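/- \textbf{Definitions.} A \emph{promise problem} is a pair $(L_{\mathrm{yes}},L_{\mathrm{no}})$ of disjoint sets of binary strings (a language $L$ is the case $L_{\mathrm{yes}}=L$, $L_{\mathrm{no}}=\{0,1\}^*\setminus L$). It is in $\mathsf{PSPACE}$ if some deterministic Turing machine, on every input $x\in L_{\mathrm{yes}}\cup L_{\mathrm{no}}$, halts after using at most $p(|x|)$ tape cells, for a fixed polynomial $p$, accepting if $x\in L_{\mathrm{yes}}$ and rejecting if $x\in L_{\mathrm{no}}$. A promise problem $Q$ is $\mathsf{PSPACE}$\emph{-hard} if for every promise problem $L$ in $\mathsf{PSPACE}$ there is a polynomial-time computable function $f$ on binary strings with $f(L_{\mathrm{yes}})\subseteq Q_{\mathrm{yes}}$ and $f(L_{\mathrm{no}})\subseteq Q_{\mathrm{no}}$. A \emph{succinct encoding} of a $2^m\times 2^m$ matrix $A$, with rows and columns indexed by $\{0,1\}^m$, is (the binary description of) a Boolean circuit with $m$ input bits which, given a row index $i$, outputs a list of pairs $(j,v)$ whose members with $v\neq 0$ are exactly the pairs $(j,A_{ij})$ with $A_{ij}\ne 0$. (Thus $m$, the size of the circuit and the number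 of nonzero entries in each row are at most polynomial in the length of the description.) For a polynomial $g$ with nonnegative integer coefficients, $\mathrm{GappedSuccinctDet}_g$ is the following promise problem. The input, of length $n$, is a succinct encoding of a symmetric positive semidefinite matrix $A$ whose entries all lie in $\{0,1,2\}$, and whose smallest eigenvalue $\lambda_{\min}(A)$ is promised to be either $0$ or at least $2^{-g(n)}$. The YES instances are those with $\lambda_{\min}(A)=0$, the NO instances those with $\lambda_{\min}(A)\ge 2^{-g(n)}$. \textbf{Theorem.} There is a polynomial $g$ such that $\mathrm{GappedSuccinctDet}_g$ is $\mathsf{PSPACE}$-hard. -/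

import Mathlib

namespace GappedSuccinct

/-! ### Promise problems, polynomial space, polynomial-time reductions -/

/-- A promise problem over binary strings. A language `S` is the case `no = yesᶜ`. -/
structure PromiseProblem where
  yes : Set (List Bool)
  no : Set (List Bool)
  disjoint : Disjoint yes no

/-- The initial configuration of the machine `M` on the binary input `x`. -/
def initCfg (M : Turing.TM2ComputableAux Bool Bool) (x : List Bool) : M.tm.Cfg :=
  Turing.initList M.tm (x.map M.inputAlphabet.invFun)

/-- The space occupied by a configuration: the total number of cells in use on all tapes (stacks),
including the input and the output one. -/
def cfgSpace (tm : Turing.FinTM2) (c : Turing.TM2.Cfg tm.Γ tm.Λ tm.σ) : ℕ :=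
  letI := tm.kFin
  ∑ k : tm.K, (c.stk k).length

/-- On input `x`, the deterministic machine `M` halts with the single bit `b` as its output, and no
configuration that it passes through occupies more than `s` cells. -/
def AnswersInSpace (M : Turing.TM2ComputableAux Bool Bool) (x : List Bool) (b : Bool) (s : ℕ) :
    Prop :=
  Nonempty (Turing.TM2Outputs M.tm (x.map M.inputAlphabet.invFun)
      (some ([b].map M.outputAlphabet.invFun))) ∧
    ∀ c : M.tm.Cfg, StateTransition.Reaches M.tm.step (initCfg M x) c → cfgSpace M.tm c ≤ s

/-- `L` is decided by a deterministic Turing machine in polynomial space. Nothing is asked of the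
machine on inputs outside the promise. -/
def InPSPACE (L : PromiseProblem) : Prop :=
  ∃ (M : Turing.TM2ComputableAux Bool Bool) (p : Polynomial ℕ),
    (∀ k, Finite (M.tm.Γ k)) ∧
    (∀ x ∈ L.yes, AnswersInSpace M x true (p.eval x.length)) ∧
    (∀ x ∈ L.no, AnswersInSpace M x false (p.eval x.length))

/-- `f` is computed by a deterministic Turing machine with finite tape alphabets in polynomial
time. -/
def PolyTime (f : List Bool → List Bool) : Prop :=
  ∃ M : Turing.TM2ComputableInPolyTime (id : List Bool → List Bool) (id : List Bool → List Bool) f,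
    ∀ k, Finite (M.tm.Γ k)

/-- Polynomial-time many-one (Karp) reducibility between promise problems. -/
def PolyTimeReduces (L Q : PromiseProblem) : Prop :=
  ∃ f : List Bool → List Bool, PolyTime f ∧
    (∀ x ∈ L.yes, f x ∈ Q.yes) ∧ (∀ x ∈ L.no, f x ∈ Q.no)

/-- Every promise problem in `PSPACE`, in particular every language in it, reduces to `Q`. -/
def PSPACEHard (Q : PromiseProblem) : Prop :=
  ∀ L : PromiseProblem, InPSPACE L → PolyTimeReduces L Q

/-! ### Boolean circuits -/

/-- A gate of a Boolean circuit; the arguments are numbers of earlier wires. -/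
inductive Gate where
  | const (b : Bool)
  | not (i : ℕ)
  | and (i j : ℕ)
  | or (i j : ℕ)

/-- The value of a gate, given the values of the earlier wires. -/
def Gate.eval (w : List Bool) : Gate → Bool
  | .const b => b
  | .not i => !(w.getD i false)
  | .and i j => w.getD i false && w.getD j false
  | .or i j => w.getD i false || w.getD j false

/-- All arguments of the gate are among the first `n` wires. -/
def Gate.ArgsBelow (n : ℕ) : Gate → Prop
  | .const _ => True
  | .not i => i < n
  | .and i j => i < n ∧ j < n
  | .or i j => i < n ∧ j < n

/-- A Boolean circuit with `arity` input bits. Wires `0, …, arity - 1` carry the input, wire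
`arity + t` carries the value of the `t`-th gate, and `outputs` lists the output wires. -/
structure Circuit where
  arity : ℕ
  gates : List Gate
  outputs : List ℕ

namespace Circuit

/-- Every gate refers to earlier wires only, and every output wire exists. -/
def WellFormed (C : Circuit) : Prop :=
  (∀ (t : ℕ) (ht : t < C.gates.length), (C.gates[t]).ArgsBelow (C.arity + t)) ∧
    ∀ o ∈ C.outputs, o < C.arity + C.gates.length

/-- The values of all wires on input `x`. -/
def wires (C : Circuit) (x : Fin C.arity → Bool) : List Bool :=
  C.gates.foldl (fun w g => w ++ [g.eval w]) (List.ofFn x)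

/-- The output bits on input `x`. -/
def eval (C : Circuit) (x : Fin C.arity → Bool) : List Bool :=
  C.outputs.map fun o => (C.wires x).getD o false

end Circuit

/-! ### Encoding circuits by binary strings -/

/-- Unary code of a natural number. Wire numbers never exceed the size of a circuit, so that unary
codes are at most polynomially longer than binary ones. -/
def encodeNat (n : ℕ) : List Bool :=
  List.replicate n true ++ [false]

/-- Code of a list: each item is preceded by `true`, the end is marked by `false`. -/
def encodeList {α : Type} (e : α → List Bool) : List α → List Bool
  | [] => [false]
  | a :: l => true :: (e a ++ encodeList e l)

/-- Code of a gate: a two-bit tag followed by the arguments. -/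
def Gate.encode : Gate → List Bool
  | .const b => [false, false, b]
  | .not i => [false, true] ++ encodeNat i
  | .and i j => [true, false] ++ (encodeNat i ++ encodeNat j)
  | .or i j => [true, true] ++ (encodeNat i ++ encodeNat j)

/-- Code of a circuit. -/
def Circuit.encode (C : Circuit) : List Bool :=
  encodeNat C.arity ++ (encodeList Gate.encode C.gates ++ encodeList encodeNat C.outputs)

/-- A code can be read off the beginning of a longer string in only one way. -/
def PrefixInjective {α : Type} (e : α → List Bool) : Prop :=
  ∀ a b s t, e a ++ s = e b ++ t → a = b ∧ s = t

theorem encodeNat_prefixInjective : PrefixInjective encodeNat := by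
  intro a
  induction a with
  | zero =>
    intro b s t h
    cases b with
    | zero => simpa [encodeNat] using h
    | succ b => simp [encodeNat, List.replicate_succ] at h
  | succ a ih =>
    intro b s t h
    cases b with
    | zero => simp [encodeNat, List.replicate_succ] at h
    | succ b =>
      have h' : encodeNat a ++ s = encodeNat b ++ t := by
        simpa [encodeNat, List.replicate_succ] using h
      obtain ⟨h1, h2⟩ := ih b s t h'
      exact ⟨by rw [h1], h2⟩

theorem encodeList_prefixInjective {α : Type} {e : α → List Bool} (he : PrefixInjective e) :
    PrefixInjective (encodeList e) := by
  intro a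
  induction a with
  | nil =>
    intro b s t h
    cases b with
    | nil => simpa [encodeList] using h
    | cons y b => simp [encodeList] at h
  | cons x a ih =>
    intro b s t h
    cases b with
    | nil => simp [encodeList] at h
    | cons y b =>
      have h' : e x ++ (encodeList e a ++ s) = e y ++ (encodeList e b ++ t) := by
        simpa [encodeList] using h
      obtain ⟨h1, h2⟩ := he _ _ _ _ h'
      obtain ⟨h3, h4⟩ := ih _ _ _ h2
      exact ⟨by rw [h1, h3], h4⟩

theorem gateEncode_prefixInjective : PrefixInjective Gate.encode := by
  intro a b s t h
  have key2 : ∀ i j i' j' : ℕ, encodeNat i ++ (encodeNat j ++ s) =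
      encodeNat i' ++ (encodeNat j' ++ t) → i = i' ∧ j = j' ∧ s = t := by
    intro i j i' j' h
    obtain ⟨h1, h2⟩ := encodeNat_prefixInjective _ _ _ _ h
    exact ⟨h1, encodeNat_prefixInjective _ _ _ _ h2⟩
  cases a <;> cases b <;> simp [Gate.encode] at h
  · exact ⟨by rw [h.1], h.2⟩
  · obtain ⟨h1, h2⟩ := encodeNat_prefixInjective _ _ _ _ h
    exact ⟨by rw [h1], h2⟩
  · obtain ⟨h1, h2, h3⟩ := key2 _ _ _ _ h
    exact ⟨by rw [h1, h2], h3⟩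
  · obtain ⟨h1, h2, h3⟩ := key2 _ _ _ _ h
    exact ⟨by rw [h1, h2], h3⟩

theorem circuitEncode_injective : Function.Injective Circuit.encode := by
  rintro ⟨m, gs, os⟩ ⟨m', gs', os'⟩ h
  obtain ⟨h1, h2⟩ := encodeNat_prefixInjective _ _ _ _ h
  obtain ⟨h3, h4⟩ := encodeList_prefixInjective gateEncode_prefixInjective _ _ _ _ h2
  obtain ⟨h5, -⟩ := encodeList_prefixInjective encodeNat_prefixInjective os os' [] []
    (by simpa using h4)
  simp only at h1 h3
  rw [h1, h3, h5]

/-! ### Succinctly encoded sparse matrices -/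

namespace Circuit

/-- The matrices encoded by `C` are indexed by binary strings of length `C.arity`, so their size is
`2 ^ C.arity`. -/
abbrev Index (C : Circuit) : Type := Fin C.arity → Bool

/-- On input a row index, the output of the circuit is divided into consecutive slots of
`C.arity + 2` bits: two bits for a value in `{0, 1, 2, 3}` (the low bit first), then the
`C.arity` bits of a column index. -/
def slotValue (C : Circuit) (i : C.Index) (s : ℕ) : ℕ :=
  ((C.eval i).getD (s * (C.arity + 2)) false).toNat +
    2 * ((C.eval i).getD (s * (C.arity + 2) + 1) false).toNat

/-- The column index written in slot `s` of the output on row `i`. -/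
def slotColumn (C : Circuit) (i : C.Index) (s : ℕ) : C.Index :=
  fun b => (C.eval i).getD (s * (C.arity + 2) + 2 + b) false

/-- The number of slots. It bounds the number of nonzero entries in each row, and is at most the
length of the code of `C`. -/
def numSlots (C : Circuit) : ℕ := C.outputs.length / (C.arity + 2)

/-- `C` is a succinct encoding of the sparse matrix `A`: on input a row index `i` it outputs the
nonzero entries of the row `i`, with their columns. Slots with the value `0` are unused. -/
def Represents (C : Circuit) (A : Matrix C.Index C.Index ℕ) : Prop :=
  C.WellFormed ∧ (C.arity + 2) ∣ C.outputs.length ∧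
    ∀ (i j : C.Index) (v : ℕ), v ≠ 0 →
      (A i j = v ↔ ∃ s < C.numSlots, C.slotColumn i s = j ∧ C.slotValue i s = v)

theorem Represents.unique {C : Circuit} {A B : Matrix C.Index C.Index ℕ} (hA : C.Represents A)
    (hB : C.Represents B) : A = B := by
  ext i j
  have h : ∀ v, v ≠ 0 → (A i j = v ↔ B i j = v) := fun v hv =>
    (hA.2.2 i j v hv).trans (hB.2.2 i j v hv).symm
  by_cases h0 : A i j = 0
  · by_contra hne
    exact hne ((h (B i j) (fun hb => hne (h0.trans hb.symm))).2 rfl)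
  · exact ((h _ h0).1 rfl).symm

end Circuit

/-! ### The problem `GappedSuccinctDet` -/

/-- `r` is the smallest eigenvalue of the real matrix `A`. -/
def IsSmallestEigenvalue {ι : Type} [Fintype ι] [DecidableEq ι] (A : Matrix ι ι ℝ) (r : ℝ) :
    Prop :=
  IsLeast {μ : ℝ | Module.End.HasEigenvalue (Matrix.toLin' A) μ} r

/-- The string `w` is a succinct encoding of a symmetric positive semidefinite matrix with entries
in `{0, 1, 2}` and with smallest eigenvalue `r`. -/
def EncodesPSDWithSmallestEigenvalue (w : List Bool) (r : ℝ) : Prop :=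
  ∃ (C : Circuit) (A : Matrix C.Index C.Index ℕ),
    C.encode = w ∧ C.Represents A ∧
    (∀ i j, A i j = 0 ∨ A i j = 1 ∨ A i j = 2) ∧
    A.IsSymm ∧ (A.map (Nat.cast : ℕ → ℝ)).PosSemidef ∧
    IsSmallestEigenvalue (A.map (Nat.cast : ℕ → ℝ)) r

theorem EncodesPSDWithSmallestEigenvalue.unique {w : List Bool} {r r' : ℝ}
    (h : EncodesPSDWithSmallestEigenvalue w r) (h' : EncodesPSDWithSmallestEigenvalue w r') :
    r = r' := by
  obtain ⟨C, A, hC, hA, -, -, -, hr⟩ := h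
  obtain ⟨C', A', hC', hA', -, -, -, hr'⟩ := h'
  obtain rfl : C = C' := circuitEncode_injective (hC.trans hC'.symm)
  obtain rfl : A = A' := hA.unique hA'
  exact IsLeast.unique hr hr'

/-- The promise problem `GappedSuccinctDet` with gap `2 ^ (-g(n))`, where `n` is the length of the
input: given a succinct encoding of a sparse symmetric positive semidefinite matrix with entries in
`{0, 1, 2}` whose smallest eigenvalue is either `0` (YES) or at least `2 ^ (-g(n))` (NO), decide
which is the case. -/
def GappedSuccinctDet (g : Polynomial ℕ) : PromiseProblem where
  yes := {w | EncodesPSDWithSmallestEigenvalue w 0}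
  no := {w | ∃ r : ℝ, EncodesPSDWithSmallestEigenvalue w r ∧ ((2 : ℝ) ^ g.eval w.length)⁻¹ ≤ r}
  disjoint := by
    rw [Set.disjoint_left]
    rintro w hw ⟨r, hr, hle⟩
    have h0 : (0 : ℝ) = r := EncodesPSDWithSmallestEigenvalue.unique hw hr
    have hpos : (0 : ℝ) < ((2 : ℝ) ^ g.eval w.length)⁻¹ := by positivity
    linarith

end GappedSuccinct

/-! The configurations of a polynomial-space machine, paired with a clock, form a forest under the
successor map, and the question is whether the path from the initial vertex `s` ends in an accepting
root. A matrix is attached whose kernel detects this. Every vertex indexes one column of an unsigned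
incidence matrix N: a vertex that is no root gives the edge to its successor, an accepting root
gives a half-edge at itself, a rejecting root is parked on a private vertex of its own, and one
spare index `h` gives a half-edge at `s`. The matrix is the Gram matrix NᵀN, which is positive
semidefinite and has entries at most 2.

If the path from `s` accepts, it carries half-edges at both ends, and the alternating sum of its
columns vanishes (`Forest.exists_inc_mulVec_eq`). If it rejects, every tree has at most one
half-edge, so N is injective. Quantitatively, pairing Nz with the alternating sign vector of the
subtree below `v` cancels all edges except the one that leaves `v` and the half-edge at `s`
(`Forest.sum_below`). This gives |z e| ≤ 2‖Nz‖₁, hence a smallest eigenvalue of at least 1/(8|E|²),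
where |E| is two to the number of index bits.

The rows must be sparse and easy to list although the successor map is not injective. The machine is
therefore replaced by one whose head stays at column 0 while the tracks of a cyclic tape rotate
(`exists_rotMachine`), and each step is split into two phases. Rewriting may merge configurations
but touches only boundedly many bits; moving affects the whole tape but is a bijection. So all
neighbours of an edge are obtained by replacing the local bits, by one forward move or by one
backward move: a number of candidates that depends on the machine only (`RotMachine.gram_eq_iff`).
The clock makes the graph acyclic, and runs long enough for a halting computation to have reached
its fixed point.

The circuit for the rows consists of a chain of gates repeated along the clock and tables of
constant size. Its code is a text with loops over a few registers (`SCircuit.itemsText_items`), and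
such a text is printed by a stack machine in polynomial time (`Prepared.polyTime`). -/

namespace GappedSuccinct

open Function

/-! ### Structured stack programs and their compilation to Turing machines -/

/-- Structured programs over a family of binary stacks. `loop k P` pops the stack `k` until it is
empty, and runs `P b` for every popped bit `b`. -/
inductive Prog (K : Type) where
  | skip
  | push (k : K) (b : Bool)
  | seq (P Q : Prog K)
  | loop (k : K) (P : Bool → Prog K)

namespace Prog

variable {K : Type}

/-- The control points of a program. -/
def Lab : Prog K → Type
  | skip => Empty
  | push _ _ => Unit
  | seq P Q => Lab P ⊕ Lab Q
  | loop _ P => Option (Lab (P true) ⊕ Lab (P false))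

theorem finite_lab : ∀ P : Prog K, Finite P.Lab
  | skip => inferInstanceAs (Finite Empty)
  | push _ _ => inferInstanceAs (Finite Unit)
  | seq P Q =>
    haveI := finite_lab P
    haveI := finite_lab Q
    inferInstanceAs (Finite (Lab P ⊕ Lab Q))
  | loop _ P =>
    haveI := finite_lab (P true)
    haveI := finite_lab (P false)
    inferInstanceAs (Finite (Option (Lab (P true) ⊕ Lab (P false))))

/-- The label at which the program is entered, if its control points are embedded by `e` and it
leaves to the label `exit`. -/
def entry {L : Type} : (P : Prog K) → (P.Lab → L) → L → L
  | skip, _, exit => exit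
  | push _ _, e, _ => e ()
  | seq P Q, e, exit => entry P (fun l => e (.inl l)) (entry Q (fun l => e (.inr l)) exit)
  | loop _ _, e, _ => e none

/-- The statements of the machine that runs the program. -/
def code {L : Type} : (P : Prog K) → (P.Lab → L) → L → P.Lab →
    Turing.TM2.Stmt (fun _ : K => Bool) L (Option Bool)
  | skip, _, _, l => nomatch l
  | push k b, _, exit, _ => .push k (fun _ => b) (.goto fun _ => exit)
  | seq P Q, e, exit, .inl l =>
    code P (fun l => e (.inl l)) (entry Q (fun l => e (.inr l)) exit) l
  | seq _ Q, e, exit, .inr l => code Q (fun l => e (.inr l)) exit l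
  | loop k P, e, exit, none => .pop k (fun _ o => o) (.goto fun v => match v with
      | none => exit
      | some true => entry (P true) (fun l => e (some (.inl l))) (e none)
      | some false => entry (P false) (fun l => e (some (.inr l))) (e none))
  | loop _ P, e, _, some (.inl l) => code (P true) (fun l => e (some (.inl l))) (e none) l
  | loop _ P, e, _, some (.inr l) => code (P false) (fun l => e (some (.inr l))) (e none) l

theorem iterate_trans {α : Type} {f : α → Option α} {a b : α} {c : Option α} {t t' : ℕ}
    (h : (flip bind f)^[t] (some a) = some b) (h' : (flip bind f)^[t'] (some b) = c) :
    (flip bind f)^[t + t'] (some a) = c := by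
  rw [add_comm, iterate_add_apply, h, h']

variable [DecidableEq K]

/-- Big-step semantics: `Exec P s s' t` says that `P` transforms `s` into `s'` in `t` steps. -/
inductive Exec : Prog K → (K → List Bool) → (K → List Bool) → ℕ → Prop
  | skip (s) : Exec skip s s 0
  | push (k b s) : Exec (push k b) s (update s k (b :: s k)) 1
  | seq {P Q s s' s'' t t'} : Exec P s s' t → Exec Q s' s'' t' → Exec (seq P Q) s s'' (t + t')
  | loop_nil {k P s} : s k = [] → Exec (loop k P) s s 1
  | loop_cons {k P s b l s' s'' t u} : s k = b :: l → Exec (P b) (update s k l) s' t →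
      Exec (loop k P) s' s'' u → Exec (loop k P) s s'' (t + u + 1)

/-- A machine that contains the code of `P` executes `P`. -/
theorem Exec.runs {L : Type} {m : L → Turing.TM2.Stmt (fun _ : K => Bool) L (Option Bool)}
    {P : Prog K} {s s' : K → List Bool} {t : ℕ} (h : Exec P s s' t) :
    ∀ (e : P.Lab → L) (exit : L), (∀ l, m (e l) = code P e exit l) → ∀ v, ∃ v',
      (flip bind (Turing.TM2.step m))^[t]
        (some (⟨some (entry P e exit), v, s⟩ : Turing.TM2.Cfg (fun _ : K => Bool) L (Option Bool)))
        = some ⟨some exit, v', s'⟩ := by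
  induction h with
  | skip s => exact fun e exit _ v => ⟨v, rfl⟩
  | push k b s =>
    intro e exit hm v
    refine ⟨v, ?_⟩
    have := hm ()
    simp [flip, entry, this, code]
  | @seq P Q s s' s'' t t' _ _ ih ih' =>
    intro e exit hm v
    obtain ⟨v', h⟩ := ih (fun l => e (.inl l)) (entry Q (fun l => e (.inr l)) exit)
      (fun l => hm (.inl l)) v
    obtain ⟨v'', h'⟩ := ih' (fun l => e (.inr l)) exit (fun l => hm (.inr l)) v'
    exact ⟨v'', iterate_trans h h'⟩
  | @loop_nil k P s hs =>
    intro e exit hm v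
    refine ⟨none, ?_⟩
    have := hm none
    -- Popping an empty stack stores the empty tail, which changes nothing.
    have h2 : update s k [] = s := by rw [← hs, update_eq_self]
    simp [flip, entry, this, code, hs, h2]
  | @loop_cons k P s b l s' s'' t t' hs _ _ ih ih' =>
    intro e exit hm v
    have h0 := hm none
    obtain ⟨v', h⟩ : ∃ v', (flip bind (Turing.TM2.step m))^[1 + t]
        (some (⟨some (entry (loop k P) e exit), v, s⟩ :
          Turing.TM2.Cfg (fun _ : K => Bool) L (Option Bool))) = some ⟨some (e none), v', s'⟩ := by
      -- The popped bit selects the body to enter; both bodies have the head of the loop as their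
      -- exit.
      cases b with
      | true =>
        obtain ⟨v', h⟩ := ih (fun l => e (some (.inl l))) (e none)
          (fun l => hm (some (.inl l))) (some true)
        exact ⟨v', iterate_trans (by simp [flip, entry, h0, code, hs]) h⟩
      | false =>
        obtain ⟨v', h⟩ := ih (fun l => e (some (.inr l))) (e none)
          (fun l => hm (some (.inr l))) (some false)
        exact ⟨v', iterate_trans (by simp [flip, entry, h0, code, hs]) h⟩
    obtain ⟨v'', h'⟩ := ih' e exit hm v'
    refine ⟨v'', ?_⟩
    rw [show t + t' + 1 = 1 + t + t' by ring]
    exact iterate_trans h h'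

/-- A step pushes at most one bit. Bounds on running times therefore yield bounds on the lengths of
registers and of printed texts. -/
theorem Exec.length_le {P : Prog K} {s s' : K → List Bool} {t : ℕ} (h : Exec P s s' t) (k : K) :
    (s' k).length ≤ (s k).length + t := by
  induction h with
  | skip s => simp
  | push k' b s =>
    by_cases hk : k = k'
    · subst hk; simp
    · simp [hk]
  | seq _ _ ih ih' => omega
  | loop_nil _ => omega
  | @loop_cons k' P s b l s' s'' t t' hs _ _ ih ih' =>
    by_cases hk : k = k'
    · subst hk
      simp only [update_self, hs, List.length_cons] at *
      omega
    · simp only [update_of_ne hk] at ih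
      omega

/-- Stacks which are empty except for one. -/
def only (k : K) (x : List Bool) : K → List Bool := update (fun _ => []) k x

open Classical in
/-- The machine that runs the program `P`, with input stack `k₀` and output stack `k₁`. -/
noncomputable def machine [Fintype K] (P : Prog K) (k₀ k₁ : K) : Turing.FinTM2 :=
  haveI := finite_lab P
  letI := Fintype.ofFinite P.Lab
  { K := K
    k₀ := k₀
    k₁ := k₁
    Γ := fun _ => Bool
    Λ := Option P.Lab
    main := entry P some none
    σ := Option Bool
    initialState := none
    m := fun l => match l with
      | none => .load (fun _ => none) .halt
      | some l => code P some none l }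

theorem initList_machine [Fintype K] (P : Prog K) (k₀ k₁ : K) (x : List Bool) :
    Turing.initList (machine P k₀ k₁) x = (⟨some (entry P some none), none, only k₀ x⟩ :
      Turing.TM2.Cfg (fun _ : K => Bool) (Option P.Lab) (Option Bool)) := by
  refine congrArg (Turing.TM2.Cfg.mk _ _) (funext fun (k : K) => ?_)
  change (dite (k = k₀) _ _ : List Bool) = _
  by_cases hk : k = k₀
  · subst hk; simp [only]; rfl
  · simp [only, hk]; rfl

theorem haltList_machine [Fintype K] (P : Prog K) (k₀ k₁ : K) (x : List Bool) :
    Turing.haltList (machine P k₀ k₁) x = (⟨none, none, only k₁ x⟩ :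
      Turing.TM2.Cfg (fun _ : K => Bool) (Option P.Lab) (Option Bool)) := by
  refine congrArg (Turing.TM2.Cfg.mk _ _) (funext fun (k : K) => ?_)
  change (dite (k = k₁) _ _ : List Bool) = _
  by_cases hk : k = k₁
  · subst hk; simp [only]; rfl
  · simp [only, hk]; rfl

/-- A function computed by a program in polynomial time is computed by a Turing machine in
polynomial time. -/
theorem polyTime_of_exec [Fintype K] (P : Prog K) (k₀ k₁ : K) (f : List Bool → List Bool)
    (p : Polynomial ℕ)
    (h : ∀ x, ∃ t ≤ p.eval x.length, Exec P (only k₀ x) (only k₁ (f x)) t) : PolyTime f := by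
  choose t ht hP using h
  -- The extra step executes the label `none`, which resets the internal state, as a halting
  -- configuration requires, and halts.
  have key : ∀ x, (flip bind (machine P k₀ k₁).step)^[t x + 1]
      (some (Turing.initList (machine P k₀ k₁) x)) =
        some (Turing.haltList (machine P k₀ k₁) (f x)) := by
    intro x
    obtain ⟨v, hv⟩ := Exec.runs (m := (machine P k₀ k₁).m) (hP x) some none (fun l => rfl) none
    rw [initList_machine, haltList_machine]
    exact iterate_trans hv rfl
  refine ⟨{ tm := machine P k₀ k₁, inputAlphabet := Equiv.refl Bool,
            outputAlphabet := Equiv.refl Bool, time := p + 1,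
            outputsFun := fun x => ⟨⟨t x + 1, ?_⟩, ?_⟩ }, fun k => (inferInstance : Finite Bool)⟩
  · have hx : List.map (Equiv.refl Bool).invFun (id x) = x := List.map_id x
    have hf : List.map (Equiv.refl Bool).invFun (id (f x)) = f x := List.map_id _
    exact (congrArg (fun y => (flip bind (machine P k₀ k₁).step)^[t x + 1]
      (some (Turing.initList (machine P k₀ k₁) y))) hx).trans ((key x).trans
        (congrArg (fun y => some (Turing.haltList (machine P k₀ k₁) y)) hf.symm))
  · simpa using ht x

end Prog

end GappedSuccinct

namespace GappedSuccinct

open Function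

/-! ### Emitting strings with loops -/

namespace Prog

variable {K : Type} [DecidableEq K]

/-- `P` transforms `s` into `s'` in at most `T` steps. -/
def ExecLE (P : Prog K) (s s' : K → List Bool) (T : ℕ) : Prop := ∃ t ≤ T, Exec P s s' t

theorem ExecLE.mono {P : Prog K} {s s' : K → List Bool} {T T' : ℕ} (h : ExecLE P s s' T)
    (hT : T ≤ T') : ExecLE P s s' T' :=
  let ⟨t, ht, h⟩ := h
  ⟨t, ht.trans hT, h⟩

theorem execLE_skip (s : K → List Bool) : ExecLE skip s s 0 := ⟨0, le_rfl, .skip s⟩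

theorem execLE_push (k : K) (b : Bool) (s : K → List Bool) :
    ExecLE (push k b) s (update s k (b :: s k)) 1 := ⟨1, le_rfl, .push k b s⟩

theorem ExecLE.seq {P Q : Prog K} {s s' s'' : K → List Bool} {T T' : ℕ} (h : ExecLE P s s' T)
    (hQ : ExecLE Q s' s'' T') : ExecLE (seq P Q) s s'' (T + T') :=
  let ⟨_, ht, h⟩ := h
  let ⟨_, ht', hQ⟩ := hQ
  ⟨_, add_le_add ht ht', h.seq hQ⟩

/-- Total correctness of a loop over the stack `k`; `S d l` is the state in which the bits `d` have
been processed and the bits `l` are left. -/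
theorem execLE_loop {k : K} {P : Bool → Prog K} (S : List Bool → List Bool → K → List Bool)
    (hk : ∀ d l, S d l k = l) (c : ℕ) (l : List Bool) :
    ∀ d, (∀ d' b l', d' ++ b :: l' = d ++ l →
      ExecLE (P b) (update (S d' (b :: l')) k l') (S (d' ++ [b]) l') c) →
    ExecLE (loop k P) (S d l) (S (d ++ l) []) ((c + 1) * l.length + 1) := by
  induction l with
  | nil =>
    intro d _
    rw [List.append_nil]
    exact ⟨1, by simp, .loop_nil (hk _ _)⟩
  | cons b l ih =>
    intro d h
    obtain ⟨t, ht, h1⟩ := h d b l rfl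
    obtain ⟨t', ht', h2⟩ := ih (d ++ [b]) (by simpa using h)
    rw [List.append_assoc, List.singleton_append] at h2
    refine ⟨_, ?_, .loop_cons (hk _ _) h1 h2⟩
    rw [List.length_cons, mul_add]
    omega

end Prog

/-- Registers that hold the parameters of the emitted text; `idx` is the running index of loops. -/
inductive Par where
  | inp | base | pow | pat | cols | idx
  deriving DecidableEq

instance : Fintype Par where
  elems := {.inp, .base, .pow, .pat, .cols, .idx}
  complete p := by cases p <;> simp

/-- All stacks of the emitting machine. -/
inductive Reg where
  | par (p : Par) | out | tmp | cnt | fin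
  deriving DecidableEq

instance : Fintype Reg where
  elems := {.out, .tmp, .cnt, .fin} ∪ Finset.univ.image .par
  complete k := by cases k <;> simp

/-- An atom of text: a bit, or the length of a register in unary. -/
inductive Atom where
  | lit (b : Bool)
  | reg (p : Par)

/-- An item of text: an atom, or a loop over the bits of a register. -/
inductive Item where
  | atom (a : Atom)
  | loop (p : Par) (body : Bool → List Atom)

/-- The text of an atom. -/
def Atom.text (ρ : Par → List Bool) : Atom → List Bool
  | lit b => [b]
  | reg p => List.replicate (ρ p).length true

/-- The text of a list of atoms. -/
def atomsText (ρ : Par → List Bool) (as : List Atom) : List Bool := as.flatMap (Atom.text ρ)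

/-- The text of the loop body, over the remaining bits `l`, with index starting from `i`. -/
def loopText (ρ : Par → List Bool) (body : Bool → List Atom) : ℕ → List Bool → List Bool
  | _, [] => []
  | i, b :: l => atomsText (update ρ .idx (List.replicate i true)) (body b) ++
      loopText ρ body (i + 1) l

/-- The text of an item. -/
def Item.text (ρ : Par → List Bool) : Item → List Bool
  | atom a => a.text ρ
  | loop p body => loopText ρ body 0 (ρ p)

/-- The text of a list of items. -/
def itemsText (ρ : Par → List Bool) (is : List Item) : List Bool := is.flatMap (Item.text ρ)

namespace Reg

/-- The contents of all stacks. -/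
def state (ρ : Par → List Bool) (o u c f : List Bool) : Reg → List Bool
  | par p => ρ p
  | out => o
  | tmp => u
  | cnt => c
  | fin => f

variable (ρ : Par → List Bool) (o u c f l : List Bool)

@[simp] theorem update_state_par (p : Par) :
    update (state ρ o u c f) (par p) l = state (update ρ p l) o u c f := by
  funext k
  cases k with
  | par q => by_cases h : q = p <;> simp [state, update, h]
  | _ => simp [state, update]

@[simp] theorem update_state_out : update (state ρ o u c f) out l = state ρ l u c f := by
  funext k; cases k <;> simp [state, update]

@[simp] theorem update_state_tmp : update (state ρ o u c f) tmp l = state ρ o l c f := by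
  funext k; cases k <;> simp [state, update]

@[simp] theorem update_state_cnt : update (state ρ o u c f) cnt l = state ρ o u l f := by
  funext k; cases k <;> simp [state, update]

@[simp] theorem update_state_fin : update (state ρ o u c f) fin l = state ρ o u c l := by
  funext k; cases k <;> simp [state, update]

@[simp] theorem state_par (p : Par) : state ρ o u c f (par p) = ρ p := rfl
@[simp] theorem state_out : state ρ o u c f out = o := rfl
@[simp] theorem state_tmp : state ρ o u c f tmp = u := rfl
@[simp] theorem state_cnt : state ρ o u c f cnt = c := rfl
@[simp] theorem state_fin : state ρ o u c f fin = f := rfl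

end Reg

/-! ### Programs that print text, and their running times -/

open Prog Reg

/-- The program that emits an atom. -/
def Atom.prog : Atom → Prog Reg
  | lit b => .push out b
  | reg p => .seq (.loop (par p) fun b => .seq (.push tmp b) (.push out true))
      (.loop tmp fun b => .push (par p) b)

/-- Run a list of programs in turn. -/
def seqAll : List (Prog Reg) → Prog Reg
  | [] => .skip
  | P :: l => .seq P (seqAll l)

/-- The program that emits an item. -/
def Item.prog : Item → Prog Reg
  | atom a => a.prog
  | loop p body => .seq (.loop (par p) fun b => .push tmp b)
      (.seq (.loop tmp fun b => .seq (.push (par p) b) (.push cnt b))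
        (.seq (.loop cnt fun b => .seq (seqAll ((body b).map Atom.prog)) (.push (par .idx) true))
          (.loop (par .idx) fun _ => .skip)))

theorem execLE_clear (p : Par) (ρ : Par → List Bool) (o u c f : List Bool) :
    ExecLE (.loop (par p) fun _ => .skip) (state ρ o u c f) (state (update ρ p []) o u c f)
      ((ρ p).length + 1) := by
  have := execLE_loop (k := par p) (P := fun _ => .skip)
    (fun _ l => state (update ρ p l) o u c f) (by simp) 0 (ρ p) [] (by
      intro d b l _
      simpa using execLE_skip (state (update ρ p l) o u c f))
  simpa using this

/-- A register can be read only by destroying it: its bits are saved on `tmp` while the text is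
printed, and then pushed back, the two reversals cancelling. The costs are `3 * n + 1` and `2 * n +
1` for a register of length `n`. The stack `out` holds the text in reverse. -/
theorem execLE_atom (a : Atom) (ρ : Par → List Bool) (o c f : List Bool) (N : ℕ)
    (hN : ∀ p, (ρ p).length ≤ N) :
    ExecLE a.prog (state ρ o [] c f) (state ρ ((a.text ρ).reverse ++ o) [] c f) (5 * N + 2) := by
  cases a with
  | lit b =>
    have := execLE_push out b (state ρ o [] c f)
    simp only [state_out, update_state_out] at this
    exact this.mono (by omega)
  | reg p =>
    have h1 := execLE_loop (k := par p) (P := fun b => .seq (.push tmp b) (.push out true))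
      (fun d l => state (update ρ p l) (List.replicate d.length true ++ o) d.reverse c f)
      (by simp) 2 (ρ p) [] (by
        intro d b l _
        have h1 := execLE_push tmp b
          (state (update ρ p l) (List.replicate d.length true ++ o) d.reverse c f)
        have h2 := execLE_push out true
          (state (update ρ p l) (List.replicate d.length true ++ o) (b :: d.reverse) c f)
        simp only [state_tmp, update_state_tmp, state_out, update_state_out] at h1 h2
        simpa [List.replicate_succ] using h1.seq h2)
    have h2 := execLE_loop (k := tmp) (P := fun b => .push (par p) b)
      (fun d l => state (update ρ p d.reverse) (List.replicate (ρ p).length true ++ o) l c f)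
      (by simp) 1 (ρ p).reverse [] (by
        intro d b l _
        have h1 := execLE_push (par p) b
          (state (update ρ p d.reverse) (List.replicate (ρ p).length true ++ o) l c f)
        simpa using h1)
    simp only [List.nil_append, List.length_nil, List.replicate_zero, List.reverse_nil,
      update_eq_self, List.reverse_reverse, List.length_reverse] at h1 h2
    have := (h1.seq h2).mono (T' := 5 * N + 2) (by have := hN p; omega)
    simpa [Atom.text, Atom.prog] using this

theorem execLE_atoms (as : List Atom) (ρ : Par → List Bool) (c f : List Bool) (N : ℕ)
    (hN : ∀ p, (ρ p).length ≤ N) : ∀ o,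
    ExecLE (seqAll (as.map Atom.prog)) (state ρ o [] c f)
      (state ρ ((atomsText ρ as).reverse ++ o) [] c f) ((5 * N + 2) * as.length) := by
  induction as with
  | nil => intro o; exact execLE_skip _
  | cons a as ih =>
    intro o
    have := (execLE_atom a ρ o c f N hN).seq (ih _)
    simp only [atomsText, List.flatMap_cons, List.reverse_append, List.append_assoc,
      List.length_cons, List.map_cons, seqAll] at this ⊢
    exact this.mono (by rw [mul_add]; omega)

/-- The loop invariant grows at the end of the processed bits, whereas `loopText` recurses from the
front. -/
theorem loopText_append (ρ : Par → List Bool) (body : Bool → List Atom) (b : Bool)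
    (l : List Bool) : ∀ i, loopText ρ body i (l ++ [b]) = loopText ρ body i l ++
      atomsText (update ρ .idx (List.replicate (i + l.length) true)) (body b) := by
  induction l with
  | nil => intro i; simp [loopText]
  | cons b' l ih => intro i; simp [loopText, ih, show i + 1 + l.length = i + (l.length + 1) by ring]

/-- A bound for the number of atoms that matter for the running time of an item. -/
def Item.weight : Item → ℕ
  | atom _ => 1
  | loop _ body => (body true).length + (body false).length + 3

/-- The body of a loop may print the length of the very register that is looped over. The bits are
therefore copied to `cnt`, by way of `tmp`, and the loop consumes the copy; `idx` counts the rounds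
in unary and is cleared at the end. -/
theorem execLE_item (a : Item) (ρ : Par → List Bool) (hidx : ρ .idx = []) (o f : List Bool)
    (N : ℕ) (hN : ∀ p, (ρ p).length ≤ N) :
    ExecLE a.prog (state ρ o [] [] f) (state ρ ((a.text ρ).reverse ++ o) [] [] f)
      ((5 * N + 2) * (N + 1) * a.weight) := by
  cases a with
  | atom a =>
    exact (execLE_atom a ρ o [] f N hN).mono (by simp only [Item.weight]; nlinarith)
  | loop p body =>
    have h1 := execLE_loop (k := par p) (P := fun b => .push tmp b)
      (fun d l => state (update ρ p l) o d.reverse [] f) (by simp) 1 (ρ p) [] (by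
        intro d b l _
        have h1 := execLE_push tmp b (state (update ρ p l) o d.reverse [] f)
        simpa using h1)
    have h2 := execLE_loop (k := tmp) (P := fun b => .seq (.push (par p) b) (.push cnt b))
      (fun d l => state (update ρ p d.reverse) o l d.reverse f) (by simp) 2 (ρ p).reverse [] (by
        intro d b l _
        have h1 := execLE_push (par p) b (state (update ρ p d.reverse) o l d.reverse f)
        have h2 := execLE_push cnt b (state (update ρ p (b :: d.reverse)) o l d.reverse f)
        simp only [state_par, update_self, update_state_par, update_idem, state_cnt,
          update_state_cnt] at h1 h2
        simpa using h1.seq h2)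
    have h3 := execLE_loop (k := cnt)
      (P := fun b => .seq (seqAll ((body b).map Atom.prog)) (.push (par .idx) true))
      (fun d l => state (update ρ .idx (List.replicate d.length true))
        ((loopText ρ body 0 d).reverse ++ o) [] l f) (by simp)
      ((5 * N + 2) * ((body true).length + (body false).length) + 1) (ρ p) [] (by
        intro d b l hd
        have hdN : d.length ≤ N := by
          have := congrArg List.length hd
          have := hN p
          simp at *
          omega
        have h1 := execLE_atoms (body b) (update ρ .idx (List.replicate d.length true)) l f N
          (by
            intro q
            by_cases hq : q = .idx
            · subst hq; simpa using hdN
            · simpa [hq] using hN q) ((loopText ρ body 0 d).reverse ++ o)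
        have h2 := execLE_push (par .idx) true (state (update ρ .idx (List.replicate d.length true))
          ((atomsText (update ρ .idx (List.replicate d.length true)) (body b)).reverse ++
            ((loopText ρ body 0 d).reverse ++ o)) [] l f)
        simp only [state_par, update_self, update_state_par, update_idem] at h2
        have h3 := (h1.seq h2).mono
          (T' := (5 * N + 2) * ((body true).length + (body false).length) + 1) (by
            cases b <;> nlinarith)
        simpa [loopText_append, List.replicate_succ] using h3)
    have h4 := execLE_clear .idx (update ρ .idx (List.replicate (ρ p).length true))
      ((loopText ρ body 0 (ρ p)).reverse ++ o) [] [] f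
    have hid : update ρ Par.idx [] = ρ := by rw [← hidx, update_eq_self]
    simp only [List.nil_append, List.length_nil, List.replicate_zero, List.reverse_nil,
      update_eq_self, List.reverse_reverse, List.length_reverse, update_self, update_idem, hid,
      loopText, List.length_replicate] at h1 h2 h3 h4
    refine (h1.seq (h2.seq (h3.seq h4))).mono ?_
    have := hN p
    set n := (ρ p).length
    set B := (body true).length + (body false).length
    simp only [Item.weight]
    have e1 : ((5 * N + 2) * B + 1 + 1) * n ≤ ((5 * N + 2) * B + 2) * N :=
      Nat.mul_le_mul le_rfl this
    change _ ≤ (5 * N + 2) * (N + 1) * (B + 3)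
    nlinarith [Nat.zero_le ((5 * N + 2) * B), Nat.zero_le N]

/-- The program that emits a list of items. -/
def emit (is : List Item) : Prog Reg := seqAll (is.map Item.prog)

theorem execLE_emit (is : List Item) (ρ : Par → List Bool) (hidx : ρ .idx = []) (f : List Bool)
    (N : ℕ) (hN : ∀ p, (ρ p).length ≤ N) : ∀ o,
    ExecLE (emit is) (state ρ o [] [] f) (state ρ ((itemsText ρ is).reverse ++ o) [] [] f)
      ((5 * N + 2) * (N + 1) * (is.map Item.weight).sum) := by
  induction is with
  | nil => intro o; exact execLE_skip _
  | cons a is ih =>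
    intro o
    have := (execLE_item a ρ hidx o f N hN).seq (ih _)
    simp only [itemsText, List.flatMap_cons, List.reverse_append, List.append_assoc,
      List.map_cons, seqAll, emit, List.sum_cons] at this ⊢
    exact this.mono (mul_add _ _ _).ge

/-- The program `p := text of is`. -/
def assign (p : Par) (is : List Item) : Prog Reg :=
  .seq (emit is) (.seq (.loop (par p) fun _ => .skip) (.loop out fun b => .push (par p) b))

/-- The program `fin := text of is`, which clears all other registers. -/
def finish (is : List Item) : Prog Reg :=
  .seq (emit is) (.seq (.loop out fun b => .push fin b)
    (.seq (.loop (par .inp) fun _ => .skip) (.seq (.loop (par .base) fun _ => .skip)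
      (.seq (.loop (par .pow) fun _ => .skip) (.seq (.loop (par .pat) fun _ => .skip)
        (.loop (par .cols) fun _ => .skip))))))

/-! ### Polynomial bounds -/

/-- The function is bounded by a polynomial in the length of the string. -/
def PolyBdd (f : List Bool → ℕ) : Prop := ∃ q : Polynomial ℕ, ∀ x, f x ≤ q.eval x.length

theorem PolyBdd.mono {f g : List Bool → ℕ} (hg : PolyBdd g) (h : ∀ x, f x ≤ g x) : PolyBdd f :=
  let ⟨q, hq⟩ := hg
  ⟨q, fun x => (h x).trans (hq x)⟩

theorem polyBdd_const (c : ℕ) : PolyBdd fun _ => c := ⟨Polynomial.C c, fun x => by simp⟩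

theorem polyBdd_length : PolyBdd List.length := ⟨Polynomial.X, fun x => by simp⟩

theorem PolyBdd.add {f g : List Bool → ℕ} (hf : PolyBdd f) (hg : PolyBdd g) :
    PolyBdd fun x => f x + g x :=
  let ⟨q, hq⟩ := hf
  let ⟨r, hr⟩ := hg
  ⟨q + r, fun x => by simpa using add_le_add (hq x) (hr x)⟩

theorem PolyBdd.mul {f g : List Bool → ℕ} (hf : PolyBdd f) (hg : PolyBdd g) :
    PolyBdd fun x => f x * g x :=
  let ⟨q, hq⟩ := hf
  let ⟨r, hr⟩ := hg
  ⟨q * r, fun x => by simpa using Nat.mul_le_mul (hq x) (hr x)⟩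

/-- The contents of the registers, depending on the input, are of polynomial length. -/
def PolyRegs (ρ : List Bool → Par → List Bool) : Prop :=
  PolyBdd fun x => ∑ p, (ρ x p).length

theorem le_sum_length (ρ : Par → List Bool) (p : Par) : (ρ p).length ≤ ∑ p, (ρ p).length :=
  Finset.single_le_sum (f := fun p => (ρ p).length) (fun _ _ => Nat.zero_le _) (Finset.mem_univ p)

/-- `P` takes `ρ x` into `ρ' x` in polynomial time. -/
def PolyExec (P : Prog Reg) (ρ ρ' : List Bool → Par → List Bool) : Prop :=
  ∃ T, PolyBdd T ∧
    ∀ x, ExecLE P (state (ρ x) [] [] [] []) (state (ρ' x) [] [] [] []) (T x)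

theorem PolyExec.seq {P Q : Prog Reg} {ρ ρ' ρ'' : List Bool → Par → List Bool}
    (h : PolyExec P ρ ρ') (h' : PolyExec Q ρ' ρ'') : PolyExec (.seq P Q) ρ ρ'' :=
  let ⟨_, hT, h⟩ := h
  let ⟨_, hT', h'⟩ := h'
  ⟨_, hT.add hT', fun x => (h x).seq (h' x)⟩

theorem PolyExec.polyRegs {P : Prog Reg} {ρ ρ' : List Bool → Par → List Bool}
    (h : PolyExec P ρ ρ') (hρ : PolyRegs ρ) : PolyRegs ρ' := by
  obtain ⟨T, hT, h⟩ := h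
  refine (hρ.add ((polyBdd_const (Fintype.card Par)).mul hT)).mono fun x => ?_
  obtain ⟨t, ht, hx⟩ := h x
  calc ∑ p, (ρ' x p).length ≤ ∑ p, ((ρ x p).length + T x) :=
        Finset.sum_le_sum fun p _ => (hx.length_le (par p)).trans (Nat.add_le_add_left ht _)
    _ = _ := by simp [Finset.sum_add_distrib]

theorem exists_polyBdd_emit (is : List Item) {ρ : List Bool → Par → List Bool}
    (hidx : ∀ x, ρ x .idx = []) (hρ : PolyRegs ρ) : ∃ T, PolyBdd T ∧ ∀ x,
      (itemsText (ρ x) is).length ≤ T x ∧ ∀ f,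
      ExecLE (emit is) (state (ρ x) [] [] [] f)
        (state (ρ x) (itemsText (ρ x) is).reverse [] [] f) (T x) := by
  refine ⟨fun x => (5 * (∑ p, (ρ x p).length) + 2) * ((∑ p, (ρ x p).length) + 1) *
    (is.map Item.weight).sum, ?_, fun x => ?_⟩
  · exact ((((polyBdd_const 5).mul hρ).add (polyBdd_const 2)).mul
      (hρ.add (polyBdd_const 1))).mul (polyBdd_const _)
  · have h := fun f => execLE_emit is (ρ x) (hidx x) f _ (le_sum_length (ρ x)) []
    simp only [List.append_nil] at h
    refine ⟨?_, h⟩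
    obtain ⟨t, ht, h⟩ := h []
    have := h.length_le out
    simp only [state_out, List.length_reverse, List.length_nil, zero_add] at this
    exact this.trans ht

/-- The text is complete on `out` before `p` is cleared, so that it may refer to the old contents of
`p`. Moving it from `out` to `p` undoes the reversal. -/
theorem polyExec_assign (p : Par) (is : List Item) {ρ : List Bool → Par → List Bool}
    (hidx : ∀ x, ρ x .idx = []) (hρ : PolyRegs ρ) :
    PolyExec (assign p is) ρ fun x => update (ρ x) p (itemsText (ρ x) is) := by
  obtain ⟨T, hT, h⟩ := exists_polyBdd_emit is hidx hρ
  refine ⟨fun x => T x + ((∑ p, (ρ x p).length) + 1 + (2 * T x + 1)),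
    hT.add ((hρ.add (polyBdd_const 1)).add (((polyBdd_const 2).mul hT).add (polyBdd_const 1))),
    fun x => ?_⟩
  obtain ⟨hlen, h⟩ := h x
  have h1 := (execLE_clear p (ρ x) (itemsText (ρ x) is).reverse [] [] []).mono
    (Nat.add_le_add_right (le_sum_length (ρ x) p) 1)
  have h2 := execLE_loop (k := out) (P := fun b => .push (par p) b)
    (fun d l => state (update (ρ x) p d.reverse) l [] [] []) (by simp) 1
    (itemsText (ρ x) is).reverse [] (by
      intro d b l _
      have h1 := execLE_push (par p) b (state (update (ρ x) p d.reverse) l [] [] [])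
      simpa using h1)
  simp only [List.nil_append, List.reverse_nil, List.reverse_reverse, List.length_reverse] at h2
  exact (h []).seq (h1.seq (h2.mono (by omega)))

/-- An output configuration must have all stacks empty except the output stack, hence the clearing;
`idx` is empty already. -/
theorem execLE_finish (is : List Item) {ρ : List Bool → Par → List Bool}
    (hidx : ∀ x, ρ x .idx = []) (hρ : PolyRegs ρ) : ∃ T, PolyBdd T ∧ ∀ x,
      ExecLE (finish is) (state (ρ x) [] [] [] []) (only fin (itemsText (ρ x) is)) (T x) := by
  obtain ⟨T, hT, h⟩ := exists_polyBdd_emit is hidx hρ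
  refine ⟨fun x => T x + ((2 * T x + 1) + 5 * ((∑ p, (ρ x p).length) + 1)),
    hT.add ((((polyBdd_const 2).mul hT).add (polyBdd_const 1)).add
      ((polyBdd_const 5).mul (hρ.add (polyBdd_const 1)))), fun x => ?_⟩
  obtain ⟨hlen, h⟩ := h x
  have h2 := execLE_loop (k := out) (P := fun b => .push fin b)
    (fun d l => state (ρ x) l [] [] d.reverse) (by simp) 1
    (itemsText (ρ x) is).reverse [] (by
      intro d b l _
      have h1 := execLE_push fin b (state (ρ x) l [] [] d.reverse)
      simpa using h1)
  simp only [List.nil_append, List.reverse_nil, List.reverse_reverse, List.length_reverse] at h2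
  have hc := fun (p : Par) (ρ' : Par → List Bool) =>
    execLE_clear p ρ' [] [] [] (itemsText (ρ x) is)
  have h3 := (h []).seq (h2.seq ((hc .inp (ρ x)).seq ((hc .base _).seq ((hc .pow _).seq
    ((hc .pat _).seq (hc .cols _))))))
  have hfin : state (update (update (update (update (update (ρ x) .inp []) .base []) .pow [])
      .pat []) .cols []) [] [] [] (itemsText (ρ x) is) = only fin (itemsText (ρ x) is) := by
    funext k
    cases k with
    | par p => cases p <;> simp [only, update, state, hidx]
    | _ => simp [only, update, state]
  rw [hfin] at h3
  refine h3.mono ?_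
  have := le_sum_length (ρ x) .inp
  have := le_sum_length (ρ x) .base
  have := le_sum_length (ρ x) .pow
  have := le_sum_length (ρ x) .pat
  have := le_sum_length (ρ x) .cols
  simp [update] at *
  omega

end GappedSuccinct

namespace GappedSuccinct

open Matrix

/-! ### The Gram matrix of the edges of a forest -/

/-- A forest in which every live vertex `e` that is no root has an edge to `nx e`. The rank makes it
acyclic; `s` is a live vertex, and `h` a further index that is used for a half-edge at `s`. -/
structure Forest (E : Type) where
  live : E → Prop
  root : E → Prop
  acc : E → Prop
  nx : E → E
  s : E
  h : E
  rank : E → ℕ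
  live_s : live s
  not_live_h : ¬ live h
  live_nx : ∀ e, live e → ¬ root e → live (nx e)
  rank_nx : ∀ e, live e → ¬ root e → rank (nx e) = rank e + 1

namespace Forest

variable {E : Type} (G : Forest E)

open Classical in
/-- The tail of the edge with index `e`. Indices without an edge get a private vertex. -/
noncomputable def tl (e : E) : E ⊕ E :=
  if G.live e then (if G.root e ∧ ¬ G.acc e then .inr e else .inl e)
  else if e = G.h then .inl G.s else .inr e

open Classical in
/-- The head of the edge with index `e`; half-edges have none. -/
noncomputable def hd (e : E) : Option (E ⊕ E) :=
  if G.live e ∧ ¬ G.root e then some (.inl (G.nx e)) else none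

open Classical in
/-- The number of common ends of two edges. -/
noncomputable def gram : Matrix E E ℕ := fun e e' =>
  (if G.tl e = G.tl e' then 1 else 0) + (if G.hd e = some (G.tl e') then 1 else 0) +
    ((if G.hd e' = some (G.tl e) then 1 else 0) +
      (if G.hd e = G.hd e' ∧ G.hd e ≠ none then 1 else 0))

open Classical in
/-- The incidence matrix. -/
noncomputable def inc : Matrix (E ⊕ E) E ℝ := fun r e =>
  (if G.tl e = r then 1 else 0) + (if G.hd e = some r then 1 else 0)

theorem gram_comm (e e' : E) : G.gram e e' = G.gram e' e := by
  have h2 : (G.hd e = G.hd e' ∧ G.hd e ≠ none) ↔ (G.hd e' = G.hd e ∧ G.hd e' ≠ none) :=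
    ⟨fun h => ⟨h.1.symm, h.1 ▸ h.2⟩, fun h => ⟨h.1.symm, h.1 ▸ h.2⟩⟩
  classical
  unfold gram
  rw [if_congr (eq_comm (a := G.tl e) (b := G.tl e')) rfl rfl, if_congr h2 rfl rfl]
  ring

theorem gram_isSymm : G.gram.IsSymm := Matrix.ext fun i j => G.gram_comm j i

/-- One step along an edge. -/
def Step (e e' : E) : Prop := G.live e ∧ ¬ G.root e ∧ e' = G.nx e

/-- There is a directed path from `e` to `e'`. -/
def Reach : E → E → Prop := Relation.ReflTransGen G.Step

theorem Reach.rank_le {G : Forest E} {e e' : E} (h : G.Reach e e') : G.rank e ≤ G.rank e' := by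
  induction h with
  | refl => exact le_rfl
  | tail _ h ih =>
    obtain ⟨h1, h2, rfl⟩ := h
    rw [G.rank_nx _ h1 h2]
    omega

theorem Reach.live {G : Forest E} {e e' : E} (h : G.Reach e e') (he : G.live e) : G.live e' := by
  induction h with
  | refl => exact he
  | tail _ h ih =>
    obtain ⟨h1, h2, rfl⟩ := h
    exact G.live_nx _ h1 h2

theorem reach_iff_of_step {e e' v : E} (h : G.Step e e') :
    G.Reach e v ↔ e = v ∨ G.Reach e' v := by
  refine ⟨fun hr => ?_, ?_⟩
  · rcases Relation.ReflTransGen.cases_head hr with rfl | ⟨w, hw, hr⟩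
    · exact .inl rfl
    · obtain ⟨_, _, rfl⟩ := h
      obtain ⟨_, _, rfl⟩ := hw
      exact .inr hr
  · rintro (rfl | hr)
    · exact .refl
    · exact .head h hr

theorem reach_iff_of_root {e v : E} (h : G.root e) : G.Reach e v ↔ e = v := by
  refine ⟨fun hr => ?_, fun h => h ▸ .refl⟩
  rcases Relation.ReflTransGen.cases_head hr with rfl | ⟨w, hw, hr⟩
  · rfl
  · exact absurd h hw.2.1

open Classical in
/-- The alternating sum over all vertices below `v`. -/
noncomputable def below (v : E) : E ⊕ E → ℝ
  | .inl u => if G.Reach u v then (-1) ^ (G.rank v + G.rank u) else 0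
  | .inr _ => 0

theorem abs_below_le (v : E) (r : E ⊕ E) : |G.below v r| ≤ 1 := by
  classical
  cases r with
  | inl u =>
    simp only [below]
    split_ifs
    · simp
    · simp
  | inr u => simp [below]

/-! ### Kernel and lower bounds of the incidence matrix -/

variable [Fintype E]

theorem sum_mul_inc (y : E ⊕ E → ℝ) (e : E) :
    ∑ r, y r * G.inc r e = y (G.tl e) + (G.hd e).elim 0 y := by
  classical
  simp only [inc, mul_add, Finset.sum_add_distrib, mul_ite, mul_one, mul_zero]
  congr 1
  · simp
  · cases G.hd e with
    | none => simp
    | some r => simp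

/-- The inner product of two columns of the incidence matrix is found by `sum_mul_inc`, applied with
one of the columns as weight: it is evaluated at the tail and at the head of the other. -/
theorem gram_eq : G.gram.map (Nat.cast : ℕ → ℝ) = G.incᵀ * G.inc := by
  classical
  ext e e'
  rw [Matrix.mul_apply]
  simp only [Matrix.transpose_apply]
  rw [G.sum_mul_inc (fun r => G.inc r e) e']
  simp only [Matrix.map_apply, gram, inc]
  push_cast
  cases h : G.hd e' with
  | none =>
    have : ¬ (G.hd e = none ∧ G.hd e ≠ none) := fun h => h.2 h.1
    simp [this]
  | some r =>
    have h1 : (G.hd e = some r ∧ G.hd e ≠ none) = (G.hd e = some r) :=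
      propext ⟨fun h => h.1, fun h => ⟨h, by simp [h]⟩⟩
    have h2 : (some r = some (G.tl e)) = (G.tl e = r) := by simp [eq_comm]
    simp only [h1, h2, Option.elim_some]

theorem posSemidef_gram : (G.gram.map (Nat.cast : ℕ → ℝ)).PosSemidef := by
  rw [gram_eq, ← Matrix.conjTranspose_eq_transpose_of_trivial]
  exact Matrix.posSemidef_conjTranspose_mul_self _

open Classical in
/-- The indicator vector of a vertex. -/
noncomputable def delta (e : E) : E ⊕ E → ℝ := Pi.single (.inl e) 1

open Classical in
theorem inc_mulVec_single (e : E) (r : E ⊕ E) : (G.inc *ᵥ Pi.single e 1) r = G.inc r e := by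
  simp

/-- If `e` leads to an accepting root, then the vertex `e` is in the range of the incidence
matrix. -/
theorem exists_inc_mulVec_eq {e v : E} (h : G.Reach e v) (hv : G.live v) (hr : G.root v)
    (ha : G.acc v) : ∃ z : E → ℝ, (∀ u, ¬ G.live u → z u = 0) ∧ G.inc *ᵥ z = delta e := by
  classical
  induction h using Relation.ReflTransGen.head_induction_on with
  | refl =>
    refine ⟨Pi.single v 1, fun u hu => ?_, ?_⟩
    · rw [Pi.single_apply, if_neg (by rintro rfl; exact hu hv)]
    · ext r
      simp [inc_mulVec_single, inc, tl, hd, hv, hr, ha, delta, Pi.single_apply, eq_comm]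
  | @head e e' h _ ih =>
    obtain ⟨z, hz, hN⟩ := ih
    -- The column of `e` is the sum of the indicators of `e` and of `nx e`, and `z` accounts for the
    -- latter. Iterated, this is the alternating sum along the path.
    refine ⟨Pi.single e 1 - z, fun u hu => ?_, ?_⟩
    · rw [Pi.sub_apply, hz u hu, Pi.single_apply, if_neg (by rintro rfl; exact hu h.1), sub_zero]
    · obtain ⟨h1, h2, rfl⟩ := h
      rw [Matrix.mulVec_sub, hN]
      ext r
      rw [Pi.sub_apply, inc_mulVec_single]
      simp [inc, tl, hd, h1, h2, delta, Pi.single_apply, eq_comm]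

/-- The indicator of `s` is obtained twice: from the path to the accepting root, and as the column
of the half-edge `h`. The difference lies in the kernel. It is nonzero because the first combination
uses live indices only and `h` is not live. -/
theorem exists_gram_mulVec_eq_zero {v : E} (h : G.Reach G.s v) (hr : G.root v) (ha : G.acc v) :
    ∃ z : E → ℝ, z ≠ 0 ∧ G.gram.map (Nat.cast : ℕ → ℝ) *ᵥ z = 0 := by
  classical
  obtain ⟨z, hz, hN⟩ := G.exists_inc_mulVec_eq h (h.live G.live_s) hr ha
  refine ⟨z - Pi.single G.h 1, fun h0 => ?_, ?_⟩
  · have := congrFun h0 G.h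
    simp [hz _ G.not_live_h] at this
  · have : G.inc *ᵥ (z - Pi.single G.h 1) = 0 := by
      rw [Matrix.mulVec_sub, hN]
      ext r
      rw [Pi.sub_apply, inc_mulVec_single]
      simp [inc, tl, hd, G.not_live_h, delta, Pi.single_apply, eq_comm]
    rw [gram_eq, ← Matrix.mulVec_mulVec, this, Matrix.mulVec_zero]

theorem sum_mul_inc_mulVec (y : E ⊕ E → ℝ) (z : E → ℝ) :
    ∑ r, y r * (G.inc *ᵥ z) r = ∑ e, z e * (y (G.tl e) + (G.hd e).elim 0 y) := by
  simp only [← sum_mul_inc, Matrix.mulVec, dotProduct, Finset.mul_sum]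
  rw [Finset.sum_comm]
  exact Finset.sum_congr rfl fun e _ => Finset.sum_congr rfl fun r _ => by ring

-- An edge with both ends below `v` contributes zero, since the signs alternate with the rank. The
-- edge of `v` itself has only its tail below `v`, because ranks increase along edges, and
-- contributes `z v`. If `v` is a rejecting root, its index sits on a private vertex and contributes
-- nothing. Beyond this only the half-edge at `s` is seen.
open Classical in
theorem sum_below (v : E) (hv : G.live v) (z : E → ℝ) :
    ∑ r, G.below v r * (G.inc *ᵥ z) r =
      (if G.root v ∧ ¬ G.acc v then 0 else z v) + z G.h * G.below v (.inl G.s) := by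
  rw [sum_mul_inc_mulVec]
  have hne : v ≠ G.h := by rintro rfl; exact G.not_live_h hv
  have key : ∀ e, z e * (G.below v (G.tl e) + (G.hd e).elim 0 (G.below v)) =
      (if e = v then (if G.root v ∧ ¬ G.acc v then 0 else z v) else 0) +
        (if e = G.h then z G.h * G.below v (.inl G.s) else 0) := by
    intro e
    by_cases hl : G.live e
    · have heh : e ≠ G.h := by rintro rfl; exact G.not_live_h hl
      by_cases hr : G.root e
      · by_cases ha : G.acc e
        · by_cases hev : e = v
          · subst hev
            simp [tl, hd, hl, hr, ha, heh, below, G.reach_iff_of_root hr, ← two_mul]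
          · simp [tl, hd, hl, hr, ha, heh, hev, below, G.reach_iff_of_root hr]
        · by_cases hev : e = v
          · subst hev
            simp [tl, hd, hl, hr, ha, heh, below]
          · simp [tl, hd, hl, hr, ha, heh, hev, below]
      · have hst := G.reach_iff_of_step (v := v) ⟨hl, hr, rfl⟩
        have hrk := G.rank_nx e hl hr
        by_cases hev : e = v
        · subst hev
          have hn : ¬ G.Reach (G.nx e) e := fun h => by have := h.rank_le; omega
          simp [tl, hd, hl, hr, heh, below, hn, hst, ← two_mul]
        · have hst' : G.Reach e v ↔ G.Reach (G.nx e) v := by simpa [hev] using hst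
          by_cases h : G.Reach (G.nx e) v
          · simp [tl, hd, hl, hr, heh, hev, below, h, hst', hrk, ← add_assoc, pow_succ]
          · simp [tl, hd, hl, hr, heh, hev, below, h, hst']
    · have hev : e ≠ v := by rintro rfl; exact hl hv
      by_cases heh : e = G.h
      · subst heh
        simp [tl, hd, hl, hev]
      · simp [tl, hd, hl, hev, heh, below]
  simp only [key, Finset.sum_add_distrib, Finset.sum_ite_eq', Finset.mem_univ, if_true]

theorem abs_sum_le (y b : E ⊕ E → ℝ) (hy : ∀ r, |y r| ≤ 1) : |∑ r, y r * b r| ≤ ∑ r, |b r| := by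
  refine (Finset.abs_sum_le_sum_abs _ _).trans (Finset.sum_le_sum fun r _ => ?_)
  rw [abs_mul]
  exact mul_le_of_le_one_left (abs_nonneg _) (hy r)

/-- If `s` leads to a rejecting root, then the incidence matrix is bounded below. -/
theorem abs_le_of_reject {v : E} (h : G.Reach G.s v) (hr : G.root v) (ha : ¬ G.acc v) (z : E → ℝ)
    (e : E) : |z e| ≤ 2 * ∑ r, |(G.inc *ᵥ z) r| := by
  classical
  set B := ∑ r, |(G.inc *ᵥ z) r|
  have hB : 0 ≤ B := Finset.sum_nonneg fun _ _ => abs_nonneg _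
  -- At the rejecting root reached from `s`, the sum over the subtree consists of `± z h` alone.
  have hh : |z G.h| ≤ B := by
    have h1 := G.sum_below v (h.live G.live_s) z
    rw [if_pos ⟨hr, ha⟩, zero_add] at h1
    have h2 := abs_sum_le (G.below v) (G.inc *ᵥ z) (G.abs_below_le v)
    rw [h1, abs_mul] at h2
    have h3 : |G.below v (.inl G.s)| = 1 := by simp [below, h]
    rwa [h3, mul_one] at h2
  -- A private vertex meets a single column, so one row of the incidence matrix reads off `z e`.
  have hpriv : ∀ e, G.tl e = .inr e → G.hd e = none → |z e| ≤ B := by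
    intro e he he'
    have h2 := abs_sum_le (Pi.single (.inr e) 1) (G.inc *ᵥ z) (fun r => by
      rw [Pi.single_apply]; split_ifs <;> simp)
    rw [sum_mul_inc_mulVec] at h2
    have key : ∀ e', z e' * ((Pi.single (.inr e) 1 : E ⊕ E → ℝ) (G.tl e') +
        (G.hd e').elim 0 (Pi.single (.inr e) 1 : E ⊕ E → ℝ)) = if e' = e then z e else 0 := by
      intro e'
      have h1 : (G.hd e').elim 0 (Pi.single (.inr e) 1 : E ⊕ E → ℝ) = 0 := by
        unfold hd; split_ifs <;> simp
      rw [h1, add_zero]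
      by_cases hee : e' = e
      · subst hee; simp [he]
      · have : G.tl e' ≠ .inr e := by
          unfold tl; split_ifs <;> simp [hee]
        simp [hee, this]
    simpa only [key, Finset.sum_ite_eq', Finset.mem_univ, if_true] using h2
  by_cases hl : G.live e
  · by_cases hra : G.root e ∧ ¬ G.acc e
    · have := hpriv e (by simp [tl, hl, hra]) (by simp [hd, hra])
      linarith
    · have h1 := G.sum_below e hl z
      rw [if_neg hra] at h1
      have h2 := abs_sum_le (G.below e) (G.inc *ᵥ z) (G.abs_below_le e)
      -- Each of the two terms is at most `B` in absolute value, which accounts for the factor 2.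
      have h3 : z e = (∑ r, G.below e r * (G.inc *ᵥ z) r) - z G.h * G.below e (.inl G.s) := by
        rw [h1]; ring
      have h4 : |z G.h * G.below e (.inl G.s)| ≤ B := by
        rw [abs_mul]
        exact (mul_le_of_le_one_right (abs_nonneg _) (G.abs_below_le _ _)).trans hh
      rw [h3]
      refine (abs_sub _ _).trans ?_
      linarith
  · by_cases heh : e = G.h
    · subst heh; linarith
    · have := hpriv e (by simp [tl, hl, heh]) (by simp [hd, hl])
      linarith

/-- The pointwise bound is squared and summed over `E`, which gives `4 * |E| * B ^ 2`;
Cauchy–Schwarz over the `2 * |E|` rows bounds `B ^ 2` and supplies the remaining factor `2 * |E|`.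
-/
theorem sum_sq_le_of_reject {v : E} (h : G.Reach G.s v) (hr : G.root v) (ha : ¬ G.acc v)
    (z : E → ℝ) :
    ∑ e, z e ^ 2 ≤ 8 * (Fintype.card E : ℝ) ^ 2 *
      (z ⬝ᵥ (G.gram.map (Nat.cast : ℕ → ℝ) *ᵥ z)) := by
  have h1 : z ⬝ᵥ (G.gram.map (Nat.cast : ℕ → ℝ) *ᵥ z) = ∑ r, (G.inc *ᵥ z) r ^ 2 := by
    rw [gram_eq, ← Matrix.mulVec_mulVec, Matrix.dotProduct_mulVec, Matrix.vecMul_transpose]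
    simp [dotProduct, sq]
  set B := ∑ r, |(G.inc *ᵥ z) r|
  have h2 : B ^ 2 ≤ (2 * Fintype.card E) * ∑ r, (G.inc *ᵥ z) r ^ 2 := by
    have := sq_sum_le_card_mul_sum_sq (s := Finset.univ) (f := fun r => |(G.inc *ᵥ z) r|)
    simp only [sq_abs, Finset.card_univ, Fintype.card_sum] at this
    push_cast at this
    linarith
  have h3 : ∑ e, z e ^ 2 ≤ ∑ _e : E, (2 * B) ^ 2 := by
    refine Finset.sum_le_sum fun e _ => ?_
    rw [← sq_abs (z e)]
    exact pow_le_pow_left₀ (abs_nonneg _) (G.abs_le_of_reject h hr ha z e) 2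
  rw [Finset.sum_const, Finset.card_univ, nsmul_eq_mul] at h3
  rw [h1]
  have h4 : (0 : ℝ) ≤ Fintype.card E := Nat.cast_nonneg _
  calc _ ≤ _ := h3
    _ = 4 * (Fintype.card E : ℝ) * B ^ 2 := by ring
    _ ≤ 4 * (Fintype.card E : ℝ) * ((2 * Fintype.card E) * ∑ r, (G.inc *ᵥ z) r ^ 2) := by gcongr
    _ = _ := by ring

/-! ### The smallest eigenvalue of the Gram matrix -/

variable [DecidableEq E]

theorem isSmallestEigenvalue_of_accept {v : E} (h : G.Reach G.s v) (hr : G.root v)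
    (ha : G.acc v) : IsSmallestEigenvalue (G.gram.map (Nat.cast : ℕ → ℝ)) 0 := by
  constructor
  · obtain ⟨z, hz, h0⟩ := G.exists_gram_mulVec_eq_zero h hr ha
    exact Module.End.hasEigenvalue_of_hasEigenvector (x := z)
      ⟨Module.End.mem_eigenspace_iff.2 (by simpa using h0), hz⟩
  · intro μ hμ
    obtain ⟨z, hz⟩ := hμ.exists_hasEigenvector
    have h1 : G.gram.map (Nat.cast : ℕ → ℝ) *ᵥ z = μ • z := by simpa using hz.apply_eq_smul
    have h2 := G.posSemidef_gram.dotProduct_mulVec_nonneg z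
    rw [h1, star_trivial, dotProduct_smul, smul_eq_mul] at h2
    have h3 : 0 < z ⬝ᵥ z := by
      have := Matrix.dotProduct_star_self_pos_iff.2 hz.2
      simpa using this
    exact nonneg_of_mul_nonneg_left h2 h3

/-- The spectral theorem provides real eigenvalues and a least one among them; evaluating the
quadratic form at one of its eigenvectors bounds it from below. -/
theorem exists_isSmallestEigenvalue_of_reject {v : E} (h : G.Reach G.s v) (hr : G.root v)
    (ha : ¬ G.acc v) : ∃ r : ℝ, IsSmallestEigenvalue (G.gram.map (Nat.cast : ℕ → ℝ)) r ∧
      (8 * (Fintype.card E : ℝ) ^ 2)⁻¹ ≤ r := by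
  have hH : (G.gram.map (Nat.cast : ℕ → ℝ)).IsHermitian := G.posSemidef_gram.1
  have hspec : {μ : ℝ | Module.End.HasEigenvalue (Matrix.toLin' (G.gram.map (Nat.cast : ℕ → ℝ))) μ}
      = Set.range hH.eigenvalues := by
    rw [← hH.spectrum_real_eq_range_eigenvalues, ← Matrix.spectrum_toLin']
    ext μ
    exact Module.End.hasEigenvalue_iff_mem_spectrum
  obtain ⟨i, hi⟩ := @Finite.exists_min _ _ _ ⟨G.s⟩ _ hH.eigenvalues
  have hleast : IsSmallestEigenvalue (G.gram.map (Nat.cast : ℕ → ℝ)) (hH.eigenvalues i) := by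
    unfold IsSmallestEigenvalue
    rw [hspec]
    exact ⟨⟨i, rfl⟩, by rintro _ ⟨j, rfl⟩; exact hi j⟩
  refine ⟨_, hleast, ?_⟩
  obtain ⟨z, hz⟩ := Module.End.HasEigenvalue.exists_hasEigenvector hleast.1
  have h1 : G.gram.map (Nat.cast : ℕ → ℝ) *ᵥ z = hH.eigenvalues i • z := by
    simpa using hz.apply_eq_smul
  have h2 := G.sum_sq_le_of_reject h hr ha z
  have h3 : 0 < z ⬝ᵥ z := by
    have := Matrix.dotProduct_star_self_pos_iff.2 hz.2
    simpa using this
  rw [h1, dotProduct_smul, smul_eq_mul] at h2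
  have h4 : ∑ e, z e ^ 2 = z ⬝ᵥ z := by simp [dotProduct, sq]
  rw [h4] at h2
  have h5 : (0 : ℝ) < Fintype.card E := Nat.cast_pos.2 (Fintype.card_pos_iff.2 ⟨G.s⟩)
  rw [inv_le_iff_one_le_mul₀ (by positivity)]
  nlinarith

end Forest
end GappedSuccinct

namespace GappedSuccinct

open Function

/-! ### Binary counters -/

namespace Timer

variable {L : ℕ} (t : Fin L → Bool)

/-- The bits of a counter, extended by `false`. -/
def bit (k : ℕ) : Bool := if h : k < L then t ⟨k, h⟩ else false

/-- The carry bits of the increment. -/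
def carry : ℕ → Bool
  | 0 => true
  | k + 1 => carry k && bit t k

/-- The borrow bits of the decrement. -/
def borrow : ℕ → Bool
  | 0 => true
  | k + 1 => borrow k && !bit t k

/-- Add one. -/
def inc : Fin L → Bool := fun k => xor (t k) (carry t k)

/-- Subtract one. -/
def dec : Fin L → Bool := fun k => xor (t k) (borrow t k)

/-- The value of the lower `n` bits. -/
def val (n : ℕ) : ℕ := ∑ k ∈ Finset.range n, (bit t k).toNat * 2 ^ k

theorem bit_inc {k : ℕ} (hk : k < L) : bit (inc t) k = xor (bit t k) (carry t k) := by
  simp [bit, hk, inc]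

theorem bit_dec {k : ℕ} (hk : k < L) : bit (dec t) k = xor (bit t k) (borrow t k) := by
  simp [bit, hk, dec]

/-- The invariant of ripple-carry addition: the carry out of the lower `n` bits has weight `2 ^ n`.
-/
theorem val_inc {n : ℕ} (hn : n ≤ L) :
    val (inc t) n + (carry t n).toNat * 2 ^ n = val t n + 1 := by
  induction n with
  | zero => simp [val, carry]
  | succ n ih =>
    have := ih (by omega)
    have hs : ∀ t : Fin L → Bool, val t (n + 1) = val t n + (bit t n).toNat * 2 ^ n :=
      fun t => Finset.sum_range_succ _ _
    rw [hs, hs, carry, bit_inc t (show n < L by omega), pow_succ]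
    generalize val (inc t) n = a at *
    generalize val t n = b at *
    generalize 2 ^ n = c at *
    generalize carry t n = u at *
    cases bit t n <;> cases u <;> simp at this ⊢ <;> omega

/-- The carry runs through trailing ones and turns them into zeros, and a borrow runs through
exactly those zeros. Both operations therefore flip the same bits, so that they are inverse to each
other, overflow included. -/
theorem borrow_inc {n : ℕ} (hn : n ≤ L) : borrow (inc t) n = carry t n := by
  induction n with
  | zero => rfl
  | succ n ih =>
    simp only [borrow, carry, bit_inc t (show n < L by omega), ih (by omega)]
    cases bit t n <;> cases carry t n <;> rfl

theorem carry_dec {n : ℕ} (hn : n ≤ L) : carry (dec t) n = borrow t n := by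
  induction n with
  | zero => rfl
  | succ n ih =>
    simp only [borrow, carry, bit_dec t (show n < L by omega), ih (by omega)]
    cases bit t n <;> cases borrow t n <;> rfl

theorem dec_inc : dec (inc t) = t := by
  funext k
  simp only [dec, borrow_inc t k.2.le]
  simp [inc]

theorem inc_dec : inc (dec t) = t := by
  funext k
  simp only [inc, carry_dec t k.2.le]
  simp [dec]

theorem val_lt (n : ℕ) : val t n < 2 ^ n := by
  induction n with
  | zero => simp [val]
  | succ n ih =>
    simp only [val, Finset.sum_range_succ, pow_succ] at ih ⊢
    cases bit t n <;> simp <;> omega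

theorem val_inc_of_not_max (h : carry t L = false) : val (inc t) L = val t L + 1 := by
  simpa [h] using val_inc t le_rfl

theorem carry_eq_true_iff : carry t L = true ↔ val t L + 1 = 2 ^ L := by
  have h1 := val_inc t le_rfl
  have h2 := val_lt (inc t) L
  cases h : carry t L <;> simp [h] at h1 ⊢
  · omega
  · have := val_lt t L
    omega

theorem borrow_eq_true_iff : ∀ n ≤ L, (borrow t n = true ↔ ∀ k < n, bit t k = false) := by
  intro n
  induction n with
  | zero => simp [borrow]
  | succ n ih =>
    intro hn
    simp only [borrow, Bool.and_eq_true, ih (by omega), Bool.not_eq_true', Nat.lt_succ_iff_lt_or_eq]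
    constructor
    · rintro ⟨h1, h2⟩ k (hk | rfl)
      exacts [h1 k hk, h2]
    · exact fun h => ⟨fun k hk => h k (.inl hk), h n (.inr rfl)⟩

theorem isZero_iff : borrow t L = true ↔ t = fun _ => false := by
  rw [borrow_eq_true_iff t L le_rfl]
  constructor
  · intro h
    funext k
    simpa [bit] using h k k.2
  · rintro rfl k hk
    simp [bit]

end Timer

/-! ### Machines with rotating tapes -/

/-- The possible motions of a track. -/
inductive Shift where
  | stay | left | right

/-- The column from which the new contents of a column are taken, relative to it. -/
def Shift.offset {d : ℕ} : Shift → Fin (d + 2)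
  | stay => 0
  | left => 1
  | right => -1

/-- A machine with `q` control bits and a cyclic tape with columns of `w` bits. In a step, the
control and the column `0` are rewritten by `F`, and then each of the `w` tracks of the tape may
rotate by one column, depending on the new control. -/
structure RotMachine where
  q : ℕ
  w : ℕ
  F : (Fin q → Bool) × (Fin w → Bool) → (Fin q → Bool) × (Fin w → Bool)
  shift : (Fin q → Bool) → Fin w → Shift
  acc : (Fin q → Bool) → Bool
  start : Fin q → Bool
  code : Bool → Fin w → Bool

namespace RotMachine

variable (M : RotMachine) (d : ℕ)

/-- Configurations with `d + 2` columns. -/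
abbrev Main : Type := (Fin M.q → Bool) × (Fin (d + 2) → Fin M.w → Bool)

variable {M d}

/-- Rewrite the control and the column `0`. -/
def rewrite (c : M.Main d) : M.Main d :=
  ((M.F (c.1, c.2 0)).1, update c.2 0 (M.F (c.1, c.2 0)).2)

/-- Rotate the tracks. -/
def rot (σ : Fin M.w → Shift) (cell : Fin (d + 2) → Fin M.w → Bool) :
    Fin (d + 2) → Fin M.w → Bool :=
  fun i j => cell (i + (σ j).offset) j

/-- Rotate the tracks back. -/
def unrot (σ : Fin M.w → Shift) (cell : Fin (d + 2) → Fin M.w → Bool) :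
    Fin (d + 2) → Fin M.w → Bool :=
  fun i j => cell (i - (σ j).offset) j

theorem rot_unrot (σ : Fin M.w → Shift) (cell : Fin (d + 2) → Fin M.w → Bool) :
    rot σ (unrot σ cell) = cell := by
  funext i j; simp [rot, unrot]

theorem unrot_rot (σ : Fin M.w → Shift) (cell : Fin (d + 2) → Fin M.w → Bool) :
    unrot σ (rot σ cell) = cell := by
  funext i j; simp [rot, unrot]

/-- Move the tape. -/
def move (c : M.Main d) : M.Main d := (c.1, rot (M.shift c.1) c.2)

/-- One step of the machine. -/
def step (c : M.Main d) : M.Main d := move (rewrite c)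

variable (M d)

/-- The number of bits of a configuration and the phase. -/
def len : ℕ := 1 + M.q + M.w * (d + 2)

/-- The column `i` of the initial tape with the input `x`. -/
def startCell (x : List Bool) (i : ℕ) : Fin M.w → Bool :=
  if h : i < x.length then M.code x[i] else fun _ => false

/-- The initial configuration with the input `x`. -/
def init (x : List Bool) : M.Main d := (M.start, fun i => M.startCell x i)

/-- The indices of the matrix. -/
@[ext]
structure Vtx where
  aux : Bool
  phase : Bool
  main : M.Main d
  timer : Fin (M.len d) → Bool

variable {M d}

/-- The vertex that follows `v`. -/
def next (v : M.Vtx d) : M.Vtx d :=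
  if v.phase then ⟨v.aux, false, move v.main, Timer.inc v.timer⟩
  else ⟨v.aux, true, rewrite v.main, v.timer⟩

variable (M d)

/-- The initial vertex. -/
def startVtx (x : List Bool) : M.Vtx d := ⟨false, false, M.init d x, fun _ => false⟩

/-- The index of the half-edge at the initial vertex. -/
def halfVtx (x : List Bool) : M.Vtx d := ⟨true, false, M.init d x, fun _ => false⟩

/-- The forest of the computations, with time. -/
def forest (x : List Bool) : Forest (M.Vtx d) where
  live v := v.aux = false
  root v := v.phase = true ∧ Timer.carry v.timer (M.len d) = true
  acc v := M.acc v.main.1 = true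
  nx := next
  s := M.startVtx d x
  h := M.halfVtx d x
  -- Rewriting raises the phase from 0 to 1; moving lowers it and adds one to the timer. Both raise
  -- the rank by one as long as the timer does not overflow, which is why a maximal timer in the
  -- second phase is a root.
  rank v := 2 * Timer.val v.timer (M.len d) + v.phase.toNat
  live_s := rfl
  not_live_h := by simp [halfVtx]
  live_nx v hv _ := by
    unfold next
    split_ifs <;> exact hv
  rank_nx v _ hr := by
    unfold next
    split_ifs with h
    · have := Timer.val_inc_of_not_max v.timer (by simpa [h] using hr)
      simp only [h, this]
      simp
      ring
    · simp [h]

variable {M d}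

/-- The computation reaches its final vertex. -/
theorem reach_final (x : List Bool) : ∃ t : Fin (M.len d) → Bool,
    (M.forest d x).root ⟨false, true, rewrite (step^[2 ^ M.len d - 1] (M.init d x)), t⟩ ∧
    (M.forest d x).Reach (M.startVtx d x)
      ⟨false, true, rewrite (step^[2 ^ M.len d - 1] (M.init d x)), t⟩ := by
  -- The timer counts complete machine steps, each of which takes two edges.
  have key : ∀ n < 2 ^ M.len d, ∃ t : Fin (M.len d) → Bool, Timer.val t (M.len d) = n ∧
      (M.forest d x).Reach (M.startVtx d x) ⟨false, false, step^[n] (M.init d x), t⟩ := by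
    intro n
    induction n with
    | zero => exact fun _ => ⟨fun _ => false, by simp [Timer.val, Timer.bit], .refl⟩
    | succ n ih =>
      intro hn
      obtain ⟨t, ht, hr⟩ := ih (by omega)
      have hc : Timer.carry t (M.len d) = false := by
        rw [← Bool.not_eq_true, Timer.carry_eq_true_iff]
        omega
      refine ⟨Timer.inc t, by rw [Timer.val_inc_of_not_max t hc, ht], ?_⟩
      have h1 : (M.forest d x).Step ⟨false, false, step^[n] (M.init d x), t⟩
          ⟨false, true, rewrite (step^[n] (M.init d x)), t⟩ :=
        ⟨rfl, by simp [forest], by simp [forest, next]⟩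
      have h2 : (M.forest d x).Step ⟨false, true, rewrite (step^[n] (M.init d x)), t⟩
          ⟨false, false, step^[n + 1] (M.init d x), Timer.inc t⟩ :=
        ⟨rfl, by simp [forest, hc], by simp only [forest, next, if_true,
          Function.iterate_succ_apply', step]⟩
      exact (hr.tail h1).tail h2
  have hpos : 0 < 2 ^ M.len d := by positivity
  obtain ⟨t, ht, hr⟩ := key (2 ^ M.len d - 1) (by omega)
  refine ⟨t, ⟨rfl, (Timer.carry_eq_true_iff t).2 (by omega)⟩, hr.tail ⟨rfl, ?_, ?_⟩⟩
  · simp [forest]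
  · simp [forest, next]

/-- Before the first visit to the fixed point the orbit has no repetition, so this visit happens
within `Fintype.card α` steps. -/
theorem iterate_eq_of_fixed {α : Type} [Fintype α] (f : α → α) {a b : α} {n : ℕ}
    (hn : f^[n] a = b) (hb : f b = b) {N : ℕ} (hN : Fintype.card α ≤ N) : f^[N] a = b := by
  classical
  have hstay : ∀ m k, f^[m] a = b → f^[m + k] a = b := by
    intro m k hm
    rw [add_comm, iterate_add_apply, hm]
    exact iterate_fixed hb k
  have hex : ∃ n, f^[n] a = b := ⟨n, hn⟩
  have hle : Nat.find hex ≤ N := by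
    by_contra hlt
    have hinj : Injective fun i : Fin (Nat.find hex) => f^[i] a := by
      have main : ∀ i j : ℕ, i < j → j < Nat.find hex → f^[i] a ≠ f^[j] a := by
        intro i j hij hj he
        -- A repetition at times `i < j` could be cut out, which would lead to `b` earlier by `j -
        -- i` steps.
        refine Nat.find_min hex (m := i + (Nat.find hex - j)) (by omega) ?_
        rw [add_comm, iterate_add_apply, he, ← iterate_add_apply, Nat.sub_add_cancel hj.le]
        exact Nat.find_spec hex
      intro i j he
      rcases lt_trichotomy i j with h | h | h
      · exact absurd he (main i j h j.2)
      · exact h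
      · exact absurd he.symm (main j i h i.2)
    have := Fintype.card_le_of_injective _ hinj
    rw [Fintype.card_fin] at this
    omega
  have := hstay _ (N - Nat.find hex) (Nat.find_spec hex)
  rwa [Nat.add_sub_cancel' hle] at this

/-- If the machine ends in a fixed point, the final vertex has its control. -/
theorem reach_final_of_fixed {x : List Bool} {n : ℕ} {c : M.Main d}
    (hn : step^[n] (M.init d x) = c) (hc : step c = c) : ∃ v : M.Vtx d,
      (M.forest d x).root v ∧ (M.forest d x).Reach (M.startVtx d x) v ∧ v.main.1 = c.1 := by
  obtain ⟨t, h1, h2⟩ := reach_final (M := M) (d := d) x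
  refine ⟨_, h1, h2, ?_⟩
  -- The timer has one bit more than a configuration, namely the one counted for the phase.
  have hcard : Fintype.card (M.Main d) ≤ 2 ^ M.len d - 1 := by
    have : Fintype.card (M.Main d) = 2 ^ (M.q + M.w * (d + 2)) := by
      simp [pow_add, pow_mul]
    rw [this, len, add_assoc, pow_add 2 1, pow_one]
    have : 0 < 2 ^ (M.q + M.w * (d + 2)) := by positivity
    omega
  rw [iterate_eq_of_fixed step hn hc hcard]
  -- The final vertex is taken after the rewriting only; its control is that of `step c`, since
  -- moving preserves the control.
  exact (congrArg Prod.fst hc : (step c).1 = c.1)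

/-! ### Rows of the matrix -/

variable (M) in
/-- The part of an index that is changed by the local slots. -/
@[ext]
structure Pre where
  aux : Bool
  phase : Bool
  ctrl : Fin M.q → Bool
  col : Fin M.w → Bool

/-- The local part of an index. -/
def Vtx.pre (v : M.Vtx d) : M.Pre := ⟨v.aux, v.phase, v.main.1, v.main.2 0⟩

/-- Replace the local part of an index. -/
def Vtx.setPre (v : M.Vtx d) (u : M.Pre) : M.Vtx d :=
  ⟨u.aux, u.phase, (u.ctrl, update v.main.2 0 u.col), v.timer⟩

open Classical in
/-- The entry of the matrix at two indices that differ in the local part only. The flags tell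
whether the timer is maximal, and whether the index is, up to `aux`, the initial one. -/
noncomputable def locVal (mx st : Bool) (p u : M.Pre) : ℕ :=
  (if u = p ∨ (st = true ∧ u = { p with aux := !p.aux }) then 1 else 0) +
  (if p.aux = false ∧ p.phase = false ∧ u.aux = false ∧ u.phase = true ∧
    M.F (p.ctrl, p.col) = (u.ctrl, u.col) ∧ ¬ (mx = true ∧ ¬ M.acc u.ctrl = true) then 1 else 0) +
  ((if u.aux = false ∧ u.phase = false ∧ p.aux = false ∧ p.phase = true ∧
    M.F (u.ctrl, u.col) = (p.ctrl, p.col) ∧ ¬ (mx = true ∧ ¬ M.acc p.ctrl = true) then 1 else 0) +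
  (if p.aux = false ∧ u.aux = false ∧ ((p.phase = false ∧ u.phase = false ∧
    M.F (p.ctrl, p.col) = M.F (u.ctrl, u.col)) ∨ (p.phase = true ∧ u = p ∧ mx = false))
    then 1 else 0))

/-- The first and the last summand require equal phases, the two middle ones different phases in
opposite orders. Hence at most two summands are 1. -/
theorem locVal_le (mx st : Bool) (p u : M.Pre) : locVal mx st p u ≤ 2 := by
  unfold locVal
  split_ifs <;> grind

/-- The index of the next edge, if the control is `q`. -/
def Vtx.fwd (v : M.Vtx d) (q : Fin M.q → Bool) : M.Vtx d :=
  ⟨false, false, (v.main.1, rot (M.shift q) v.main.2), Timer.inc v.timer⟩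

/-- The index of the previous edge, if the control is `q`. -/
def Vtx.bwd (v : M.Vtx d) (q : Fin M.q → Bool) : M.Vtx d :=
  ⟨false, true, (v.main.1, unrot (M.shift q) v.main.2), Timer.dec v.timer⟩

/-- The validity of the slot of the next edge. -/
def fwdOk (mx : Bool) (q : Fin M.q → Bool) (p : M.Pre) : Prop :=
  p.aux = false ∧ p.phase = true ∧ p.ctrl = q ∧ mx = false

/-- The validity of the slot of the previous edge. -/
def bwdOk (zr : Bool) (q : Fin M.q → Bool) (p : M.Pre) : Prop :=
  p.aux = false ∧ p.phase = false ∧ p.ctrl = q ∧ zr = false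

open Classical in
/-- The index is, up to `aux`, the initial one. -/
noncomputable def Vtx.isStart (x : List Bool) (v : M.Vtx d) : Bool :=
  decide (v.phase = false ∧ v.main = M.init d x ∧ Timer.borrow v.timer (M.len d) = true)

theorem Vtx.isStart_iff (x : List Bool) (v : M.Vtx d) :
    v.isStart x = true ↔ { v with aux := false } = M.startVtx d x := by
  simp [isStart, startVtx, Timer.isZero_iff]

theorem setPre_pre (v : M.Vtx d) : v.setPre v.pre = v := by
  simp [Vtx.setPre, Vtx.pre]

/-! ### Entries of the Gram matrix of a computation forest -/

section gram

variable (x : List Bool)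

theorem inc_ne {t : Fin (M.len d) → Bool} (h : Timer.carry t (M.len d) = false) :
    Timer.inc t ≠ t := by
  intro he
  have := Timer.val_inc_of_not_max t h
  rw [he] at this
  omega

/-- An incremented timer is zero only after an overflow, and the other phase leads to `phase =
true`. So the initial vertex has no incoming edge, and the half-edge there meets no head. -/
theorem next_ne_start {v : M.Vtx d} (hr : ¬ (M.forest d x).root v) : next v ≠ M.startVtx d x := by
  unfold next
  split_ifs with h
  · intro he
    have h1 : Timer.carry v.timer (M.len d) = false := by simpa [forest, h] using hr
    have h2 : Timer.inc v.timer = fun _ => false := congrArg Vtx.timer he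
    rw [← Timer.borrow_inc v.timer le_rfl, (Timer.isZero_iff _).2 h2] at h1
    exact Bool.noConfusion h1
  · intro he
    simpa [startVtx] using congrArg Vtx.phase he

theorem tl_eq_inl_iff (e w : M.Vtx d) : (M.forest d x).tl e = .inl w ↔
    (e.aux = false ∧ e = w ∧ ¬ (e.phase = true ∧ Timer.carry e.timer (M.len d) = true ∧
      ¬ M.acc e.main.1 = true)) ∨ (e = M.halfVtx d x ∧ w = M.startVtx d x) := by
  have hh : e = M.halfVtx d x → e.aux = true := by rintro rfl; rfl
  by_cases h1 : (M.forest d x).live e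
  · have h1' : e.aux = false := h1
    have hne : e ≠ M.halfVtx d x := fun h => by rw [hh h] at h1'; exact Bool.noConfusion h1'
    by_cases h2 : (M.forest d x).root e ∧ ¬ (M.forest d x).acc e
    · rw [Forest.tl, if_pos h1, if_pos h2]
      simp only [reduceCtorEq, hne, false_and, or_false, false_iff]
      exact fun h => h.2.2 ⟨h2.1.1, h2.1.2, h2.2⟩
    · rw [Forest.tl, if_pos h1, if_neg h2]
      simp only [Sum.inl.injEq, hne, false_and, or_false]
      exact ⟨fun h => ⟨h1, h, fun h' => h2 ⟨⟨h'.1, h'.2.1⟩, h'.2.2⟩⟩, fun h => h.2.1⟩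
  · have h1' : ¬ e.aux = false := h1
    by_cases h3 : e = M.halfVtx d x
    · have h3' : e = (M.forest d x).h := h3
      rw [Forest.tl, if_neg h1, if_pos h3']
      constructor
      · exact fun h => .inr ⟨h3, (Sum.inl.inj h).symm⟩
      · rintro (⟨h, -⟩ | ⟨-, rfl⟩)
        · exact absurd h h1'
        · rfl
    · have h3' : ¬ e = (M.forest d x).h := h3
      rw [Forest.tl, if_neg h1, if_neg h3']
      simp [h1', h3]

/-- Tails are private to their index, with one exception: the initial vertex is shared by its
outgoing edge and the half-edge, two indices that differ in `aux` only. -/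
theorem tl_eq_tl_iff (e e' : M.Vtx d) : (M.forest d x).tl e = (M.forest d x).tl e' ↔
    e' = e ∨ (e.isStart x = true ∧ e' = { e with aux := !e.aux }) := by
  have hs : (M.forest d x).tl (M.startVtx d x) = .inl (M.startVtx d x) :=
    (tl_eq_inl_iff x _ _).2 (.inl ⟨rfl, rfl, by simp [startVtx]⟩)
  have hh : (M.forest d x).tl (M.halfVtx d x) = .inl (M.startVtx d x) :=
    (tl_eq_inl_iff x _ _).2 (.inr ⟨rfl, rfl⟩)
  have hflip : ∀ e : M.Vtx d, e.isStart x = true → e = M.startVtx d x ∨ e = M.halfVtx d x := by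
    intro e he
    rw [Vtx.isStart_iff] at he
    obtain ⟨a, b, c, t⟩ := e
    cases a
    · exact .inl he
    · right
      simp only [startVtx, halfVtx, Vtx.mk.injEq, true_and] at he ⊢
      exact he
  constructor
  · intro h
    have hr : ∀ e w : M.Vtx d, (M.forest d x).tl e = .inr w → e = w := by
      intro e w h
      unfold Forest.tl at h
      split_ifs at h <;> simpa using h
    rcases h1 : (M.forest d x).tl e with w | w
    · rw [h1] at h
      have h2 := (tl_eq_inl_iff x _ _).1 h1
      have h3 := (tl_eq_inl_iff x _ _).1 h.symm
      have st : (M.startVtx d x).isStart x = true := by rw [Vtx.isStart_iff]; rfl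
      have ht : (M.halfVtx d x).isStart x = true := by rw [Vtx.isStart_iff]; rfl
      rcases h2 with ⟨_, rfl, _⟩ | ⟨rfl, rfl⟩ <;> rcases h3 with ⟨_, h4, _⟩ | ⟨h4, h5⟩
      · exact .inl h4
      · subst h5 h4
        exact .inr ⟨st, rfl⟩
      · subst h4
        exact .inr ⟨ht, rfl⟩
      · exact .inl h4
    · rw [h1] at h
      exact .inl ((hr _ _ h.symm).trans (hr _ _ h1).symm)
  · rintro (rfl | ⟨h, rfl⟩)
    · rfl
    · rcases hflip e h with rfl | rfl
      · exact hs.trans hh.symm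
      · exact hh.trans hs.symm

/-- Such edges are consecutive on a path. The last condition excludes rejecting roots, whose tail
has been moved to a private vertex. -/
theorem hd_eq_tl_iff (e e' : M.Vtx d) : (M.forest d x).hd e = some ((M.forest d x).tl e') ↔
    e.aux = false ∧ ¬ (e.phase = true ∧ Timer.carry e.timer (M.len d) = true) ∧ e' = next e ∧
      ¬ (e'.phase = true ∧ Timer.carry e'.timer (M.len d) = true ∧ ¬ M.acc e'.main.1 = true) := by
  unfold Forest.hd
  split_ifs with h
  · rw [Option.some_inj, eq_comm, tl_eq_inl_iff]
    have h1 : (M.forest d x).nx e = next e := rfl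
    have h2 := next_ne_start x h.2
    have h3 : (next e).aux = false := (M.forest d x).live_nx e h.1 h.2
    simp only [h1, h2, and_false, or_false]
    refine ⟨fun h' => ⟨h.1, h.2, h'.2⟩, fun h' => ⟨?_, h'.2.2⟩⟩
    rw [h'.2.2.1]
    exact h3
  · simp only [false_iff]
    exact fun h' => h ⟨h'.1, h'.2.1⟩

/-- Only rewriting can merge two vertices. A move is injective: the timer can be decremented again,
and the control, which a move preserves, determines the rotation to be undone. -/
theorem hd_eq_hd_iff (e e' : M.Vtx d) :
    ((M.forest d x).hd e = (M.forest d x).hd e' ∧ (M.forest d x).hd e ≠ none) ↔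
    e.aux = false ∧ e'.aux = false ∧
      ((e.phase = false ∧ e'.phase = false ∧ rewrite e.main = rewrite e'.main ∧
          e.timer = e'.timer) ∨
        (e.phase = true ∧ e' = e ∧ Timer.carry e.timer (M.len d) = false)) := by
  have hd_eq : ∀ e : M.Vtx d, (M.forest d x).hd e ≠ none ↔ e.aux = false ∧
      ¬ (e.phase = true ∧ Timer.carry e.timer (M.len d) = true) := by
    intro e
    unfold Forest.hd
    simp [forest]
  have hd_eq' : ∀ e : M.Vtx d, (M.forest d x).hd e ≠ none →
      (M.forest d x).hd e = some (.inl (next e)) := by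
    intro e he
    unfold Forest.hd at he ⊢
    split_ifs at he ⊢ with h
    · rfl
    · exact absurd rfl he
  constructor
  · rintro ⟨h, hn⟩
    have hn' := h ▸ hn
    obtain ⟨h1, h2⟩ := (hd_eq e).1 hn
    obtain ⟨h1', h2'⟩ := (hd_eq e').1 hn'
    rw [hd_eq' e hn, hd_eq' e' hn', Option.some_inj, Sum.inl.injEq] at h
    refine ⟨h1, h1', ?_⟩
    obtain ⟨a, b, c, t⟩ := e
    obtain ⟨a', b', c', t'⟩ := e'
    simp only at h1 h1' h2 h2'
    cases b <;> cases b'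
    · simp only [next, Bool.false_eq_true, if_false, Vtx.mk.injEq] at h
      exact .inl ⟨rfl, rfl, h.2.2.1, h.2.2.2⟩
    · simp [next] at h
    · simp [next] at h
    · simp only [next, if_true, Vtx.mk.injEq, move, Prod.mk.injEq] at h
      obtain ⟨-, -, ⟨h3, h4⟩, h5⟩ := h
      have h6 : t' = t := by rw [← Timer.dec_inc t', ← h5, Timer.dec_inc]
      have h7 : c' = c := by
        refine Prod.ext h3.symm ?_
        rw [← unrot_rot (M.shift c'.1) c'.2, ← h4, ← h3, unrot_rot]
      subst h6 h7 h1 h1'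
      exact .inr ⟨rfl, rfl, by simpa using h2⟩
  · rintro ⟨h1, h2, ⟨h3, h4, h5, h6⟩ | ⟨h3, rfl, h5⟩⟩
    · have hn := (hd_eq e).2 ⟨h1, by simp [h3]⟩
      have hn' := (hd_eq e').2 ⟨h2, by simp [h4]⟩
      refine ⟨?_, hn⟩
      rw [hd_eq' e hn, hd_eq' e' hn']
      simp [next, h3, h4, h1, h2, h5, h6]
    · exact ⟨rfl, (hd_eq _).2 ⟨h1, by simp [h5]⟩⟩

theorem setPre_inj {v : M.Vtx d} {u u' : M.Pre} : v.setPre u = v.setPre u' ↔ u = u' := by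
  refine ⟨fun h => ?_, fun h => h ▸ rfl⟩
  simp only [Vtx.setPre, Vtx.mk.injEq, Prod.mk.injEq] at h
  obtain ⟨h1, h2, ⟨h3, h4⟩, -⟩ := h
  exact Pre.ext h1 h2 h3 (update_injective _ _ h4)

theorem setPre_setPre (v : M.Vtx d) (u : M.Pre) : (v.setPre u).setPre v.pre = v := by
  simp [Vtx.setPre, Vtx.pre]

theorem rewrite_setPre (v : M.Vtx d) (u : M.Pre) : rewrite (v.setPre u).main =
    ((M.F (u.ctrl, u.col)).1, update v.main.2 0 (M.F (u.ctrl, u.col)).2) := by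
  simp [rewrite, Vtx.setPre]

theorem next_of_phase {v : M.Vtx d} (h : v.phase = false) : next v =
    v.setPre ⟨v.aux, true, (M.F (v.main.1, v.main.2 0)).1, (M.F (v.main.1, v.main.2 0)).2⟩ := by
  simp [next, h, Vtx.setPre, rewrite]

theorem hd_eq_tl_setPre_iff (e : M.Vtx d) (u : M.Pre) :
    (M.forest d x).hd e = some ((M.forest d x).tl (e.setPre u)) ↔
      e.aux = false ∧ e.phase = false ∧ u.aux = false ∧ u.phase = true ∧
      M.F (e.main.1, e.main.2 0) = (u.ctrl, u.col) ∧
      ¬ (Timer.carry e.timer (M.len d) = true ∧ ¬ M.acc u.ctrl = true) := by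
  rw [hd_eq_tl_iff]
  have ht : (e.setPre u).timer = e.timer := rfl
  have hc : (e.setPre u).main.1 = u.ctrl := rfl
  have hp : (e.setPre u).phase = u.phase := rfl
  rw [ht, hc, hp]
  cases h : e.phase with
  | false =>
    rw [next_of_phase h, setPre_inj]
    constructor
    · rintro ⟨h1, -, rfl, h2⟩
      exact ⟨h1, rfl, h1, rfl, rfl, fun h' => h2 ⟨rfl, h'⟩⟩
    · rintro ⟨h1, -, h2, h3, h4, h5⟩
      refine ⟨h1, by simp, ?_, fun h' => h5 h'.2⟩
      rw [h4]
      exact Pre.ext (h2.trans h1.symm) h3 rfl rfl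
  | true =>
    simp only [reduceCtorEq, false_and, and_false, iff_false, true_and]
    rintro ⟨h1, h2, h3, -⟩
    have := congrArg Vtx.timer h3
    simp only [next, h, if_true, Vtx.setPre] at this
    exact inc_ne (by simpa using h2) this.symm

/-- The four summands of `gram` are matched one by one with those of `locVal`. Of the rest of the
index only two flags matter: whether the timer is maximal and whether the index is the initial one.
-/
theorem gram_setPre (e : M.Vtx d) (u : M.Pre) : (M.forest d x).gram e (e.setPre u) =
    locVal (Timer.carry e.timer (M.len d)) (e.isStart x) e.pre u := by
  classical
  have hflip : { e with aux := !e.aux } = e.setPre { e.pre with aux := !e.pre.aux } := by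
    simp [Vtx.setPre, Vtx.pre]
  have h1 : (M.forest d x).tl e = (M.forest d x).tl (e.setPre u) ↔
      u = e.pre ∨ (e.isStart x = true ∧ u = { e.pre with aux := !e.pre.aux }) := by
    rw [tl_eq_tl_iff, hflip, setPre_inj]
    nth_rewrite 2 [← setPre_pre e]
    rw [setPre_inj]
  have h3 := hd_eq_tl_setPre_iff x (e.setPre u) e.pre
  rw [setPre_setPre] at h3
  have h3' : (e.setPre u).main.2 0 = u.col := by simp [Vtx.setPre]
  rw [h3'] at h3
  have h4 : ((M.forest d x).hd e = (M.forest d x).hd (e.setPre u) ∧ (M.forest d x).hd e ≠ none) ↔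
      e.aux = false ∧ u.aux = false ∧ ((e.phase = false ∧ u.phase = false ∧
        M.F (e.main.1, e.main.2 0) = M.F (u.ctrl, u.col)) ∨
        (e.phase = true ∧ u = e.pre ∧ Timer.carry e.timer (M.len d) = false)) := by
    rw [hd_eq_hd_iff, rewrite_setPre]
    have he : e.setPre u = e ↔ u = e.pre := by
      nth_rewrite 2 [← setPre_pre e]
      exact setPre_inj
    rw [he]
    have : rewrite e.main = ((M.F (u.ctrl, u.col)).1, update e.main.2 0 (M.F (u.ctrl, u.col)).2) ↔
        M.F (e.main.1, e.main.2 0) = M.F (u.ctrl, u.col) := by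
      simp only [rewrite, (update_injective e.main.2 0).eq_iff, Prod.ext_iff]
    rw [this]
    simp [Vtx.setPre]
  unfold Forest.gram locVal
  rw [if_congr h1 rfl rfl, if_congr (hd_eq_tl_setPre_iff x e u) rfl rfl, if_congr h3 rfl rfl,
    if_congr h4 rfl rfl]
  rfl

/-- There is one slot for each control `q`, because the wiring of a slot must not depend on the
input while the rotation does; only the slot whose `q` is the actual control is valid. There the two
edges are consecutive and meet nowhere else. -/
theorem gram_fwd (e : M.Vtx d) (q : Fin M.q → Bool)
    (h : fwdOk (Timer.carry e.timer (M.len d)) q e.pre) :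
    (M.forest d x).gram e (e.fwd q) = 1 := by
  classical
  obtain ⟨h1, h2, rfl, h4⟩ := h
  change e.aux = false at h1
  change e.phase = true at h2
  have hn : e.fwd e.pre.ctrl = next e := by
    simp [next, h1, h2, Vtx.fwd, move, Vtx.pre]
  have hp : (e.fwd e.pre.ctrl).phase = false := rfl
  have ht : (e.fwd e.pre.ctrl).timer = Timer.inc e.timer := rfl
  have i1 : ¬ (M.forest d x).tl e = (M.forest d x).tl (e.fwd e.pre.ctrl) := by
    rw [tl_eq_tl_iff]
    rintro (h | ⟨-, h⟩)
    · rw [h, h2] at hp; exact Bool.noConfusion hp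
    · rw [h] at hp
      exact Bool.noConfusion (h2.symm.trans hp)
  have i2 : (M.forest d x).hd e = some ((M.forest d x).tl (e.fwd e.pre.ctrl)) := by
    rw [hd_eq_tl_iff]
    exact ⟨h1, by simp [h4], hn, by simp [hp]⟩
  have i3 : ¬ (M.forest d x).hd (e.fwd e.pre.ctrl) = some ((M.forest d x).tl e) := by
    rw [hd_eq_tl_iff]
    rintro ⟨-, -, h, -⟩
    have := congrArg Vtx.timer h
    simp only [next, hp] at this
    exact inc_ne h4 this.symm
  have i4 : ¬ ((M.forest d x).hd e = (M.forest d x).hd (e.fwd e.pre.ctrl) ∧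
      (M.forest d x).hd e ≠ none) := by
    rw [hd_eq_hd_iff]
    rintro ⟨-, -, ⟨h, -⟩ | ⟨-, h, -⟩⟩
    · rw [h2] at h; exact Bool.noConfusion h
    · rw [h, h2] at hp; exact Bool.noConfusion hp
  rw [Forest.gram, if_neg i1, if_pos i2, if_neg i3, if_neg i4]

theorem fwd_bwd (e : M.Vtx d) (h1 : e.aux = false) (h2 : e.phase = false) :
    (e.bwd e.pre.ctrl).fwd e.pre.ctrl = e := by
  obtain ⟨a, b, c, t⟩ := e
  simp only at h1 h2
  subst h1 h2
  simp [Vtx.fwd, Vtx.bwd, rot_unrot, Timer.inc_dec]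

/-- By symmetry this is the forward slot in the row of the predecessor. -/
theorem gram_bwd (e : M.Vtx d) (q : Fin M.q → Bool)
    (h : bwdOk (Timer.borrow e.timer (M.len d)) q e.pre) :
    (M.forest d x).gram e (e.bwd q) = 1 := by
  obtain ⟨h1, h2, rfl, h4⟩ := h
  rw [Forest.gram_comm]
  have h := gram_fwd x (e.bwd e.pre.ctrl) e.pre.ctrl
    ⟨rfl, rfl, rfl, (Timer.carry_dec e.timer le_rfl).trans h4⟩
  rwa [fwd_bwd e h1 h2] at h

/-- The nonzero entries of a row. -/
theorem exists_slot_of_gram_ne_zero {e e' : M.Vtx d} (h : (M.forest d x).gram e e' ≠ 0) :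
    (∃ u, e.setPre u = e') ∨
    (∃ q, e.fwd q = e' ∧ fwdOk (Timer.carry e.timer (M.len d)) q e.pre) ∨
    ∃ q, e.bwd q = e' ∧ bwdOk (Timer.borrow e.timer (M.len d)) q e.pre := by
  classical
  by_cases i1 : (M.forest d x).tl e = (M.forest d x).tl e'
  · left
    rcases (tl_eq_tl_iff x _ _).1 i1 with rfl | ⟨-, rfl⟩
    · exact ⟨_, setPre_pre _⟩
    · exact ⟨{ e.pre with aux := !e.aux }, by simp [Vtx.setPre, Vtx.pre]⟩
  by_cases i2 : (M.forest d x).hd e = some ((M.forest d x).tl e')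
  · obtain ⟨h1, h2, h3, -⟩ := (hd_eq_tl_iff x _ _).1 i2
    cases hp : e.phase with
    | false => exact .inl ⟨_, (next_of_phase hp).symm.trans h3.symm⟩
    | true =>
      refine .inr (.inl ⟨e.main.1, ?_, h1, hp, rfl, by simpa [hp] using h2⟩)
      rw [h3]
      simp [next, hp, h1, Vtx.fwd, move]
  by_cases i3 : (M.forest d x).hd e' = some ((M.forest d x).tl e)
  · obtain ⟨h1, h2, h3, -⟩ := (hd_eq_tl_iff x _ _).1 i3
    cases hp : e'.phase with
    | false =>
      -- A predecessor through rewriting differs from `e` in the local part only.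
      left
      rw [next_of_phase hp] at h3
      exact ⟨e'.pre, by rw [h3, setPre_setPre]⟩
    | true =>
      right; right
      obtain ⟨a, b, c, t⟩ := e'
      simp only at h1 hp
      subst h1 hp
      have h4 : Timer.carry t (M.len d) = false := by simpa using h2
      subst h3
      refine ⟨c.1, ?_, rfl, rfl, rfl, ?_⟩
      · simp [next, Vtx.bwd, move, unrot_rot, Timer.dec_inc]
      · simp only [next, if_true]
        rw [Timer.borrow_inc t le_rfl, h4]
  by_cases i4 : (M.forest d x).hd e = (M.forest d x).hd e' ∧ (M.forest d x).hd e ≠ none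
  · left
    rcases (hd_eq_hd_iff x _ _).1 i4 with ⟨h1, h2, ⟨h3, h4, h5, h6⟩ | ⟨-, rfl, -⟩⟩
    · refine ⟨e'.pre, ?_⟩
      -- Equal rewritings agree outside column 0, since a rewriting changes that column only.
      have h7 : update e.main.2 0 (e'.main.2 0) = e'.main.2 := by
        have := congrArg Prod.snd h5
        simp only [rewrite] at this
        have := congrArg (fun f => update f 0 (e'.main.2 0)) this
        simpa using this
      simp [Vtx.setPre, Vtx.pre, h6, h7]
    · exact ⟨_, setPre_pre _⟩
  · rw [Forest.gram, if_neg i1, if_neg i2, if_neg i3, if_neg i4] at h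
    exact absurd rfl h

open Classical in
/-- Complete description of the rows. -/
theorem gram_eq_iff (e e' : M.Vtx d) {k : ℕ} (hk : k ≠ 0) : (M.forest d x).gram e e' = k ↔
    (∃ u, e.setPre u = e' ∧
      locVal (Timer.carry e.timer (M.len d)) (e.isStart x) e.pre u = k) ∨
    (∃ q, e.fwd q = e' ∧
      (if fwdOk (Timer.carry e.timer (M.len d)) q e.pre then 1 else 0) = k) ∨
    ∃ q, e.bwd q = e' ∧
      (if bwdOk (Timer.borrow e.timer (M.len d)) q e.pre then 1 else 0) = k := by
  constructor
  · rintro rfl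
    rcases exists_slot_of_gram_ne_zero x hk with ⟨u, rfl⟩ | ⟨q, rfl, h⟩ | ⟨q, rfl, h⟩
    · exact .inl ⟨u, rfl, (gram_setPre x e u).symm⟩
    · exact .inr (.inl ⟨q, rfl, by rw [if_pos h, gram_fwd x e q h]⟩)
    · exact .inr (.inr ⟨q, rfl, by rw [if_pos h, gram_bwd x e q h]⟩)
  · rintro (⟨u, rfl, h⟩ | ⟨q, rfl, h⟩ | ⟨q, rfl, h⟩)
    · rw [gram_setPre, h]
    · split_ifs at h with h'
      · rw [gram_fwd x e q h', h]
      · exact absurd h.symm hk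
    · split_ifs at h with h'
      · rw [gram_bwd x e q h', h]
      · exact absurd h.symm hk

theorem gram_le_two (e e' : M.Vtx d) : (M.forest d x).gram e e' ≤ 2 := by
  by_cases h : (M.forest d x).gram e e' = 0
  · omega
  · rcases exists_slot_of_gram_ne_zero x h with ⟨u, rfl⟩ | ⟨q, rfl, h'⟩ | ⟨q, rfl, h'⟩
    · rw [gram_setPre]; exact locVal_le _ _ _ _
    · rw [gram_fwd x e q h']; norm_num
    · rw [gram_bwd x e q h']; norm_num

end gram

end RotMachine

end GappedSuccinct

namespace GappedSuccinct

open Function Turing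

/-! ### Simulation of stack machines by machines with rotating tapes -/

namespace Sim

theorem exists_of_iterate_succ {α : Type} {f : α → Option α} {a c : α} {n : ℕ}
    (h : (flip bind f)^[n + 1] (some a) = some c) :
    ∃ b, (flip bind f)^[n] (some a) = some b ∧ f b = some c := by
  rw [iterate_succ_apply'] at h
  exact Option.bind_eq_some_iff.1 h

open Classical in
/-- One-hot code of an element of a finite type. -/
noncomputable def oneHot (α : Type) [Finite α] (a : α) : Fin (Nat.card α) → Bool :=
  fun i => decide (Finite.equivFin α a = i)

open Classical in
/-- Inverse of the one-hot code. -/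
noncomputable def unHot (α : Type) [Finite α] [Inhabited α] (b : Fin (Nat.card α) → Bool) : α :=
  if h : ∃ a, b (Finite.equivFin α a) = true then h.choose else default

theorem unHot_oneHot (α : Type) [Finite α] [Inhabited α] (a : α) : unHot α (oneHot α a) = a := by
  have h : ∃ a', oneHot α a (Finite.equivFin α a') = true := ⟨a, by simp [oneHot]⟩
  rw [unHot, dif_pos h]
  exact ((Finite.equivFin α).injective (of_decide_eq_true h.choose_spec)).symm

variable {K : Type} {Γ : K → Type} {Λ σ : Type}

open Classical in
/-- Code of a column: for each stack and symbol, a bit tells whether the cell holds the symbol. -/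
noncomputable def encCol [Finite (Σ k, Γ k)] (c : ∀ k, Option (Γ k)) :
    Fin (Nat.card (Σ k, Γ k)) → Bool :=
  fun j => decide (c ((Finite.equivFin (Σ k, Γ k)).symm j).1 =
    some ((Finite.equivFin (Σ k, Γ k)).symm j).2)

open Classical in
/-- Inverse of the code of columns. -/
noncomputable def decCol [Finite (Σ k, Γ k)] (b : Fin (Nat.card (Σ k, Γ k)) → Bool) (k : K) :
    Option (Γ k) :=
  if h : ∃ a : Γ k, b (Finite.equivFin (Σ k, Γ k) ⟨k, a⟩) = true then some h.choose else none

theorem decCol_encCol [Finite (Σ k, Γ k)] (c : ∀ k, Option (Γ k)) : decCol (encCol c) = c := by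
  funext k
  have hc : ∀ a : Γ k, encCol c (Finite.equivFin (Σ k, Γ k) ⟨k, a⟩) = true ↔ c k = some a := by
    intro a
    -- The pair is generalized because the type of its second component depends on the first.
    have key : ∀ s : Σ k, Γ k, s = ⟨k, a⟩ → (c s.1 = some s.2 ↔ c k = some a) := by
      rintro _ rfl
      exact Iff.rfl
    simpa [encCol] using key _ (Equiv.symm_apply_apply (Finite.equivFin (Σ k, Γ k)) ⟨k, a⟩)
  unfold decCol
  split_ifs with h
  · exact ((hc _).1 h.choose_spec).symm
  · cases hk : c k with
    | none => rfl
    | some a => exact absurd ⟨a, (hc a).2 hk⟩ h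

open Classical in
/-- All substatements of a machine. -/
noncomputable def allStmts [Fintype Λ] (m : Λ → TM2.Stmt Γ Λ σ) : Finset (TM2.Stmt Γ Λ σ) :=
  insert .halt (Finset.univ.biUnion fun l => TM2.stmts₁ (m l))

/-- Control states: a statement to execute, the internal state and the last motion of the tapes; or
a final answer. -/
abbrev Ctrl [Fintype Λ] (m : Λ → TM2.Stmt Γ Λ σ) : Type :=
  ({q // q ∈ allStmts m} × σ × Option (K × Bool)) ⊕ Bool

instance [Fintype Λ] (m : Λ → TM2.Stmt Γ Λ σ) : Inhabited (Ctrl m) := ⟨.inr false⟩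

/-! ### The simulating machine and its single steps -/

section

variable [Fintype Λ] (m : Λ → TM2.Stmt Γ Λ σ) (k₁ : K) (out : Γ k₁ → Bool)

open Classical in
/-- The control state that executes `q`. -/
noncomputable def run (q : TM2.Stmt Γ Λ σ) (v : σ) (o : Option (K × Bool)) : Ctrl m :=
  .inl (if h : q ∈ allStmts m then ⟨q, h⟩ else ⟨.halt, Finset.mem_insert_self _ _⟩, v, o)

open Classical in
/-- The effect of one step on the control and the top symbols. A push takes two steps: first the
tape is moved, then the symbol is written. -/
noncomputable def delta : Ctrl m → (∀ k, Option (Γ k)) → Ctrl m × (∀ k, Option (Γ k))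
  | .inr b, c => (.inr b, c)
  | .inl (q, v, o), c => match q.1 with
    | .push k f q' => match o with
      | some (_, true) => (run m q' v none, update c k (some (f v)))
      | _ => (run m (.push k f q') v (some (k, true)), c)
    | .peek k f q' => (run m q' (f v (c k)) none, c)
    | .pop k f q' => (run m q' (f v (c k)) (some (k, false)), update c k none)
    | .load f q' => (run m q' (f v) none, c)
    | .branch f q₁ q₂ => (run m (cond (f v) q₁ q₂) v none, c)
    | .goto f => (run m (m (f v)) v none, c)
    | .halt => (.inr (((c k₁).map out).getD false), c)

open Classical in
/-- The motion of the tapes. -/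
noncomputable def motion (s : Ctrl m) (k : K) : Shift :=
  match s with
  | .inl (_, _, some (k', b)) => if k = k' then (if b then .right else .left) else .stay
  | _ => .stay

variable [Finite K] [∀ k, Finite (Γ k)] [Finite σ]

open Classical in
/-- The simulating machine. -/
noncomputable def machine (k₀ : K) (inp : Bool → Γ k₀) (l₀ : Λ) (v₀ : σ) : RotMachine where
  q := Nat.card (Ctrl m)
  w := Nat.card (Σ k, Γ k)
  F b := (oneHot _ (delta m k₁ out (unHot _ b.1) (decCol b.2)).1,
    encCol (delta m k₁ out (unHot _ b.1) (decCol b.2)).2)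
  shift b j := motion m (unHot _ b) ((Finite.equivFin (Σ k, Γ k)).symm j).1
  acc b := decide (unHot (Ctrl m) b = .inr true)
  start := oneHot _ (run m (m l₀) v₀ none)
  code b := encCol (update (fun _ => none) k₀ (some (inp b)))

variable (k₀ : K) (inp : Bool → Γ k₀) (l₀ : Λ) (v₀ : σ) {d : ℕ}

/-- The configuration with given control and cells. -/
noncomputable def conf (s : Ctrl m) (g : Fin (d + 2) → ∀ k, Option (Γ k)) :
    (machine m k₁ out k₀ inp l₀ v₀).Main d :=
  (oneHot _ s, fun i => encCol (g i))

-- On codes the bit functions decode, apply `delta` and encode again. A rotation may be performed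
-- track by track because all tracks of one stack `k` move alike.
open Classical in
theorem step_conf (s : Ctrl m) (g : Fin (d + 2) → ∀ k, Option (Γ k)) :
    RotMachine.step (conf m k₁ out k₀ inp l₀ v₀ s g) =
      conf m k₁ out k₀ inp l₀ v₀ (delta m k₁ out s (g 0)).1 (fun i k =>
        update g 0 (delta m k₁ out s (g 0)).2
          (i + (motion m (delta m k₁ out s (g 0)).1 k).offset) k) := by
  have h1 : RotMachine.rewrite (conf m k₁ out k₀ inp l₀ v₀ s g) =
      conf m k₁ out k₀ inp l₀ v₀ (delta m k₁ out s (g 0)).1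
        (update g 0 (delta m k₁ out s (g 0)).2) := by
    refine Prod.ext ?_ ?_
    · simp [RotMachine.rewrite, conf, machine, unHot_oneHot, decCol_encCol]
    · funext i
      simp only [RotMachine.rewrite, conf, machine, unHot_oneHot, decCol_encCol]
      by_cases hi : i = 0
      · subst hi; simp
      · simp [hi]
  rw [RotMachine.step, h1]
  refine Prod.ext rfl ?_
  funext i j
  simp only [RotMachine.move, RotMachine.rot, conf, machine, unHot_oneHot, encCol]

/-- The cells of a tape that hold stacks. -/
def cells (stk : ∀ k, List (Γ k)) : Fin (d + 2) → ∀ k, Option (Γ k) := fun i k => (stk k)[i.val]?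

theorem step_stay (s s' : Ctrl m) (g : Fin (d + 2) → ∀ k, Option (Γ k))
    (h : delta m k₁ out s (g 0) = (s', g 0)) (hm : ∀ k, motion m s' k = .stay) :
    RotMachine.step (conf m k₁ out k₀ inp l₀ v₀ s g) = conf m k₁ out k₀ inp l₀ v₀ s' g := by
  rw [step_conf, h]
  simp [hm, Shift.offset]

variable [DecidableEq K]

theorem step_pop (s s' : Ctrl m) (stk : ∀ k, List (Γ k)) (k : K)
    (h : delta m k₁ out s (cells (d := d) stk 0) = (s', update (cells (d := d) stk 0) k none))
    (hm : ∀ k', motion m s' k' = if k' = k then .left else .stay)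
    (hlen : (stk k).length ≤ d + 2) :
    RotMachine.step (conf (d := d) m k₁ out k₀ inp l₀ v₀ s (cells stk)) =
      conf m k₁ out k₀ inp l₀ v₀ s' (cells (update stk k (stk k).tail)) := by
  rw [step_conf, h]
  congr 1
  funext i k'
  simp only [hm]
  by_cases hk : k' = k
  · subst hk
    simp only [if_true, Shift.offset]
    -- The last column receives the erased top cell by wrapping round; this is correct because the
    -- shortened stack does not reach that far.
    by_cases hi : i = Fin.last (d + 1)
    · subst hi
      simp [cells, hlen]
    · have h0 : i + 1 ≠ 0 := by
        intro h
        have := congrArg Fin.val h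
        rw [Fin.val_add_one, if_neg hi] at this
        simp at this
      rw [update_of_ne h0]
      simp [cells, Fin.val_add_one, hi]
  · simp only [if_neg hk, Shift.offset, add_zero, cells, update_of_ne hk]
    by_cases hi : i = 0
    · subst hi; simp [hk, cells]
    · simp [hi, cells]

/-- The motion depends on the new control and follows the rewriting, so a push first rotates to the
right and then overwrites the cell that has wrapped round into column 0. The mark `some (k, true)`
tells that the first half is done, hence `ho`. -/
theorem step_push (q' : TM2.Stmt Γ Λ σ) (v : σ) (o : Option (K × Bool)) (k : K) (f : σ → Γ k)
    (ho : ∀ k, o ≠ some (k, true)) (stk : ∀ k, List (Γ k)) (hq : .push k f q' ∈ allStmts m) :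
    RotMachine.step^[2] (conf (d := d) m k₁ out k₀ inp l₀ v₀ (run m (.push k f q') v o)
        (cells stk)) =
      conf m k₁ out k₀ inp l₀ v₀ (run m q' v none) (cells (update stk k (f v :: stk k))) := by
  have h1 : ∀ c, delta m k₁ out (run m (.push k f q') v o) c =
      (run m (.push k f q') v (some (k, true)), c) := by
    intro c
    rcases o with _ | ⟨k', b⟩
    · simp [delta, run, hq]
    · cases b
      · simp [delta, run, hq]
      · exact absurd rfl (ho k')
  have h2 : ∀ c, delta m k₁ out (run m (.push k f q') v (some (k, true))) c =
      (run m q' v none, update c k (some (f v))) := by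
    intro c
    simp only [delta, run, hq, dif_pos]
    congr 1
    funext k'
    by_cases hk : k' = k
    · subst hk; simp
    · simp [hk]
  have m1 : ∀ k', motion m (run m (.push k f q') v (some (k, true))) k' =
      if k' = k then .right else .stay := by
    intro k'
    simp [motion, run]
  have m2 : ∀ k', motion m (run m q' v none) k' = .stay := fun k' => rfl
  rw [iterate_succ_apply, iterate_one, step_conf, h1, step_conf, h2]
  congr 1
  funext i k'
  simp only [m1, m2, Shift.offset, add_zero, update_eq_self]
  by_cases hi : i = 0
  · subst hi
    by_cases hk : k' = k
    · subst hk; simp [cells]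
    · simp [hk, cells]
  · by_cases hk : k' = k
    · subst hk
      obtain ⟨j, rfl⟩ := Fin.exists_succ_eq.2 hi
      have : (j.succ + -1 : Fin (d + 2)) = j.castSucc := by
        rw [← Fin.coeSucc_eq_succ, add_neg_cancel_right]
      simp [cells, this]
    · simp [hi, hk, cells]

/-- The number of pushes in a statement. -/
def pushes : TM2.Stmt Γ Λ σ → ℕ
  | .push _ _ q => pushes q + 1
  | .peek _ _ q => pushes q
  | .pop _ _ q => pushes q
  | .load _ q => pushes q
  | .branch _ q₁ q₂ => pushes q₁ + pushes q₂
  | .goto _ => 0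
  | .halt => 0

/-- The control state at the beginning of a step. -/
noncomputable def atCfg (c : TM2.Cfg Γ Λ σ) (o : Option (K × Bool)) : Ctrl m :=
  run m (c.l.elim .halt m) c.var o

/-- The simulating machine comes from the given control state and stacks to the configuration
`c`. -/
def Leads (d : ℕ) (s : Ctrl m) (stk : ∀ k, List (Γ k)) (c : TM2.Cfg Γ Λ σ) : Prop :=
  ∃ (n : ℕ) (o' : Option (K × Bool)), (∀ k, o' ≠ some (k, true)) ∧
    RotMachine.step^[n] (conf (d := d) m k₁ out k₀ inp l₀ v₀ s (cells stk)) =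
      conf m k₁ out k₀ inp l₀ v₀ (atCfg m c o') (cells c.stk)

/-- Induction on the statement. A step of the stack machine may execute several pushes, so within a
statement the stacks may exceed their length at its beginning by `pushes q`; the length hypothesis
reserves this room. -/
theorem simulate_stmt (q : TM2.Stmt Γ Λ σ) : ∀ (v : σ) (o : Option (K × Bool))
    (stk : ∀ k, List (Γ k)), TM2.stmts₁ q ⊆ allStmts m → (∀ k, o ≠ some (k, true)) →
    (∀ k, (stk k).length + pushes q ≤ d + 2) →
    Leads m k₁ out k₀ inp l₀ v₀ d (run m q v o) stk (TM2.stepAux q v stk) := by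
  have stay : ∀ (s s' : Ctrl m) (stk : ∀ k, List (Γ k)) (c : TM2.Cfg Γ Λ σ),
      delta m k₁ out s (cells (d := d) stk 0) = (s', cells (d := d) stk 0) →
      (∀ k, motion m s' k = .stay) → Leads m k₁ out k₀ inp l₀ v₀ d s' stk c →
      Leads m k₁ out k₀ inp l₀ v₀ d s stk c := by
    rintro s s' stk c h hm ⟨n, o', ho, hP⟩
    refine ⟨n + 1, o', ho, ?_⟩
    rwa [iterate_succ_apply, step_stay m k₁ out k₀ inp l₀ v₀ s s' (cells stk) h hm]
  have sub : ∀ {q q' : TM2.Stmt Γ Λ σ}, TM2.stmts₁ q ⊆ allStmts m → q' ∈ TM2.stmts₁ q →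
      TM2.stmts₁ q' ⊆ allStmts m := fun h h' => (TM2.stmts₁_trans h').trans h
  have self : ∀ {q : TM2.Stmt Γ Λ σ}, TM2.stmts₁ q ⊆ allStmts m → q ∈ allStmts m :=
    fun h => h TM2.stmts₁_self
  have htop : ∀ (stk : ∀ k, List (Γ k)) (k : K), cells (d := d) stk 0 k = (stk k).head? := by
    intro stk k
    simp [cells, List.head?_eq_getElem?]
  induction q with
  | push k f q ih =>
    intro v o stk hq ho hlen
    obtain ⟨n, o', ho', h⟩ := ih v none (update stk k (f v :: stk k))
      (sub hq (by simp [TM2.stmts₁, TM2.stmts₁_self])) (by simp) (by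
        intro k'
        have := hlen k'
        by_cases hk : k' = k
        · subst hk; simp [pushes] at this ⊢; omega
        · simp [hk, pushes] at this ⊢; omega)
    refine ⟨n + 2, o', ho', ?_⟩
    rw [iterate_add_apply, step_push m k₁ out k₀ inp l₀ v₀ q v o k f ho stk (self hq), h]
    rfl
  | peek k f q ih =>
    intro v o stk hq ho hlen
    refine stay _ (run m q (f v (stk k).head?) none) stk _ ?_ (fun _ => rfl)
      (ih _ none stk (sub hq (by simp [TM2.stmts₁, TM2.stmts₁_self])) (by simp) hlen)
    simp [delta, run, self hq, htop]
  | pop k f q ih =>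
    intro v o stk hq ho hlen
    obtain ⟨n, o', ho', h⟩ := ih (f v (stk k).head?) (some (k, false)) (update stk k (stk k).tail)
      (sub hq (by simp [TM2.stmts₁, TM2.stmts₁_self])) (by simp) (by
        intro k'
        have := hlen k'
        by_cases hk : k' = k
        · subst hk; simp [pushes] at this ⊢; omega
        · simpa [hk, pushes] using this)
    refine ⟨n + 1, o', ho', ?_⟩
    rw [iterate_succ_apply, step_pop m k₁ out k₀ inp l₀ v₀ _
      (run m q (f v (stk k).head?) (some (k, false))) stk k ?_ ?_ ?_, h]
    · rfl
    · simp only [delta, run, self hq, dif_pos, htop]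
      congr 1
      funext k'
      by_cases hk : k' = k
      · subst hk; simp
      · simp [hk]
    · intro k'
      simp [motion, run]
    · have := hlen k
      omega
  | load f q ih =>
    intro v o stk hq ho hlen
    refine stay _ (run m q (f v) none) stk _ ?_ (fun _ => rfl)
      (ih _ none stk (sub hq (by simp [TM2.stmts₁, TM2.stmts₁_self])) (by simp) hlen)
    simp [delta, run, self hq]
  | branch f q₁ q₂ ih₁ ih₂ =>
    intro v o stk hq ho hlen
    refine stay _ (run m (cond (f v) q₁ q₂) v none) stk _ ?_ (fun _ => rfl) ?_
    · simp [delta, run, self hq]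
    · simp only [TM2.stepAux]
      cases f v with
      | true =>
        exact ih₁ v none stk (sub hq (by simp [TM2.stmts₁, TM2.stmts₁_self])) (by simp)
          fun k => le_trans (by simp [pushes]) (hlen k)
      | false =>
        exact ih₂ v none stk (sub hq (by simp [TM2.stmts₁, TM2.stmts₁_self])) (by simp)
          fun k => le_trans (by simp [pushes]) (hlen k)
  | goto f =>
    intro v o stk hq ho hlen
    refine stay _ (run m (m (f v)) v none) stk _ ?_ (fun _ => rfl) ⟨0, none, by simp, rfl⟩
    simp [delta, run, self hq]
  | halt =>
    intro v o stk hq ho hlen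
    exact ⟨0, o, ho, rfl⟩

/-- The simulating machine follows a computation whose stacks remain short. -/
theorem simulate (c₀ : TM2.Cfg Γ Λ σ) (s : ℕ) (hs : s + ∑ l, pushes (m l) ≤ d + 2)
    (hspace : ∀ c, StateTransition.Reaches (TM2.step m) c₀ c → ∀ k, (c.stk k).length ≤ s) (n : ℕ) :
    ∀ c, (flip bind (TM2.step m))^[n] (some c₀) = some c →
      StateTransition.Reaches (TM2.step m) c₀ c ∧
      Leads m k₁ out k₀ inp l₀ v₀ d (atCfg m c₀ none) c₀.stk c := by
  induction n with
  | zero =>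
    intro c h
    obtain rfl : c₀ = c := by simpa using h
    exact ⟨.refl, 0, none, by simp, rfl⟩
  | succ n ih =>
    intro c h
    obtain ⟨c', h', hc⟩ := exists_of_iterate_succ h
    obtain ⟨hr, n', o, ho, hn'⟩ := ih c' h'
    refine ⟨hr.tail hc, ?_⟩
    obtain ⟨l, v, stk⟩ := c'
    cases l with
    | none => simp at hc
    | some l =>
      simp only [TM2.step, Option.some.injEq] at hc
      subst hc
      have hsub : TM2.stmts₁ (m l) ⊆ allStmts m := by
        classical
        intro q hq
        exact Finset.mem_insert_of_mem (Finset.mem_biUnion.2 ⟨l, Finset.mem_univ _, hq⟩)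
      have hp : pushes (m l) ≤ ∑ l, pushes (m l) :=
        Finset.single_le_sum (f := fun l => pushes (m l)) (fun _ _ => Nat.zero_le _)
          (Finset.mem_univ l)
      obtain ⟨n'', o', ho', hn''⟩ := simulate_stmt (d := d) m k₁ out k₀ inp l₀ v₀ (m l) v o stk hsub
        ho (fun k => by have := hspace _ hr k; simp only at this; omega)
      refine ⟨n'' + n', o', ho', ?_⟩
      rw [iterate_add_apply, hn']
      exact hn''

end

end Sim

open Sim in
/-- A stack machine that answers in bounded space is simulated by a machine with rotating tapes. -/
theorem exists_rotMachine (M : TM2ComputableAux Bool Bool) (hfin : ∀ k, Finite (M.tm.Γ k)) :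
    ∃ (R : RotMachine) (C : ℕ), ∀ x b s d, AnswersInSpace M x b s → s + C ≤ d + 2 →
      ∃ (n : ℕ) (c : R.Main d), RotMachine.step^[n] (R.init d x) = c ∧ RotMachine.step c = c ∧
        R.acc c.1 = b := by
  classical
  let _ := M.tm.kFin
  let _ := M.tm.ΛFin
  let _ := M.tm.σFin
  refine ⟨Sim.machine M.tm.m M.tm.k₁ M.outputAlphabet M.tm.k₀ M.inputAlphabet.symm M.tm.main
    M.tm.initialState, ∑ l, pushes (M.tm.m l), ?_⟩
  rintro x b s d ⟨⟨⟨N, hN⟩⟩, hsp⟩ hs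
  have hsp' : ∀ c, StateTransition.Reaches (TM2.step M.tm.m) (initCfg M x) c →
      ∀ k, (c.stk k).length ≤ s := by
    intro c hc k
    refine le_trans ?_ (hsp c hc)
    exact Finset.single_le_sum (f := fun k => (c.stk k).length) (fun _ _ => Nat.zero_le _)
      (Finset.mem_univ k)
  obtain ⟨-, n, o, ho, hn⟩ := Sim.simulate M.tm.m M.tm.k₁ M.outputAlphabet M.tm.k₀
    M.inputAlphabet.symm M.tm.main M.tm.initialState (initCfg M x) s hs hsp' N _ hN
  have hinit : (Sim.machine M.tm.m M.tm.k₁ M.outputAlphabet M.tm.k₀ M.inputAlphabet.symm M.tm.main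
      M.tm.initialState).init d x = Sim.conf M.tm.m M.tm.k₁ M.outputAlphabet M.tm.k₀
        M.inputAlphabet.symm M.tm.main M.tm.initialState (atCfg M.tm.m (initCfg M x) none)
        (cells (initCfg M x).stk) := by
    refine Prod.ext rfl ?_
    funext i
    simp only [RotMachine.init, RotMachine.startCell, conf, machine]
    -- Columns within the input hold one symbol, on the track of `k₀`; all further columns are
    -- blank.
    split_ifs with h
    · congr 1
      funext k
      by_cases hk : k = M.tm.k₀
      · subst hk
        simp [cells, initCfg, initList, h]
      · simp [cells, initCfg, initList, hk]
    · funext j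
      simp only [encCol, Bool.false_eq, decide_eq_false_iff_not]
      generalize (Finite.equivFin (Σ k, M.tm.Γ k)).symm j = p
      obtain ⟨k, a⟩ := p
      by_cases hk : k = M.tm.k₀
      · subst hk
        simp [cells, initCfg, initList, not_lt.1 h]
      · simp [cells, initCfg, initList, hk]
  set c := haltList M.tm (List.map M.outputAlphabet.invFun [b]) with hc
  have htop : cells (d := d) c.stk 0 M.tm.k₁ = some (M.outputAlphabet.symm b) := by
    simp [cells, hc, haltList]
  have hfix : ∀ g : Fin (d + 2) → ∀ k, Option (M.tm.Γ k),
      RotMachine.step (conf M.tm.m M.tm.k₁ M.outputAlphabet M.tm.k₀ M.inputAlphabet.symm M.tm.main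
        M.tm.initialState (.inr b) g) = conf M.tm.m M.tm.k₁ M.outputAlphabet M.tm.k₀
          M.inputAlphabet.symm M.tm.main M.tm.initialState (.inr b) g :=
    fun g => step_stay _ _ _ _ _ _ _ _ _ g rfl fun _ => rfl
  refine ⟨n + 1, conf M.tm.m M.tm.k₁ M.outputAlphabet M.tm.k₀ M.inputAlphabet.symm M.tm.main
        M.tm.initialState (.inr b) (cells c.stk), ?_, hfix _, ?_⟩
  -- One more step executes `halt` and turns the top of the output stack into the final control
  -- state, which is fixed.
  · rw [iterate_succ_apply', hinit]
    refine (congrArg RotMachine.step hn).trans ?_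
    refine step_stay _ _ _ _ _ _ _ _ _ (cells c.stk) ?_ fun _ => rfl
    have hmem : TM2.Stmt.halt ∈ allStmts M.tm.m := Finset.mem_insert_self _ _
    have hl : c.l = none := rfl
    simp [atCfg, hl, run, hmem, delta, htop]
  · simp only [machine, conf, unHot_oneHot]
    cases b <;> simp

end GappedSuccinct

namespace GappedSuccinct

open Function

/-! ### Parametrized circuits and the text of their codes -/

/-- A linear combination of the lengths of registers. -/
structure Lin where
  regs : List Par
  const : ℕ

/-- The value of a linear combination. -/
def Lin.val (ρ : Par → List Bool) (a : Lin) : ℕ := (a.regs.map fun p => (ρ p).length).sum + a.const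

/-- The linear combination `a * |pat| + b * |cols| + c * |idx| + k`. -/
def lin (a b c k : ℕ) : Lin :=
  ⟨List.replicate a .pat ++ (List.replicate b .cols ++ List.replicate c .idx), k⟩

@[simp] theorem val_lin (ρ : Par → List Bool) (a b c k : ℕ) : (lin a b c k).val ρ =
    a * (ρ .pat).length + b * (ρ .cols).length + c * (ρ .idx).length + k := by
  simp [Lin.val, lin]
  ring

/-- The text of the code of the value. -/
def Lin.atoms (a : Lin) : List Atom :=
  a.regs.map .reg ++ (List.replicate a.const (.lit true) ++ [.lit false])

theorem atomsText_append (ρ : Par → List Bool) (as bs : List Atom) :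
    atomsText ρ (as ++ bs) = atomsText ρ as ++ atomsText ρ bs := List.flatMap_append

theorem atomsText_lin (ρ : Par → List Bool) (a : Lin) :
    atomsText ρ a.atoms = encodeNat (a.val ρ) := by
  have h1 : ∀ l : List Par, atomsText ρ (l.map .reg) =
      List.replicate (l.map fun p => (ρ p).length).sum true := by
    intro l
    induction l with
    | nil => rfl
    | cons p l ih =>
      simp only [atomsText, List.map_cons, List.flatMap_cons, Atom.text, List.sum_cons] at ih ⊢
      rw [ih, List.replicate_add]
  have h2 : ∀ n, atomsText ρ (List.replicate n (.lit true)) = List.replicate n true := by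
    intro n
    induction n with
    | zero => rfl
    | succ n ih =>
      simp only [atomsText, List.replicate_succ, List.flatMap_cons, Atom.text] at ih ⊢
      rw [ih]; rfl
  rw [Lin.atoms, atomsText_append, atomsText_append, h1, h2, encodeNat, Lin.val, List.replicate_add,
    List.append_assoc]
  rfl

/-- A gate with parametrized arguments. -/
inductive SGate where
  | const (b : Bool)
  | not (a : Lin)
  | and (a b : Lin)
  | or (a b : Lin)

/-- The gate for given parameters. -/
def SGate.gate (ρ : Par → List Bool) : SGate → Gate
  | const b => .const b
  | not a => .not (a.val ρ)
  | and a b => .and (a.val ρ) (b.val ρ)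
  | or a b => .or (a.val ρ) (b.val ρ)

/-- The text of the code of a gate. -/
def SGate.atoms : SGate → List Atom
  | const b => [.lit false, .lit false, .lit b]
  | not a => [.lit false, .lit true] ++ a.atoms
  | and a b => [.lit true, .lit false] ++ (a.atoms ++ b.atoms)
  | or a b => [.lit true, .lit true] ++ (a.atoms ++ b.atoms)

theorem atomsText_gate (ρ : Par → List Bool) (g : SGate) :
    atomsText ρ g.atoms = (g.gate ρ).encode := by
  cases g with
  | const b => rfl
  | not a => rw [SGate.atoms, atomsText_append, atomsText_lin]; rfl
  | and a b =>
    rw [SGate.atoms, atomsText_append, atomsText_append, atomsText_lin, atomsText_lin]; rfl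
  | or a b =>
    rw [SGate.atoms, atomsText_append, atomsText_append, atomsText_lin, atomsText_lin]; rfl

/-- A part of a parametrized list: one item, or a loop. -/
inductive Part (α : Type) where
  | one (a : α)
  | loop (p : Par) (body : Bool → List α)

section Part

variable {α β : Type}

/-- The contribution of a loop over the remaining bits `l`, with index starting from `i`. -/
def expandLoop (sem : (Par → List Bool) → α → β) (ρ : Par → List Bool) (body : Bool → List α) :
    ℕ → List Bool → List β
  | _, [] => []
  | i, b :: l => (body b).map (sem (update ρ .idx (List.replicate i true))) ++
      expandLoop sem ρ body (i + 1) l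

/-- The contribution of a part. -/
def Part.expand (sem : (Par → List Bool) → α → β) (ρ : Par → List Bool) : Part α → List β
  | one a => [sem ρ a]
  | loop p body => expandLoop sem ρ body 0 (ρ p)

/-- The parametrized list. -/
def expand (sem : (Par → List Bool) → α → β) (ρ : Par → List Bool) (ps : List (Part α)) : List β :=
  ps.flatMap (Part.expand sem ρ)

/-- The text of the code of the items of a part. -/
def Part.item (at' : α → List Atom) : Part α → List Item
  | one a => .atom (.lit true) :: (at' a).map .atom
  | loop p body => [.loop p fun b => (body b).flatMap fun a => .lit true :: at' a]

theorem itemsText_append (ρ : Par → List Bool) (as bs : List Item) :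
    itemsText ρ (as ++ bs) = itemsText ρ as ++ itemsText ρ bs := List.flatMap_append

theorem itemsText_atoms (ρ : Par → List Bool) (as : List Atom) :
    itemsText ρ (as.map .atom) = atomsText ρ as := by
  simp [itemsText, atomsText, List.flatMap_map, Item.text]

theorem encodeList_eq {e : β → List Bool} (l : List β) :
    encodeList e l = (l.flatMap fun b => true :: e b) ++ [false] := by
  induction l with
  | nil => rfl
  | cons a l ih => simp [encodeList, ih]

variable {sem : (Par → List Bool) → α → β} {at' : α → List Atom} {e : β → List Bool}

theorem itemsText_parts (h : ∀ ρ a, atomsText ρ (at' a) = e (sem ρ a)) (ρ : Par → List Bool)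
    (ps : List (Part α)) :
    itemsText ρ (ps.flatMap (Part.item at')) = (expand sem ρ ps).flatMap fun b => true :: e b := by
  have hb : ∀ ρ (l : List α), atomsText ρ (l.flatMap fun a => .lit true :: at' a) =
      (l.map (sem ρ)).flatMap fun b => true :: e b := by
    intro ρ l
    induction l with
    | nil => rfl
    | cons a l ih =>
      rw [List.flatMap_cons, atomsText_append, ih, List.map_cons, List.flatMap_cons, ← h ρ a]
      rfl
  induction ps with
  | nil => rfl
  | cons p ps ih =>
    have hc : expand sem ρ (p :: ps) = p.expand sem ρ ++ expand sem ρ ps := List.flatMap_cons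
    rw [List.flatMap_cons, itemsText_append, ih, hc, List.flatMap_append]
    congr 1
    cases p with
    | one a =>
      have := itemsText_atoms ρ (at' a)
      rw [h] at this
      simp only [Part.item, itemsText, List.flatMap_cons, Item.text, Atom.text] at this ⊢
      rw [this]
      simp [Part.expand]
    | loop p body =>
      simp only [Part.item, itemsText, List.flatMap_cons, List.flatMap_nil, List.append_nil,
        Item.text, Part.expand]
      generalize ρ p = l
      generalize 0 = i
      induction l generalizing i with
      | nil => rfl
      | cons b l ih => rw [loopText, expandLoop, List.flatMap_append, ih, hb]

end Part

/-- A parametrized circuit. -/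
structure SCircuit where
  arity : Lin
  gates : List (Part SGate)
  outputs : List (Part Lin)

namespace SCircuit

/-- The circuit for given parameters. -/
def circuit (C : SCircuit) (ρ : Par → List Bool) : Circuit where
  arity := C.arity.val ρ
  gates := expand SGate.gate ρ C.gates
  outputs := expand Lin.val ρ C.outputs

/-- The text of the code of the circuit. -/
def items (C : SCircuit) : List Item :=
  C.arity.atoms.map .atom ++ (C.gates.flatMap (Part.item SGate.atoms) ++
    ([.atom (.lit false)] ++ (C.outputs.flatMap (Part.item Lin.atoms) ++ [.atom (.lit false)])))

/-- Unary wire numbers make this possible: a linear combination of register lengths is printed by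
printing the registers one after the other. -/
theorem itemsText_items (C : SCircuit) (ρ : Par → List Bool) :
    itemsText ρ C.items = (C.circuit ρ).encode := by
  rw [items, itemsText_append, itemsText_append, itemsText_append, itemsText_append,
    itemsText_atoms, atomsText_lin, itemsText_parts (fun ρ a => atomsText_gate ρ a),
    itemsText_parts (fun ρ a => atomsText_lin ρ a), Circuit.encode, encodeList_eq, encodeList_eq]
  simp only [circuit, List.append_assoc]
  rfl

end SCircuit

/-! ### Evaluation of circuits -/

/-- The values of all wires, after some more gates. -/
def runGates (w : List Bool) (gs : List Gate) : List Bool :=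
  gs.foldl (fun w g => w ++ [g.eval w]) w

theorem runGates_cons (w : List Bool) (g : Gate) (gs : List Gate) :
    runGates w (g :: gs) = runGates (w ++ [g.eval w]) gs := rfl

theorem exists_runGates_eq (gs : List Gate) : ∀ w, ∃ v, runGates w gs = w ++ v ∧
    v.length = gs.length := by
  induction gs with
  | nil => exact fun w => ⟨[], by simp [runGates]⟩
  | cons g gs ih =>
    intro w
    obtain ⟨v, h, hl⟩ := ih (w ++ [g.eval w])
    exact ⟨g.eval w :: v, by rw [runGates_cons, h]; simp, by simp [hl]⟩

theorem getD_runGates (w : List Bool) (gs : List Gate) {p : ℕ} (hp : p < w.length) :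
    (runGates w gs).getD p false = w.getD p false := by
  obtain ⟨v, h, hl⟩ := exists_runGates_eq gs w
  rw [h, List.getD_append _ _ _ _ hp]

/-- The arguments of the gates are earlier wires, where the first gate has number `n`. -/
def GatesBelow : ℕ → List Gate → Prop
  | _, [] => True
  | n, g :: gs => g.ArgsBelow n ∧ GatesBelow (n + 1) gs

theorem gatesBelow_append {n : ℕ} {gs hs : List Gate} :
    GatesBelow n (gs ++ hs) ↔ GatesBelow n gs ∧ GatesBelow (n + gs.length) hs := by
  induction gs generalizing n with
  | nil => simp [GatesBelow]
  | cons g gs ih =>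
    simp only [List.cons_append, GatesBelow, ih, and_assoc, List.length_cons,
      show n + 1 + gs.length = n + (gs.length + 1) by ring]

theorem GatesBelow.getElem {n : ℕ} {gs : List Gate} (h : GatesBelow n gs) (t : ℕ)
    (ht : t < gs.length) : (gs[t]).ArgsBelow (n + t) := by
  induction gs generalizing n t with
  | nil => simp at ht
  | cons g gs ih =>
    cases t with
    | zero => exact h.1
    | succ t =>
      have := ih h.2 t (by simpa using ht)
      simpa [show n + 1 + t = n + (t + 1) by ring] using this

/-- The values of the gates are as they should, where the first gate has number `n`. -/
def Holds (W : List Bool) : ℕ → List Gate → Prop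
  | _, [] => True
  | n, g :: gs => W.getD n false = g.eval W ∧ Holds W (n + 1) gs

theorem holds_append {W : List Bool} {n : ℕ} {gs hs : List Gate} :
    Holds W n (gs ++ hs) ↔ Holds W n gs ∧ Holds W (n + gs.length) hs := by
  induction gs generalizing n with
  | nil => simp [Holds]
  | cons g gs ih =>
    simp only [List.cons_append, Holds, ih, and_assoc, List.length_cons,
      show n + 1 + gs.length = n + (gs.length + 1) by ring]

/-- Appending wires does not alter earlier ones, so every gate equation persists in the final list.
Afterwards circuits are analysed through these equations alone, without following the evaluation. -/
theorem holds_runGates {gs : List Gate} : ∀ {w : List Bool}, GatesBelow w.length gs →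
    Holds (runGates w gs) w.length gs := by
  induction gs with
  | nil => exact fun _ => trivial
  | cons g gs ih =>
    intro w h
    have hw : (w ++ [g.eval w]).length = w.length + 1 := by simp
    refine ⟨?_, hw ▸ ih (hw ▸ h.2)⟩
    have hg : g.eval (runGates w (g :: gs)) = g.eval w := by
      have := h.1
      cases g with
      | const b => rfl
      | not i => simp only [Gate.eval, getD_runGates _ _ this]
      | and i j | or i j => simp only [Gate.eval, getD_runGates _ _ this.1, getD_runGates _ _ this.2]
    rw [hg, runGates_cons, getD_runGates _ _ (by omega)]
    simp

/-! ### Formulas -/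

/-- Boolean formulas. -/
inductive Fml where
  | const (b : Bool)
  | var (i : ℕ)
  | not (F : Fml)
  | and (F G : Fml)
  | or (F G : Fml)

namespace Fml

/-- The value of a formula. -/
def eval (η : ℕ → Bool) : Fml → Bool
  | const b => b
  | var i => η i
  | not F => !eval η F
  | and F G => eval η F && eval η G
  | or F G => eval η F || eval η G

/-- A formula for a Boolean function of the first `n` variables. -/
def ofFun : ℕ → ((ℕ → Bool) → Bool) → Fml
  | 0, f => const (f fun _ => false)
  | n + 1, f => or (and (var n) (ofFun n fun η => f (update η n true)))
      (and (not (var n)) (ofFun n f))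

theorem eval_ofFun (η : ℕ → Bool) (n : ℕ) : ∀ f,
    eval η (ofFun n f) = f fun i => if i < n then η i else false := by
  induction n with
  | zero => intro f; simp [ofFun, eval]
  | succ n ih =>
    intro f
    simp only [ofFun, eval, ih]
    -- Shannon expansion in the variable `n`; the branch for the value `false` needs no update,
    -- since `false` is the default.
    have h : (fun i => if i < n + 1 then η i else false) =
        update (fun i => if i < n then η i else false) n (η n) := by
      funext i
      by_cases hi : i = n
      · subst hi; simp
      · simp [hi, show (i < n + 1) ↔ i < n by omega]
    rw [h]
    cases hn : η n
    · have : update (fun i => if i < n then η i else false) n false =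
          fun i => if i < n then η i else false := by
        funext i
        by_cases hi : i = n
        · subst hi; simp
        · simp [hi]
      rw [this]
      simp only [Bool.false_and, Bool.not_false, Bool.true_and, Bool.false_or]
    · simp only [Bool.true_and, Bool.not_true, Bool.false_and, Bool.or_false]

/-- The number of gates of a formula. -/
def size : Fml → ℕ
  | const _ => 1
  | var _ => 1
  | not F => size F + 1
  | and F G => size F + size G + 1
  | or F G => size F + size G + 1

theorem size_pos (F : Fml) : 0 < F.size := by cases F <;> simp [size]

/-- The gates of a formula; `v` gives the wires of the variables and `at'` those of the gates. -/
def gates (v : ℕ → Lin) (at' : ℕ → Lin) : Fml → ℕ → List SGate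
  | const b, _ => [.const b]
  | var i, _ => [.and (v i) (v i)]
  | not F, o => gates v at' F o ++ [.not (at' (o + F.size - 1))]
  | and F G, o => gates v at' F o ++ (gates v at' G (o + F.size) ++
      [.and (at' (o + F.size - 1)) (at' (o + F.size + G.size - 1))])
  | or F G, o => gates v at' F o ++ (gates v at' G (o + F.size) ++
      [.or (at' (o + F.size - 1)) (at' (o + F.size + G.size - 1))])

variable {v at' : ℕ → Lin} {ρ : Par → List Bool} {B : ℕ}

theorem length_gates (F : Fml) : ∀ o, (gates v at' F o).length = F.size := by
  induction F with
  | const b => intro o; rfl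
  | var i => intro o; rfl
  | not F ih => intro o; simp [gates, size, ih]
  | and F G ihF ihG => intro o; simp [gates, size, ihF, ihG]; omega
  | or F G ihF ihG => intro o; simp [gates, size, ihF, ihG]; omega

theorem gatesBelow (hv : ∀ i, (v i).val ρ < B) (hat : ∀ o, (at' o).val ρ = B + o) (F : Fml) :
    ∀ o, GatesBelow (B + o) ((gates v at' F o).map (SGate.gate ρ)) := by
  induction F with
  | const b => intro o; simp [gates, GatesBelow, SGate.gate, Gate.ArgsBelow]
  | var i =>
    intro o
    have := hv i
    exact ⟨⟨by omega, by omega⟩, trivial⟩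
  | not F ih =>
    intro o
    have := F.size_pos
    rw [gates, List.map_append, gatesBelow_append]
    refine ⟨ih o, ?_⟩
    simp only [List.map_cons, List.map_nil, GatesBelow, SGate.gate, Gate.ArgsBelow, hat,
      List.length_map, length_gates]
    exact ⟨by omega, trivial⟩
  | and F G ihF ihG | or F G ihF ihG =>
    intro o
    have := F.size_pos
    have := G.size_pos
    rw [gates, List.map_append, gatesBelow_append, List.map_append, gatesBelow_append]
    refine ⟨ihF o, ?_, ?_⟩
    · have := ihG (o + F.size)
      rwa [List.length_map, length_gates, add_assoc]
    · simp only [List.map_cons, List.map_nil, GatesBelow, SGate.gate, Gate.ArgsBelow, hat,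
        List.length_map, length_gates]
      exact ⟨⟨by omega, by omega⟩, trivial⟩

/-- The gates of a formula form a contiguous block that begins at position `o`; its value is on the
last gate of the block, at position `o + F.size - 1`. -/
theorem getD_of_holds (hat : ∀ o, (at' o).val ρ = B + o) {W : List Bool} {η : ℕ → Bool}
    (hη : ∀ i, W.getD ((v i).val ρ) false = η i) (F : Fml) :
    ∀ o, Holds W (B + o) ((gates v at' F o).map (SGate.gate ρ)) →
      W.getD (B + (o + F.size - 1)) false = F.eval η := by
  induction F with
  | const b => exact fun o h => h.1
  | var i =>
    intro o h
    refine h.1.trans ?_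
    change (W.getD ((v i).val ρ) false && W.getD ((v i).val ρ) false) = η i
    rw [hη, Bool.and_self]
  | not F ih =>
    intro o h
    have := F.size_pos
    rw [gates, List.map_append, holds_append, List.length_map, length_gates] at h
    have h2 := h.2.1
    rw [SGate.gate, Gate.eval, hat, ih o h.1, add_assoc] at h2
    exact h2
  | and F G ihF ihG | or F G ihF ihG =>
    intro o h
    have := F.size_pos
    have := G.size_pos
    rw [gates, List.map_append, List.map_append, holds_append, holds_append, List.length_map,
      List.length_map, length_gates, length_gates, add_assoc] at h
    have h2 := h.2.2.1
    rw [SGate.gate, Gate.eval, hat, hat, ihF o h.1, ihG _ h.2.1, add_assoc] at h2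
    rw [size, eval, ← h2]
    congr 1
    omega

end Fml

end GappedSuccinct

namespace GappedSuccinct

open Function

/-! ### Lists of chunks -/

section chunks

variable {α : Type} {f : α → List Bool} {c : ℕ}

theorem length_flatMap_of_chunks {l : List α} (h : ∀ a ∈ l, (f a).length = c) :
    (l.flatMap f).length = l.length * c := by
  induction l with
  | nil => simp
  | cons a l ih =>
    rw [List.flatMap_cons, List.length_append, h a (by simp), ih fun a ha => h a (by simp [ha]),
      List.length_cons]
    ring

theorem getD_append_add {l l' : List Bool} {n : ℕ} (hl : l.length = n) (k : ℕ) :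
    (l ++ l').getD (n + k) false = l'.getD k false := by
  subst hl
  rw [List.getD_append_right _ _ _ _ (by omega), Nat.add_sub_cancel_left]

theorem getD_flatMap_of_chunks {l : List α} (h : ∀ a ∈ l, (f a).length = c) {s j : ℕ}
    (hs : s < l.length) (hj : j < c) :
    (l.flatMap f).getD (s * c + j) false = (f l[s]).getD j false := by
  induction l generalizing s with
  | nil => simp at hs
  | cons a l ih =>
    have ha := h a (by simp)
    cases s with
    | zero =>
      rw [List.flatMap_cons, zero_mul, zero_add, List.getD_append _ _ _ _ (by omega)]
      rfl
    | succ s =>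
      rw [List.flatMap_cons, show (s + 1) * c + j = c + (s * c + j) by ring, getD_append_add ha,
        ih (fun a ha => h a (by simp [ha])) (by simpa using hs)]
      rfl

theorem getD_ofFn {n : ℕ} (g : Fin n → Bool) (j : Fin n) :
    (List.ofFn g).getD j false = g j := by
  simp [List.getD]

end chunks

/-! ### The bits of an index -/

namespace RotMachine

variable {M : RotMachine} {d : ℕ}

/-- The bits of a phase and a configuration. -/
def mainBits (ph : Bool) (c : M.Main d) : List Bool :=
  ph :: (List.ofFn c.1 ++ (List.finRange (d + 2)).flatMap fun i => List.ofFn (c.2 i))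

theorem length_cellBits (cell : Fin (d + 2) → Fin M.w → Bool) :
    ((List.finRange (d + 2)).flatMap fun i => List.ofFn (cell i)).length = M.w * (d + 2) := by
  rw [length_flatMap_of_chunks (c := M.w) (by simp), List.length_finRange, mul_comm]

theorem length_mainBits (ph : Bool) (c : M.Main d) : (mainBits ph c).length = M.len d := by
  rw [mainBits, List.length_cons, List.length_append, length_cellBits, List.length_ofFn, len]
  ring

theorem getD_mainBits_cell (ph : Bool) (c : M.Main d) (i : Fin (d + 2)) (j : Fin M.w) :
    (mainBits ph c).getD (1 + M.q + M.w * i + j) false = c.2 i j := by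
  rw [mainBits, show 1 + M.q + M.w * i + j = (M.q + (i * M.w + j)) + 1 by ring, List.getD_cons_succ,
    getD_append_add (by simp), getD_flatMap_of_chunks (by simp) (by simp) j.2,
    List.getElem_finRange, getD_ofFn]
  rfl

theorem mainBits_inj {ph ph' : Bool} {c c' : M.Main d} :
    mainBits ph c = mainBits ph' c' ↔ ph = ph' ∧ c = c' := by
  refine ⟨fun h => ?_, fun h => by rw [h.1, h.2]⟩
  have h2 : c.2 = c'.2 := by
    funext i j
    rw [← getD_mainBits_cell ph, h, getD_mainBits_cell]
  rw [mainBits, mainBits, List.cons.injEq, h2, List.append_cancel_right_eq] at h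
  exact ⟨h.1, Prod.ext (List.ofFn_injective h.2) h2⟩

/-- The bits of an index. -/
def Vtx.bits (v : M.Vtx d) : List Bool :=
  v.aux :: (mainBits v.phase v.main ++ List.ofFn v.timer)

theorem Vtx.length_bits (v : M.Vtx d) : v.bits.length = 2 * M.len d + 1 := by
  rw [bits, List.length_cons, List.length_append, length_mainBits, List.length_ofFn]
  ring

theorem Vtx.bits_injective : Injective (Vtx.bits : M.Vtx d → List Bool) := by
  intro v v' h
  rw [bits, bits, List.cons.injEq] at h
  obtain ⟨h1, h2⟩ := List.append_inj h.2 (by simp [length_mainBits])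
  obtain ⟨h3, h4⟩ := mainBits_inj.1 h1
  exact Vtx.ext h.1 h3 h4 (List.ofFn_injective h2)

theorem Vtx.getD_bits_main (v : M.Vtx d) {k : ℕ} (hk : k < M.len d) :
    v.bits.getD (1 + k) false = (mainBits v.phase v.main).getD k false := by
  rw [bits, add_comm, List.getD_cons_succ, List.getD_append _ _ _ _ (by rwa [length_mainBits])]

theorem Vtx.getD_bits_ctrl (v : M.Vtx d) (j : Fin M.q) :
    v.bits.getD (2 + j) false = v.main.1 j := by
  rw [show 2 + (j : ℕ) = 1 + (j + 1) by ring, getD_bits_main _ (by have := j.2; rw [len]; omega),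
    mainBits, List.getD_cons_succ, List.getD_append _ _ _ _ (by simp), getD_ofFn]

theorem Vtx.getD_bits_timer (v : M.Vtx d) (k : Fin (M.len d)) :
    v.bits.getD (M.len d + 1 + k) false = v.timer k := by
  rw [bits, show M.len d + 1 + k = M.len d + k + 1 by ring, List.getD_cons_succ,
    getD_append_add (length_mainBits _ _), getD_ofFn]

variable (M) in
/-- The wire of a bit of the tape. -/
def cellWire (i j : ℕ) : ℕ := 2 + M.q + M.w * i + j

theorem cellWire_lt (i : Fin (d + 2)) (j : Fin M.w) : M.cellWire i j < M.len d + 1 := by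
  have h1 : M.w * (i + 1) ≤ M.w * (d + 2) := Nat.mul_le_mul_left _ i.2
  have h2 := j.2
  rw [mul_add] at h1
  unfold cellWire len
  omega

theorem Vtx.getD_bits_cell (v : M.Vtx d) (i : Fin (d + 2)) (j : Fin M.w) :
    v.bits.getD (M.cellWire i j) false = v.main.2 i j := by
  have h := cellWire_lt i j
  unfold cellWire at h ⊢
  rw [show 2 + M.q + M.w * i + j = 1 + (1 + M.q + M.w * i + j) by ring,
    getD_bits_main _ (by omega), getD_mainBits_cell]

/-- The components of an index. -/
def Vtx.equivProd : M.Vtx d ≃ Bool × Bool × M.Main d × (Fin (M.len d) → Bool) where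
  toFun v := (v.aux, v.phase, v.main, v.timer)
  invFun p := ⟨p.1, p.2.1, p.2.2.1, p.2.2.2⟩

noncomputable instance : Fintype (M.Vtx d) := Fintype.ofEquiv _ Vtx.equivProd.symm

theorem card_vtx : Fintype.card (M.Vtx d) = 2 ^ (2 * M.len d + 1) := by
  rw [Fintype.card_congr Vtx.equivProd]
  simp only [Fintype.card_prod, Fintype.card_bool, Fintype.card_pi, Finset.prod_const,
    Finset.card_univ, Fintype.card_fin]
  -- `M.len d` counts the phase and the configuration; the timer has the same number of bits, and
  -- `aux` is the one left over.
  have h : 2 ^ M.len d = 2 * (2 ^ M.q * (2 ^ M.w) ^ (d + 2)) := by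
    rw [len, pow_add, pow_add, pow_mul]
    ring
  rw [pow_succ 2 (2 * M.len d), mul_comm 2 (M.len d), pow_mul, h]
  ring

/-- Indices and strings of bits. -/
noncomputable def Vtx.equivIndex {m : ℕ} (hm : m = 2 * M.len d + 1) :
    M.Vtx d ≃ (Fin m → Bool) :=
  Equiv.ofBijective (fun v b => v.bits.getD b false) <| by
    rw [Fintype.bijective_iff_injective_and_card, card_vtx]
    refine ⟨fun v v' h => Vtx.bits_injective ?_, by simp [hm]⟩
    refine List.ext_getElem (by rw [length_bits, length_bits]) fun k h1 h2 => ?_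
    have := congrFun h ⟨k, by rw [length_bits] at h1; omega⟩
    simpa [List.getD, h1, h2] using this

theorem Vtx.ofFn_equivIndex {m : ℕ} (hm : m = 2 * M.len d + 1) (v : M.Vtx d) :
    List.ofFn (Vtx.equivIndex hm v) = v.bits := by
  refine List.ext_getElem (by rw [length_bits, List.length_ofFn, hm]) fun k h1 h2 => ?_
  simp [equivIndex, List.getD, h2]

/-! ### Slots, the candidates for nonzero entries of a row -/

noncomputable instance : Fintype M.Pre :=
  Fintype.ofInjective (fun u => (u.aux, u.phase, u.ctrl, u.col)) fun u u' h => by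
    simp only [Prod.mk.injEq] at h
    exact Pre.ext h.1 h.2.1 h.2.2.1 h.2.2.2

variable (M) in
/-- The slots of a row. -/
inductive Slot where
  | loc (u : M.Pre)
  | fwd (q : Fin M.q → Bool)
  | bwd (q : Fin M.q → Bool)

variable (M) in
/-- The list of all slots. -/
noncomputable def slots : List M.Slot :=
  (Finset.univ : Finset M.Pre).toList.map .loc ++
    ((Finset.univ : Finset (Fin M.q → Bool)).toList.map .fwd ++
      (Finset.univ : Finset (Fin M.q → Bool)).toList.map .bwd)

theorem mem_slots (s : M.Slot) : s ∈ M.slots := by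
  cases s <;> simp [slots]

/-- The column of a slot. -/
def Slot.column (v : M.Vtx d) : M.Slot → M.Vtx d
  | loc u => v.setPre u
  | fwd q => v.fwd q
  | bwd q => v.bwd q

open Classical in
/-- The value of a slot, where the flags tell whether the timer is maximal, whether it is zero, and
whether the index is the initial one. -/
noncomputable def Slot.value (mx zr st : Bool) (p : M.Pre) : M.Slot → ℕ
  | loc u => locVal mx st p u
  | fwd q => if fwdOk mx q p then 1 else 0
  | bwd q => if bwdOk zr q p then 1 else 0

theorem Slot.value_le (mx zr st : Bool) (p : M.Pre) (s : M.Slot) : s.value mx zr st p ≤ 2 := by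
  cases s with
  | loc u => exact locVal_le _ _ _ _
  | fwd q => rw [value]; split_ifs <;> norm_num
  | bwd q => rw [value]; split_ifs <;> norm_num

/-- The value of a slot in the row of `v`. -/
noncomputable def Slot.entry (x : List Bool) (v : M.Vtx d) (s : M.Slot) : ℕ :=
  s.value (Timer.carry v.timer (M.len d)) (Timer.borrow v.timer (M.len d)) (v.isStart x) v.pre

theorem gram_eq_iff_slot (x : List Bool) (v v' : M.Vtx d) {k : ℕ} (hk : k ≠ 0) :
    (M.forest d x).gram v v' = k ↔ ∃ s : M.Slot, s.column v = v' ∧ s.entry x v = k := by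
  rw [gram_eq_iff x v v' hk]
  constructor
  · rintro (⟨u, h⟩ | ⟨q, h⟩ | ⟨q, h⟩)
    exacts [⟨.loc u, h⟩, ⟨.fwd q, h⟩, ⟨.bwd q, h⟩]
  · rintro ⟨u | q | q, h⟩
    exacts [.inl ⟨u, h⟩, .inr (.inl ⟨q, h⟩), .inr (.inr ⟨q, h⟩)]

end RotMachine

end GappedSuccinct

namespace GappedSuccinct

open Function

/-! ### Rules for expanding parametrized lists -/

section expand

variable {α β γ : Type} (sem : (Par → List Bool) → α → β) (ρ : Par → List Bool)

theorem expand_append (ps qs : List (Part α)) :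
    expand sem ρ (ps ++ qs) = expand sem ρ ps ++ expand sem ρ qs := List.flatMap_append

theorem expand_cons (p : Part α) (ps : List (Part α)) :
    expand sem ρ (p :: ps) = p.expand sem ρ ++ expand sem ρ ps := List.flatMap_cons

theorem expand_map_one (l : List α) : expand sem ρ (l.map .one) = l.map (sem ρ) := by
  induction l with
  | nil => rfl
  | cons a l ih => rw [List.map_cons, expand_cons, ih]; rfl

theorem map_expand (g : β → γ) (ps : List (Part α)) :
    (expand sem ρ ps).map g = expand (fun ρ a => g (sem ρ a)) ρ ps := by
  rw [expand, List.map_flatMap, expand]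
  congr 1
  funext p
  cases p with
  | one a => rfl
  | loop p body =>
    simp only [Part.expand]
    generalize ρ p = l
    generalize 0 = i
    induction l generalizing i with
    | nil => rfl
    | cons b l ih => rw [expandLoop, expandLoop, List.map_append, ih, List.map_map]; rfl

theorem expand_loop_const {p : Par} {n : ℕ} (hn : (ρ p).length = n) (body : List α) :
    (Part.loop p fun _ => body).expand sem ρ =
      (List.finRange n).flatMap fun i : Fin n =>
        body.map (sem (update ρ .idx (List.replicate i true))) := by
  have h : ∀ (l : List Bool) i, expandLoop sem ρ (fun _ => body) i l =
      (List.range l.length).flatMap fun k =>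
        body.map (sem (update ρ .idx (List.replicate (i + k) true))) := by
    intro l
    induction l with
    | nil => exact fun i => rfl
    | cons b l ih =>
      intro i
      rw [expandLoop, ih, List.length_cons, List.range_succ_eq_map, List.flatMap_cons,
        List.flatMap_map]
      simp only [add_zero, Nat.succ_eq_add_one, ← add_assoc, add_right_comm]
  rw [Part.expand, h, hn, ← List.map_coe_finRange_eq_range, List.flatMap_map]
  simp only [zero_add]

end expand

theorem val_lin_idx (ρ : Par → List Bool) (a b c k i : ℕ) :
    (lin a b c k).val (update ρ .idx (List.replicate i true)) =
      a * (ρ .pat).length + b * (ρ .cols).length + c * i + k := by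
  simp

/-! ### The gates for the timer and the comparison with the initial configuration -/

/-- The gates for the bit `idx` of the timer and of the pattern, whose value is `b`. The gates `1`
and `2` carry on the chains of the carry and borrow bits, the gate `4` carries on the comparison of
the configuration with the pattern, and the gates `8` and `11` give the bits of the incremented and
of the decremented timer. -/
def chainBody (b : Bool) : List SGate :=
  [.not (lin 1 0 1 1),
    .and (lin 2 0 12 2) (lin 1 0 1 1),
    .and (lin 2 0 12 3) (lin 2 0 12 13),
    .not (lin 0 0 1 1),
    .and (lin 2 0 12 5) (if b then lin 0 0 1 1 else lin 2 0 12 16),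
    .not (lin 2 0 12 2),
    .and (lin 1 0 1 1) (lin 2 0 12 18),
    .and (lin 2 0 12 13) (lin 2 0 12 2),
    .or (lin 2 0 12 19) (lin 2 0 12 20),
    .not (lin 2 0 12 3),
    .and (lin 1 0 1 1) (lin 2 0 12 22),
    .or (lin 2 0 12 23) (lin 2 0 12 15)]

/-- Constants, the starting points of the chains. -/
def chainStart : List SGate := .const false :: List.replicate 11 (.const true)

/-- The gates for the timer and the comparison with the initial configuration. -/
def chainParts : List (Part SGate) := chainStart.map .one ++ [.loop .pat chainBody]

section chain

variable {ρ : Par → List Bool} {T : ℕ}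

theorem length_expandLoop_chain (i : ℕ) (l : List Bool) :
    (expandLoop SGate.gate ρ chainBody i l).length = 12 * l.length := by
  induction l generalizing i with
  | nil => rfl
  | cons b l ih =>
    rw [expandLoop, List.length_append, ih, List.length_map, List.length_cons]
    simp only [chainBody, List.length_cons, List.length_nil]
    ring

theorem length_expand_chain (hT : (ρ .pat).length = T) :
    (expand SGate.gate ρ chainParts).length = 12 * T + 12 := by
  rw [chainParts, expand_append, expand_map_one, List.length_append, List.length_map, expand_cons,
    List.length_append, Part.expand, length_expandLoop_chain, hT]
  simp [chainStart, expand, add_comm]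

theorem gatesBelow_chainBody (hT : (ρ .pat).length = T) (i : ℕ) (b : Bool) :
    GatesBelow (2 * T + (12 * i + 13))
      ((chainBody b).map (SGate.gate (update ρ .idx (List.replicate i true)))) := by
  cases b <;>
  · simp only [chainBody, List.map_cons, List.map_nil, GatesBelow, SGate.gate, Gate.ArgsBelow,
      val_lin_idx, hT, if_true, if_false, Bool.false_eq_true, and_true]
    refine ⟨?_, ⟨?_, ?_⟩, ⟨?_, ?_⟩, ?_, ⟨?_, ?_⟩, ?_, ⟨?_, ?_⟩, ⟨?_, ?_⟩, ⟨?_, ?_⟩, ?_, ⟨?_, ?_⟩,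
      ?_, ?_⟩ <;> omega

theorem gatesBelow_chain (hT : (ρ .pat).length = T) :
    GatesBelow (2 * T + 1) (expand SGate.gate ρ chainParts) := by
  have h : ∀ (l : List Bool) (i : ℕ),
      GatesBelow (2 * T + (12 * i + 13)) (expandLoop SGate.gate ρ chainBody i l) := by
    intro l
    induction l with
    | nil => exact fun i => trivial
    | cons b l ih =>
      intro i
      rw [expandLoop, gatesBelow_append]
      refine ⟨gatesBelow_chainBody hT i b, ?_⟩
      have := ih (i + 1)
      rwa [show 2 * T + (12 * (i + 1) + 13) = 2 * T + (12 * i + 13) + 12 by ring] at this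
  rw [chainParts, expand_append, expand_map_one, gatesBelow_append]
  refine ⟨?_, ?_⟩
  · simp [chainStart, GatesBelow, SGate.gate, Gate.ArgsBelow, List.replicate]
  · rw [expand_cons, Part.expand]
    have := h (ρ .pat) 0
    simpa [chainStart, expand] using this

/-- Wire `0` is `aux`, wire `i + 1` is bit `i` of the phase and configuration, and wire `T + (i +
1)` is bit `i` of the timer. Block `i` begins at `2 * T + 12 * i + 13`; with period 12 its results
at offsets 14, 15 and 17 are the inputs of the next block at offsets 2, 3 and 5. For `i = 0` these
are wires of `chainStart`, whose length 12 serves this purpose. -/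
theorem chainBody_holds (hT : (ρ .pat).length = T) {W : List Bool} {i : ℕ} {b : Bool}
    (h : Holds W (2 * T + (12 * i + 13))
      ((chainBody b).map (SGate.gate (update ρ .idx (List.replicate i true))))) :
    W.getD (2 * T + (12 * i + 14)) false =
      (W.getD (2 * T + (12 * i + 2)) false && W.getD (T + (i + 1)) false) ∧
    W.getD (2 * T + (12 * i + 15)) false =
      (W.getD (2 * T + (12 * i + 3)) false && !W.getD (T + (i + 1)) false) ∧
    W.getD (2 * T + (12 * i + 17)) false =
      (W.getD (2 * T + (12 * i + 5)) false && (b == W.getD (i + 1) false)) ∧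
    W.getD (2 * T + (12 * i + 21)) false =
      xor (W.getD (T + (i + 1)) false) (W.getD (2 * T + (12 * i + 2)) false) ∧
    W.getD (2 * T + (12 * i + 24)) false =
      xor (W.getD (T + (i + 1)) false) (W.getD (2 * T + (12 * i + 3)) false) := by
  cases b <;>
  · simp only [chainBody, List.map_cons, List.map_nil, Holds, SGate.gate, Gate.eval,
      val_lin_idx, hT, if_true, if_false, Bool.false_eq_true, and_true, one_mul, zero_mul, add_zero,
      zero_add, add_assoc, Nat.reduceAdd] at h
    obtain ⟨h0, h1, h2, h3, h4, h5, h6, h7, h8, h9, h10, h11⟩ := h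
    rw [h1, h4, h11, h10, h9, h8, h7, h6, h5, h2, h0]
    try rw [h3]
    generalize W.getD (T + (i + 1)) false = t
    generalize W.getD (2 * T + (12 * i + 2)) false = u
    generalize W.getD (2 * T + (12 * i + 3)) false = v
    refine ⟨rfl, rfl, by simp, ?_, ?_⟩ <;> revert t u v <;> decide

theorem holds_chainBody {W : List Bool}
    (h : Holds W (2 * T + 1) (expand SGate.gate ρ chainParts)) (i : ℕ) (hi : i < (ρ .pat).length) :
    Holds W (2 * T + (12 * i + 13))
      ((chainBody (ρ .pat)[i]).map (SGate.gate (update ρ .idx (List.replicate i true)))) := by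
  have key : ∀ (l : List Bool) (i k : ℕ) (hk : k < l.length),
      Holds W (2 * T + (12 * i + 13)) (expandLoop SGate.gate ρ chainBody i l) →
      Holds W (2 * T + (12 * (i + k) + 13))
        ((chainBody l[k]).map (SGate.gate (update ρ .idx (List.replicate (i + k) true)))) := by
    intro l
    induction l with
    | nil => exact fun i k hk => by simp at hk
    | cons b l ih =>
      intro i k hk h
      rw [expandLoop, holds_append] at h
      cases k with
      | zero => exact h.1
      | succ k =>
        have := ih (i + 1) k (by simpa using hk) (by
          rw [show 2 * T + (12 * (i + 1) + 13) = 2 * T + (12 * i + 13) + 12 by ring]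
          exact h.2)
        rwa [show i + 1 + k = i + (k + 1) by ring] at this
  rw [chainParts, expand_append, expand_map_one, holds_append, expand_cons, Part.expand] at h
  have := key (ρ .pat) 0 i hi (by simpa [chainStart, expand] using h.2)
  simpa only [zero_add] using this

theorem chainStart_holds {W : List Bool}
    (h : Holds W (2 * T + 1) (expand SGate.gate ρ chainParts)) :
    W.getD (2 * T + 1) false = false ∧ W.getD (2 * T + 2) false = true ∧
      W.getD (2 * T + 3) false = true ∧ W.getD (2 * T + 5) false = true := by
  rw [chainParts, expand_append, expand_map_one, holds_append] at h
  obtain ⟨h0, h1, h2, h3, h4, -⟩ := h.1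
  exact ⟨h0, h1, h2, h4⟩

/-- The chains compute the carry and borrow bits and compare with the pattern. -/
theorem chain_eq (hT : (ρ .pat).length = T) {W : List Bool}
    (h : Holds W (2 * T + 1) (expand SGate.gate ρ chainParts)) {t : Fin T → Bool}
    (ht : ∀ k < T, W.getD (T + (k + 1)) false = Timer.bit t k) : ∀ i ≤ T,
    W.getD (2 * T + (12 * i + 2)) false = Timer.carry t i ∧
    W.getD (2 * T + (12 * i + 3)) false = Timer.borrow t i ∧
    (W.getD (2 * T + (12 * i + 5)) false = true ↔
      ∀ k < i, (ρ .pat).getD k false = W.getD (k + 1) false) := by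
  intro i
  induction i with
  | zero =>
    obtain ⟨-, h1, h2, h3⟩ := chainStart_holds h
    exact fun _ => ⟨h1, h2, iff_of_true h3 fun k hk => by omega⟩
  | succ i ih =>
    intro hi
    obtain ⟨i1, i2, i3⟩ := ih (by omega)
    have hi' : i < (ρ .pat).length := by omega
    obtain ⟨e1, e2, e3, -⟩ := chainBody_holds hT (holds_chainBody h i hi')
    rw [i1, ht i (by omega)] at e1
    rw [i2, ht i (by omega)] at e2
    refine ⟨e1, e2, ?_⟩
    rw [show 12 * (i + 1) + 5 = 12 * i + 17 by ring, e3, Bool.and_eq_true, i3, beq_iff_eq]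
    have hg : (ρ .pat)[i] = (ρ .pat).getD i false := by simp [List.getD, hi']
    rw [hg]
    constructor
    · rintro ⟨h1, h2⟩ k hk
      rcases Nat.lt_succ_iff_lt_or_eq.1 hk with hk | rfl
      exacts [h1 k hk, h2]
    · exact fun h => ⟨fun k hk => h k (by omega), h i (by omega)⟩

/-- Adding or subtracting one flips the bits reached by the carry or the borrow, and the chains
provide these. -/
theorem chain_inc_dec (hT : (ρ .pat).length = T) {W : List Bool}
    (h : Holds W (2 * T + 1) (expand SGate.gate ρ chainParts)) {t : Fin T → Bool}
    (ht : ∀ k < T, W.getD (T + (k + 1)) false = Timer.bit t k) (k : Fin T) :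
    W.getD (2 * T + (12 * k + 21)) false = Timer.inc t k ∧
    W.getD (2 * T + (12 * k + 24)) false = Timer.dec t k := by
  obtain ⟨i1, i2, -⟩ := chain_eq hT h ht k k.2.le
  obtain ⟨-, -, -, e4, e5⟩ := chainBody_holds hT (holds_chainBody h k (by omega))
  have hb : Timer.bit t k = t k := by simp [Timer.bit]
  rw [i1, ht k k.2, hb] at e4
  rw [i2, ht k k.2, hb] at e5
  exact ⟨e4, e5⟩

end chain

/-! ### Tables -/

/-- A slot of a row: formulas for the two bits of the value, and the wires of the column. -/
structure TableRow where
  lo : Fml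
  hi : Fml
  col : List (Part Lin)

section table

variable (v at' : ℕ → Lin)

/-- The gates of a table, where `o` is the number of the first gate. -/
def tableGates : List TableRow → ℕ → List SGate
  | [], _ => []
  | s :: ss, o => s.lo.gates v at' o ++ (s.hi.gates v at' (o + s.lo.size) ++
      tableGates ss (o + s.lo.size + s.hi.size))

/-- The outputs of a table. -/
def tableOutputs : List TableRow → ℕ → List (Part Lin)
  | [], _ => []
  | s :: ss, o => [.one (at' (o + s.lo.size - 1)), .one (at' (o + s.lo.size + s.hi.size - 1))] ++
      (s.col ++ tableOutputs ss (o + s.lo.size + s.hi.size))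

variable {v at'} {ρ : Par → List Bool} {B : ℕ}

theorem gatesBelow_table (hv : ∀ i, (v i).val ρ < B) (hat : ∀ o, (at' o).val ρ = B + o)
    (ss : List TableRow) : ∀ o,
    GatesBelow (B + o) ((tableGates v at' ss o).map (SGate.gate ρ)) := by
  induction ss with
  | nil => exact fun o => trivial
  | cons s ss ih =>
    intro o
    rw [tableGates, List.map_append, List.map_append, gatesBelow_append, gatesBelow_append,
      List.length_map, List.length_map, Fml.length_gates, Fml.length_gates, add_assoc, add_assoc,
      add_assoc]
    refine ⟨Fml.gatesBelow hv hat _ _, Fml.gatesBelow hv hat _ _, ?_⟩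
    have := ih (o + s.lo.size + s.hi.size)
    rwa [add_assoc] at this

theorem tableOutputs_lt (hat : ∀ o, (at' o).val ρ = B + o) (ss : List TableRow)
    (hs : ∀ s ∈ ss, ∀ p ∈ expand Lin.val ρ s.col, p < B) : ∀ o,
    ∀ p ∈ expand Lin.val ρ (tableOutputs at' ss o), p < B + o + (tableGates v at' ss o).length := by
  induction ss with
  | nil => exact fun o p hp => by simp [tableOutputs, expand] at hp
  | cons s ss ih =>
    intro o p hp
    have h1 := s.lo.size_pos
    have h2 := s.hi.size_pos
    rw [tableOutputs, expand_append, expand_append, List.mem_append, List.mem_append] at hp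
    rw [tableGates, List.length_append, List.length_append, Fml.length_gates, Fml.length_gates]
    rcases hp with hp | hp | hp
    · have : p = (at' (o + s.lo.size - 1)).val ρ ∨
          p = (at' (o + s.lo.size + s.hi.size - 1)).val ρ := by
        simpa [expand, Part.expand] using hp
      rw [hat, hat] at this
      omega
    · have := hs s (by simp) p hp
      omega
    · have := ih (fun s h => hs s (by simp [h])) _ p hp
      omega

/-- The two formulas of a row occupy consecutive blocks of gates, and the last gate of each block is
an output; the column is wired directly and needs no gates in the table. -/
theorem map_tableOutputs (hat : ∀ o, (at' o).val ρ = B + o) {W : List Bool} {η : ℕ → Bool}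
    (hη : ∀ i, W.getD ((v i).val ρ) false = η i) (ss : List TableRow) : ∀ o,
    Holds W (B + o) ((tableGates v at' ss o).map (SGate.gate ρ)) →
    (expand Lin.val ρ (tableOutputs at' ss o)).map (fun p => W.getD p false) =
      ss.flatMap fun s => [s.lo.eval η, s.hi.eval η] ++
        (expand Lin.val ρ s.col).map fun p => W.getD p false := by
  induction ss with
  | nil => exact fun o _ => rfl
  | cons s ss ih =>
    intro o h
    rw [tableGates, List.map_append, List.map_append, holds_append, holds_append,
      List.length_map, List.length_map, Fml.length_gates, Fml.length_gates, add_assoc, add_assoc,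
      add_assoc] at h
    have h1 := Fml.getD_of_holds hat hη _ _ h.1
    have h2 := Fml.getD_of_holds hat hη _ _ h.2.1
    have h3 := ih (o + s.lo.size + s.hi.size) (by rw [add_assoc]; exact h.2.2)
    rw [tableOutputs, expand_append, expand_append, List.map_append, List.map_append, h3,
      List.flatMap_cons, List.append_assoc]
    congr 1
    rw [← h1, ← h2, ← hat, ← hat]
    rfl

end table

end GappedSuccinct

namespace GappedSuccinct

open Function

/-- The opposite motion. -/
def Shift.rev : Shift → Shift
  | stay => stay
  | left => right
  | right => left

theorem Shift.offset_rev {d : ℕ} (s : Shift) : (s.rev.offset : Fin (d + 2)) = -s.offset := by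
  cases s <;> simp [rev, offset]

namespace RotMachine

variable {M : RotMachine} {d : ℕ}

theorem unrot_eq_rot (σ : Fin M.w → Shift) (cell : Fin (d + 2) → Fin M.w → Bool) :
    unrot σ cell = rot (fun j => (σ j).rev) cell := by
  funext i j
  rw [unrot, rot, Shift.offset_rev, sub_eq_add_neg]

/-! ### The wires of the columns -/

variable (M) in
/-- The source of the track `j` in column `0`. -/
def srcFirst (s : Shift) (j : ℕ) : Lin :=
  match s with
  | .stay => lin 0 0 0 (2 + M.q + j)
  | .left => lin 0 0 0 (2 + M.q + M.w + j)
  | .right => lin 0 M.w 0 (2 + M.q + M.w + j)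

variable (M) in
/-- The source of the track `j` in column `idx + 1`. -/
def srcInner (s : Shift) (j : ℕ) : Lin :=
  match s with
  | .stay => lin 0 0 M.w (2 + M.q + M.w + j)
  | .left => lin 0 0 M.w (2 + M.q + 2 * M.w + j)
  | .right => lin 0 0 M.w (2 + M.q + j)

variable (M) in
/-- The source of the track `j` in the last column. -/
def srcLast (s : Shift) (j : ℕ) : Lin :=
  match s with
  | .stay => lin 0 M.w 0 (2 + M.q + M.w + j)
  | .left => lin 0 0 0 (2 + M.q + j)
  | .right => lin 0 M.w 0 (2 + M.q + j)

/-- Rotations wrap round at columns `0` and `d + 1` only. These two are wired separately, while the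
`d` columns between them come from a loop over `cols`, with column `idx + 1` in round `idx`. -/
theorem val_srcFirst {ρ : Par → List Bool} (hcols : (ρ .cols).length = d) (s : Shift) (j : Fin M.w) :
    (M.srcFirst s j).val ρ = M.cellWire ((0 : Fin (d + 2)) + s.offset : Fin (d + 2)) j := by
  cases s with
  | stay => simp [srcFirst, cellWire, Shift.offset]
  | left => simp [srcFirst, cellWire, Shift.offset]
  | right =>
    have : ((0 + -1 : Fin (d + 2)) : ℕ) = d + 1 := by simp
    rw [Shift.offset, this]
    simp [srcFirst, cellWire, hcols]
    ring

theorem val_srcInner (ρ : Par → List Bool) (s : Shift) (i : Fin d) (j : Fin M.w) :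
    (M.srcInner s j).val (update ρ .idx (List.replicate i true)) =
      M.cellWire (i.castSucc.succ + s.offset : Fin (d + 2)) j := by
  cases s with
  | stay =>
    simp [srcInner, cellWire, Shift.offset]
    ring
  | left =>
    have : ((i.castSucc.succ + 1 : Fin (d + 2)) : ℕ) = i + 2 := by
      rw [Fin.val_add_one_of_lt (by rw [Fin.lt_def]; simp)]
      simp
    rw [Shift.offset, this]
    simp [srcInner, cellWire]
    ring
  | right =>
    have : ((i.castSucc.succ + -1 : Fin (d + 2)) : ℕ) = i := by
      rw [← sub_eq_add_neg, Fin.coe_sub_one, if_neg (Fin.succ_ne_zero _)]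
      simp
    rw [Shift.offset, this]
    simp [srcInner, cellWire]
    ring

theorem val_srcLast {ρ : Par → List Bool} (hcols : (ρ .cols).length = d) (s : Shift) (j : Fin M.w) :
    (M.srcLast s j).val ρ = M.cellWire (Fin.last (d + 1) + s.offset : Fin (d + 2)) j := by
  cases s with
  | stay =>
    simp [srcLast, cellWire, Shift.offset, hcols]
    ring
  | left => simp [srcLast, cellWire, Shift.offset]
  | right =>
    have : ((Fin.last (d + 1) + -1 : Fin (d + 2)) : ℕ) = d := by
      rw [← sub_eq_add_neg, Fin.coe_sub_one, if_neg (Fin.last_pos.ne')]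
      simp
    rw [Shift.offset, this]
    simp [srcLast, cellWire, hcols]
    ring

variable (M) in
/-- The wires of a column: the first bits are given, the other columns of the tape are rotated, and
`tm` gives the timer. -/
def columnParts (pre : List Lin) (σ : Fin M.w → Shift) (tm : Lin) : List (Part Lin) :=
  pre.map .one ++ ([.loop .cols fun _ => List.ofFn fun j => M.srcInner (σ j) j] ++
    ((List.ofFn fun j => M.srcLast (σ j) j).map .one ++ [.loop .pat fun _ => [tm]]))

/-- The value of a Boolean constant is on this wire. -/
def constWire (b : Bool) : Lin := lin 2 0 0 (if b then 2 else 1)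

variable (M) in
/-- The wires of the first bits after a rotation. -/
def rotPre (ph : Bool) (σ : Fin M.w → Shift) : List Lin :=
  [constWire false, constWire ph] ++ ((List.ofFn fun j : Fin M.q => lin 0 0 0 (2 + j)) ++
    List.ofFn fun j => M.srcFirst (σ j) j)

/-- The wires of the first bits in a local slot. -/
def Pre.wires (u : M.Pre) : List Lin :=
  [constWire u.aux, constWire u.phase] ++ ((List.ofFn fun j => constWire (u.ctrl j)) ++
    List.ofFn fun j => constWire (u.col j))

/-- The wires of the column of a slot. -/
def Slot.parts : M.Slot → List (Part Lin)
  | loc u => M.columnParts u.wires (fun _ => .stay) (lin 1 0 1 1)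
  | fwd q => M.columnParts (M.rotPre false (M.shift q)) (M.shift q) (lin 2 0 12 21)
  | bwd q => M.columnParts (M.rotPre true fun j => (M.shift q j).rev) (fun j => (M.shift q j).rev)
      (lin 2 0 12 24)

theorem expand_columnParts {β : Type} (f : ℕ → β) {ρ : Par → List Bool}
    (hcols : (ρ .cols).length = d) (hpat : (ρ .pat).length = M.len d) (pre : List Lin)
    (σ : Fin M.w → Shift) (a c k : ℕ) :
    (expand Lin.val ρ (M.columnParts pre σ (lin a 0 c k))).map f =
      pre.map (fun p => f (p.val ρ)) ++
      ((List.finRange d).flatMap fun i => List.ofFn fun j =>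
        f (M.cellWire (i.castSucc.succ + (σ j).offset : Fin (d + 2)) j)) ++
      (List.ofFn fun j => f (M.cellWire (Fin.last (d + 1) + (σ j).offset : Fin (d + 2)) j)) ++
      List.ofFn fun i : Fin (M.len d) => f (a * M.len d + c * i + k) := by
  rw [map_expand, columnParts, expand_append, expand_append, expand_append, expand_map_one,
    expand_map_one, expand_cons, expand_cons, expand_loop_const _ _ hcols,
    expand_loop_const _ _ hpat]
  simp only [expand, List.flatMap_nil, List.append_nil, List.map_ofFn, List.append_assoc]
  congr 1
  congr 1
  · congr 1
    funext i
    congr 1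
    funext j
    exact congrArg f (val_srcInner ρ _ _ _)
  congr 1
  · congr 1
    funext j
    exact congrArg f (val_srcLast hcols _ _)
  · simp only [List.map_cons, List.map_nil, val_lin_idx, hpat, zero_mul, add_zero]
    rw [List.ofFn_eq_map, List.map_eq_flatMap]

/-- The bits of an index, column by column. -/
theorem Vtx.bits_eq (v : M.Vtx d) : v.bits = [v.aux, v.phase] ++ (List.ofFn v.main.1 ++
    List.ofFn (v.main.2 0)) ++
    ((List.finRange d).flatMap fun i => List.ofFn (v.main.2 i.castSucc.succ)) ++
    List.ofFn (v.main.2 (Fin.last (d + 1))) ++ List.ofFn v.timer := by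
  rw [bits, mainBits, List.finRange_succ, List.flatMap_cons, List.flatMap_map,
    List.finRange_succ_last, List.flatMap_append, List.flatMap_map]
  simp

theorem map_parts {ρ : Par → List Bool} (hcols : (ρ .cols).length = d)
    (hpat : (ρ .pat).length = M.len d) {W : List Bool} {v : M.Vtx d}
    (hW : ∀ p < 2 * M.len d + 1, W.getD p false = v.bits.getD p false)
    (hC : Holds W (2 * M.len d + 1) (expand SGate.gate ρ chainParts))
    (ht : ∀ k < M.len d, W.getD (M.len d + (k + 1)) false = Timer.bit v.timer k) (s : M.Slot) :
    (expand Lin.val ρ s.parts).map (fun p => W.getD p false) = (s.column v).bits := by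
  have hconst : ∀ b, W.getD ((constWire b).val ρ) false = b := by
    obtain ⟨h0, h1, -⟩ := chainStart_holds hC
    intro b
    cases b
    · simpa [constWire, hpat] using h0
    · simpa [constWire, hpat] using h1
  have hcell : ∀ (i : Fin (d + 2)) (j : Fin M.w), W.getD (M.cellWire i j) false = v.main.2 i j := by
    intro i j
    rw [hW _ (by have := cellWire_lt i j; omega), Vtx.getD_bits_cell]
  have hctrl : ∀ j : Fin M.q, W.getD ((lin 0 0 0 (2 + j)).val ρ) false = v.main.1 j := by
    intro j
    have hj := j.2
    have : (lin 0 0 0 (2 + j)).val ρ = 2 + j := by simp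
    rw [this, hW _ (by rw [len]; omega), Vtx.getD_bits_ctrl]
  have htm := chain_inc_dec hpat hC ht
  -- This serves both directions, since rotating back is rotating by the reversed shifts.
  have hrot : ∀ (ph : Bool) (σ : Fin M.w → Shift) (t : Fin (M.len d) → Bool) (a c k : ℕ),
      (∀ i : Fin (M.len d), W.getD (a * M.len d + c * i + k) false = t i) →
      (expand Lin.val ρ (M.columnParts (M.rotPre ph σ) σ (lin a 0 c k))).map
        (fun p => W.getD p false) = Vtx.bits ⟨false, ph, (v.main.1, rot σ v.main.2), t⟩ := by
    intro ph σ t a c k h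
    rw [expand_columnParts _ hcols hpat, Vtx.bits_eq, rotPre]
    simp only [List.map_append, List.map_cons, List.map_nil, List.map_ofFn, comp_def, hconst, hctrl,
      val_srcFirst hcols, hcell, h]
    rfl
  cases s with
  | loc u =>
    rw [Slot.parts, expand_columnParts _ hcols hpat, Vtx.bits_eq, Pre.wires]
    have h1 : ∀ i : Fin d, update v.main.2 0 u.col i.castSucc.succ = v.main.2 i.castSucc.succ :=
      fun i => update_of_ne (Fin.succ_ne_zero _) _ _
    have h2 : update v.main.2 0 u.col (Fin.last (d + 1)) = v.main.2 (Fin.last (d + 1)) :=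
      update_of_ne Fin.last_pos.ne' _ _
    have h3 : ∀ i : Fin (M.len d), W.getD (1 * M.len d + 1 * i + 1) false = v.timer i := by
      intro i
      rw [one_mul, one_mul, add_assoc, ht i i.2]
      simp [Timer.bit]
    simp only [List.map_append, List.map_cons, List.map_nil, List.map_ofFn, comp_def, hconst,
      hcell, h3, Slot.column, Vtx.setPre, Shift.offset, add_zero, h1, h2, update_self]
  | fwd q =>
    refine hrot _ _ _ _ _ _ fun i => ?_
    rw [add_assoc]
    exact (htm i).1
  | bwd q =>
    refine (hrot _ _ (Timer.dec v.timer) _ _ _ fun i => ?_).trans ?_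
    · rw [add_assoc]
      exact (htm i).2
    · rw [← unrot_eq_rot]
      rfl

/-- The inputs, the constants and the chains take up `2 * T + 1`, `12` and `12 * T` wires, with `T =
M.len d`; the tables begin right after them. -/
theorem parts_lt {ρ : Par → List Bool} (hcols : (ρ .cols).length = d)
    (hpat : (ρ .pat).length = M.len d) (s : M.Slot) :
    ∀ p ∈ expand Lin.val ρ s.parts, p < 14 * M.len d + 13 := by
  have hconst : ∀ b, (constWire b).val ρ < 14 * M.len d + 13 := by
    intro b
    cases b <;> simp [constWire, hpat] <;> omega
  have hcell : ∀ (i : Fin (d + 2)) (j : Fin M.w), M.cellWire i j < 14 * M.len d + 13 := by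
    intro i j
    have := cellWire_lt i j
    omega
  have hctrl : ∀ j : Fin M.q, (lin 0 0 0 (2 + j)).val ρ < 14 * M.len d + 13 := by
    intro j
    have hj := j.2
    have : (lin 0 0 0 (2 + j)).val ρ = 2 + j := by simp
    rw [this, len]
    omega
  have key : ∀ (pre : List Lin) (σ : Fin M.w → Shift) (a c k : ℕ),
      (∀ p ∈ pre, p.val ρ < 14 * M.len d + 13) → a ≤ 2 → c ≤ 12 → k ≤ 24 →
      ∀ p ∈ expand Lin.val ρ (M.columnParts pre σ (lin a 0 c k)), p < 14 * M.len d + 13 := by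
    intro pre σ a c k hpre ha hc hk p hp
    have h := expand_columnParts (fun p => p) hcols hpat pre σ a c k
    rw [List.map_id'] at h
    simp only [h, List.mem_append, List.mem_map, List.mem_flatMap, List.mem_ofFn] at hp
    rcases hp with ((⟨q, hq, rfl⟩ | ⟨i, -, j, rfl⟩) | ⟨j, rfl⟩) | ⟨i, rfl⟩
    · exact hpre q hq
    · exact hcell _ _
    · exact hcell _ _
    · have h1 : a * M.len d ≤ 2 * M.len d := Nat.mul_le_mul_right _ ha
      have h2 : c * i ≤ 12 * i := Nat.mul_le_mul_right _ hc
      have := i.2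
      omega
  have hrot : ∀ ph σ, ∀ p ∈ M.rotPre ph σ, p.val ρ < 14 * M.len d + 13 := by
    intro ph σ p hp
    simp only [rotPre, List.mem_append, List.mem_cons, List.not_mem_nil, or_false,
      List.mem_ofFn] at hp
    rcases hp with (rfl | rfl) | ⟨j, rfl⟩ | ⟨j, rfl⟩
    · exact hconst _
    · exact hconst _
    · exact hctrl j
    · rw [val_srcFirst hcols]
      exact hcell _ _
  cases s with
  | loc u =>
    refine key _ _ _ _ _ (fun p hp => ?_) (by norm_num) (by norm_num) (by norm_num)
    simp only [Pre.wires, List.mem_append, List.mem_cons, List.not_mem_nil, or_false,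
      List.mem_ofFn] at hp
    rcases hp with (rfl | rfl) | ⟨j, rfl⟩ | ⟨j, rfl⟩ <;> exact hconst _
  | fwd q => exact key _ _ _ _ _ (hrot _ _) (by norm_num) (by norm_num) (by norm_num)
  | bwd q => exact key _ _ _ _ _ (hrot _ _) (by norm_num) (by norm_num) (by norm_num)

end RotMachine

end GappedSuccinct

namespace GappedSuccinct

open Function

namespace RotMachine

variable {M : RotMachine} {d : ℕ}

/-! ### The circuit of the rows -/

variable (M) in
/-- The wires of the variables of the tables. -/
def varWire (k : ℕ) : Lin :=
  if k < 2 + M.q + M.w then lin 0 0 0 k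
  else if k = 2 + M.q + M.w then lin 14 0 0 2
  else if k = 2 + M.q + M.w + 1 then lin 14 0 0 3
  else lin 14 0 0 5

/-- The wires of the gates of the tables. -/
def gateWire (o : ℕ) : Lin := lin 14 0 0 (13 + o)

variable (M) in
/-- The local part of an index, read off the variables. -/
def preOf (η : ℕ → Bool) : M.Pre :=
  ⟨η 0, η 1, fun j => η (2 + j), fun j => η (2 + M.q + j)⟩

/-- The value of a slot as a function of the variables. -/
noncomputable def Slot.valueOf (s : M.Slot) (η : ℕ → Bool) : ℕ :=
  s.value (η (2 + M.q + M.w)) (η (2 + M.q + M.w + 1))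
    (η (2 + M.q + M.w + 1) && η (2 + M.q + M.w + 2)) (M.preOf η)

/-- The table row of a slot. -/
noncomputable def Slot.row (s : M.Slot) : TableRow where
  lo := .ofFun (2 + M.q + M.w + 3) fun η => decide (s.valueOf η = 1)
  hi := .ofFun (2 + M.q + M.w + 3) fun η => decide (s.valueOf η = 2)
  col := s.parts

variable (M) in
/-- The circuit that outputs the rows of the matrix. -/
noncomputable def rowCircuit : SCircuit where
  arity := lin 2 0 0 1
  gates := chainParts ++ (tableGates M.varWire gateWire (M.slots.map Slot.row) 0).map .one
  outputs := tableOutputs gateWire (M.slots.map Slot.row) 0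

/-- The value depends on the local part of the index and three flags only. This is a constant number
of variables, so formulas of constant size suffice. -/
theorem Slot.valueOf_congr {s : M.Slot} {η η' : ℕ → Bool}
    (h : ∀ i < 2 + M.q + M.w + 3, η i = η' i) : s.valueOf η = s.valueOf η' := by
  have hp : M.preOf η = M.preOf η' := by
    refine Pre.ext (h _ (by omega)) (h _ (by omega)) ?_ ?_ <;> funext j <;>
      exact h _ (by have := j.2; omega)
  rw [valueOf, valueOf, hp, h _ (by omega), h _ (by omega), h _ (by omega)]

theorem Slot.eval_lo (s : M.Slot) (η : ℕ → Bool) :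
    s.row.lo.eval η = decide (s.valueOf η = 1) := by
  rw [row, Fml.eval_ofFun, valueOf_congr fun i hi => if_pos hi]

theorem Slot.eval_hi (s : M.Slot) (η : ℕ → Bool) :
    s.row.hi.eval η = decide (s.valueOf η = 2) := by
  rw [row, Fml.eval_ofFun, valueOf_congr fun i hi => if_pos hi]

section circuit

variable {ρ : Par → List Bool} {x : List Bool}

theorem val_gateWire (hpat : (ρ .pat).length = M.len d) (o : ℕ) :
    (gateWire o).val ρ = 14 * M.len d + 13 + o := by
  simp [gateWire, hpat, add_assoc]

theorem val_varWire_lt (hpat : (ρ .pat).length = M.len d) (k : ℕ) :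
    (M.varWire k).val ρ < 14 * M.len d + 13 := by
  have hl : M.w * (d + 2) = M.w * (d + 1) + M.w := by ring
  unfold varWire
  split_ifs <;> simp only [val_lin, hpat]
  · rw [len]
    omega
  all_goals omega

theorem gatesBelow_rowCircuit (hpat : (ρ .pat).length = M.len d) :
    GatesBelow (2 * M.len d + 1) (M.rowCircuit.circuit ρ).gates := by
  change GatesBelow _ (expand _ _ (_ ++ _))
  rw [expand_append, gatesBelow_append, expand_map_one, length_expand_chain hpat,
    show 2 * M.len d + 1 + (12 * M.len d + 12) = 14 * M.len d + 13 + 0 by ring]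
  exact ⟨gatesBelow_chain hpat, gatesBelow_table (val_varWire_lt hpat) (val_gateWire hpat) _ _⟩

theorem arity_rowCircuit (hpat : (ρ .pat).length = M.len d) :
    (M.rowCircuit.circuit ρ).arity = 2 * M.len d + 1 := by
  change (lin 2 0 0 1).val ρ = _
  simp [hpat]

theorem wellFormed_rowCircuit (hcols : (ρ .cols).length = d) (hpat : (ρ .pat).length = M.len d) :
    (M.rowCircuit.circuit ρ).WellFormed := by
  refine ⟨fun t ht => ?_, fun o ho => ?_⟩
  · rw [arity_rowCircuit hpat]
    exact (gatesBelow_rowCircuit hpat).getElem t ht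
  · have h := tableOutputs_lt (v := M.varWire) (val_gateWire hpat) (M.slots.map Slot.row) (by
      simp only [List.mem_map, forall_exists_index, and_imp]
      rintro _ s - rfl
      exact parts_lt hcols hpat s) 0 o ho
    rw [arity_rowCircuit hpat]
    change o < _ + (expand _ _ (_ ++ _)).length
    rw [expand_append, List.length_append, length_expand_chain hpat, expand_map_one,
      List.length_map]
    omega

theorem valueOf_wires (hpat : ρ .pat = mainBits false (M.init d x)) {W : List Bool} {v : M.Vtx d}
    (hW : ∀ p < 2 * M.len d + 1, W.getD p false = v.bits.getD p false)
    (hC : Holds W (2 * M.len d + 1) (expand SGate.gate ρ chainParts))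
    (ht : ∀ k < M.len d, W.getD (M.len d + (k + 1)) false = Timer.bit v.timer k) (s : M.Slot) :
    s.valueOf (fun k => W.getD ((M.varWire k).val ρ) false) = s.entry x v := by
  have hl : (ρ .pat).length = M.len d := by rw [hpat, length_mainBits]
  obtain ⟨hc, hb, hs⟩ := chain_eq hl hC ht (M.len d) le_rfl
  have h0 : ∀ k < 2 + M.q + M.w, W.getD ((M.varWire k).val ρ) false = v.bits.getD k false := by
    intro k hk
    have h1 : (M.varWire k).val ρ = k := by simp [varWire, hk]
    have h2 : M.w * (d + 2) = M.w * (d + 1) + M.w := by ring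
    rw [h1, hW]
    rw [len]
    omega
  have hp : M.preOf (fun k => W.getD ((M.varWire k).val ρ) false) = v.pre := by
    refine Pre.ext (h0 0 (by omega)) (h0 1 (by omega)) ?_ ?_ <;> funext j
    · exact (h0 _ (by have := j.2; omega)).trans (v.getD_bits_ctrl j)
    · refine (h0 _ (by have := j.2; omega)).trans ?_
      have := v.getD_bits_cell 0 j
      rwa [show M.cellWire ((0 : Fin (d + 2)) : ℕ) j = 2 + M.q + j by simp [cellWire]] at this
  have e1 : W.getD ((M.varWire (2 + M.q + M.w)).val ρ) false =
      Timer.carry v.timer (M.len d) := by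
    rw [← hc]
    congr 1
    simp [varWire, hl]
    ring
  have e2 : W.getD ((M.varWire (2 + M.q + M.w + 1)).val ρ) false =
      Timer.borrow v.timer (M.len d) := by
    rw [← hb]
    congr 1
    simp [varWire, hl]
    ring
  have e3 : W.getD ((M.varWire (2 + M.q + M.w + 2)).val ρ) false = true ↔
      v.phase = false ∧ v.main = M.init d x := by
    have : (M.varWire (2 + M.q + M.w + 2)).val ρ = 2 * M.len d + (12 * M.len d + 5) := by
      simp [varWire, hl]
      ring
    -- The comparison chain says that the bits agree with the pattern one by one, and bits determine
    -- phase and configuration.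
    rw [this, hs, ← mainBits_inj, ← hpat]
    constructor
    · intro h
      refine List.ext_getElem (by rw [hl, length_mainBits]) fun k h1 h2 => ?_
      have h3 : k < M.len d := by rwa [length_mainBits] at h1
      have := h k h3
      rw [hW _ (by omega), add_comm, v.getD_bits_main h3, List.getD_eq_getElem _ _ h1,
        List.getD_eq_getElem _ _ h2] at this
      exact this.symm
    · intro h k hk
      rw [hW _ (by omega), add_comm, v.getD_bits_main hk, h]
  have e4 : (W.getD ((M.varWire (2 + M.q + M.w + 1)).val ρ) false &&
      W.getD ((M.varWire (2 + M.q + M.w + 2)).val ρ) false) = v.isStart x := by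
    rw [Bool.eq_iff_iff, Bool.and_eq_true, e3, e2]
    simp only [Vtx.isStart, decide_eq_true_eq]
    tauto
  rw [Slot.valueOf, Slot.entry, hp, e4, e1, e2]

theorem eval_rowCircuit (hcols : (ρ .cols).length = d)
    (hpat : ρ .pat = mainBits false (M.init d x)) (v : M.Vtx d)
    {i : (M.rowCircuit.circuit ρ).Index} (hi : List.ofFn i = v.bits) :
    (M.rowCircuit.circuit ρ).eval i = M.slots.flatMap fun s =>
      [decide (s.entry x v = 1), decide (s.entry x v = 2)] ++ (s.column v).bits := by
  have hl : (ρ .pat).length = M.len d := by rw [hpat, length_mainBits]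
  set W := (M.rowCircuit.circuit ρ).wires i with hWdef
  have hW : ∀ p < 2 * M.len d + 1, W.getD p false = v.bits.getD p false := by
    intro p hp
    have : W = runGates v.bits (M.rowCircuit.circuit ρ).gates := by rw [← hi]; rfl
    rw [this, getD_runGates _ _ (by rwa [Vtx.length_bits])]
  have hH : Holds W (2 * M.len d + 1) (M.rowCircuit.circuit ρ).gates := by
    have h := gatesBelow_rowCircuit (M := M) hl
    have : W = runGates v.bits (M.rowCircuit.circuit ρ).gates := by rw [← hi]; rfl
    rw [this]
    rw [← v.length_bits] at h ⊢
    exact holds_runGates h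
  change Holds _ _ (expand _ _ (_ ++ _)) at hH
  rw [expand_append, holds_append, expand_map_one, length_expand_chain hl,
    show 2 * M.len d + 1 + (12 * M.len d + 12) = 14 * M.len d + 13 + 0 by ring] at hH
  obtain ⟨hC, hT⟩ := hH
  have ht : ∀ k < M.len d, W.getD (M.len d + (k + 1)) false = Timer.bit v.timer k := by
    intro k hk
    rw [hW _ (by omega), ← add_assoc, add_right_comm, v.getD_bits_timer ⟨k, hk⟩]
    simp [Timer.bit, hk]
  have h := map_tableOutputs (v := M.varWire) (val_gateWire hl)
    (η := fun k => W.getD ((M.varWire k).val ρ) false) (fun _ => rfl) (M.slots.map Slot.row) 0 hT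
  refine h.trans ?_
  rw [List.flatMap_map]
  congr 1
  funext s
  rw [Slot.eval_lo, Slot.eval_hi, valueOf_wires hpat hW hC ht, Slot.row,
    map_parts hcols hl hW hC ht]

/-- The circuit represents the matrix of the forest. -/
theorem represents_rowCircuit (hcols : (ρ .cols).length = d)
    (hpat : ρ .pat = mainBits false (M.init d x)) :
    ∃ φ : (M.rowCircuit.circuit ρ).Index ≃ M.Vtx d,
      (M.rowCircuit.circuit ρ).Represents ((M.forest d x).gram.submatrix φ φ) := by
  have hl : (ρ .pat).length = M.len d := by rw [hpat, length_mainBits]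
  have hm := arity_rowCircuit (M := M) hl
  refine ⟨(Vtx.equivIndex hm).symm, wellFormed_rowCircuit hcols hl, ?_⟩
  have heval : ∀ v : M.Vtx d, (M.rowCircuit.circuit ρ).eval (Vtx.equivIndex hm v) =
      M.slots.flatMap fun s =>
        [decide (s.entry x v = 1), decide (s.entry x v = 2)] ++ (s.column v).bits :=
    fun v => eval_rowCircuit hcols hpat v (Vtx.ofFn_equivIndex hm v)
  have hlen : ∀ (v : M.Vtx d), ∀ s ∈ M.slots,
      ([decide (s.entry x v = 1), decide (s.entry x v = 2)] ++ (s.column v).bits).length =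
        (M.rowCircuit.circuit ρ).arity + 2 := by
    intro v s _
    rw [List.length_append, Vtx.length_bits, hm, add_comm]
    rfl
  have hout : (M.rowCircuit.circuit ρ).outputs.length =
      M.slots.length * ((M.rowCircuit.circuit ρ).arity + 2) := by
    -- The number of outputs does not depend on the input, so it may be read off from any row.
    have h := congrArg List.length (heval (M.startVtx d x))
    rw [length_flatMap_of_chunks (hlen _), Circuit.eval, List.length_map] at h
    exact h
  have hnum : (M.rowCircuit.circuit ρ).numSlots = M.slots.length := by
    rw [Circuit.numSlots, hout, Nat.mul_div_cancel _ (by omega)]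
  refine ⟨⟨_, hout.trans (mul_comm _ _)⟩, fun i j k hk => ?_⟩
  obtain ⟨v, rfl⟩ := (Vtx.equivIndex hm).surjective i
  obtain ⟨v', rfl⟩ := (Vtx.equivIndex hm).surjective j
  rw [Matrix.submatrix_apply, Equiv.symm_apply_apply, Equiv.symm_apply_apply,
    gram_eq_iff_slot x v v' hk, hnum]
  have hcol : ∀ (n : ℕ) (hn : n < M.slots.length),
      (M.rowCircuit.circuit ρ).slotColumn (Vtx.equivIndex hm v) n =
        Vtx.equivIndex hm (M.slots[n].column v) := by
    intro n hn
    funext b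
    rw [Circuit.slotColumn, heval, add_assoc, getD_flatMap_of_chunks (hlen v) hn (by omega),
      getD_append_add (n := 2) rfl]
    rfl
  have hv : ∀ (n : ℕ) (hn : n < M.slots.length),
      (M.rowCircuit.circuit ρ).slotValue (Vtx.equivIndex hm v) n = M.slots[n].entry x v := by
    intro n hn
    have h0 := getD_flatMap_of_chunks (hlen v) hn (show 0 < _ by omega)
    have h1 := getD_flatMap_of_chunks (hlen v) hn (show 1 < _ by omega)
    rw [Circuit.slotValue, heval]
    rw [add_zero] at h0
    rw [h0, h1]
    -- As the value 3 does not occur, the low bit means that the value is 1 and the high bit that it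
    -- is 2.
    have : M.slots[n].entry x v ≤ 2 := Slot.value_le _ _ _ _ _
    change (decide (M.slots[n].entry x v = 1)).toNat +
      2 * (decide (M.slots[n].entry x v = 2)).toNat = _
    interval_cases M.slots[n].entry x v <;> rfl
  constructor
  · rintro ⟨s, h1, h2⟩
    obtain ⟨n, hn, rfl⟩ := List.getElem_of_mem (mem_slots s)
    exact ⟨n, hn, by rw [hcol n hn, h1], by rw [hv n hn, h2]⟩
  · rintro ⟨n, hn, h1, h2⟩
    rw [hcol n hn] at h1
    rw [hv n hn] at h2
    exact ⟨_, (Vtx.equivIndex hm).injective h1, h2⟩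

end circuit

end RotMachine

end GappedSuccinct

namespace GappedSuccinct

open Function

/-! ### Transport of the smallest eigenvalue -/

section eigenvalue

variable {ι κ : Type} [Fintype ι] [DecidableEq ι] [Fintype κ] [DecidableEq κ]

theorem hasEigenvalue_toLin'_iff (A : Matrix ι ι ℝ) (μ : ℝ) :
    Module.End.HasEigenvalue (Matrix.toLin' A) μ ↔ ∃ z ≠ 0, A.mulVec z = μ • z := by
  constructor
  · intro h
    obtain ⟨z, hz⟩ := h.exists_hasEigenvector
    exact ⟨z, hz.2, by simpa using hz.apply_eq_smul⟩
  · rintro ⟨z, hz, h⟩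
    exact Module.End.hasEigenvalue_of_hasEigenvector (x := z)
      ⟨Module.End.mem_eigenspace_iff.2 (by simpa using h), hz⟩

theorem hasEigenvalue_submatrix {A : Matrix ι ι ℝ} {μ : ℝ} (φ : κ ≃ ι)
    (h : Module.End.HasEigenvalue (Matrix.toLin' A) μ) :
    Module.End.HasEigenvalue (Matrix.toLin' (A.submatrix φ φ)) μ := by
  rw [hasEigenvalue_toLin'_iff] at h ⊢
  obtain ⟨z, hz, h⟩ := h
  refine ⟨z ∘ φ, fun h0 => hz ?_, ?_⟩
  · funext i
    simpa using congrFun h0 (φ.symm i)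
  · rw [Matrix.submatrix_mulVec_equiv, comp_assoc, Equiv.self_comp_symm, comp_id, h]
    rfl

theorem IsSmallestEigenvalue.submatrix {A : Matrix ι ι ℝ} {r : ℝ} (h : IsSmallestEigenvalue A r)
    (φ : κ ≃ ι) : IsSmallestEigenvalue (A.submatrix φ φ) r := by
  refine ⟨hasEigenvalue_submatrix φ h.1, fun μ hμ => h.2 ?_⟩
  have := hasEigenvalue_submatrix φ.symm hμ
  rwa [Matrix.submatrix_submatrix, Equiv.self_comp_symm, Matrix.submatrix_id_id] at this

end eigenvalue

theorem RotMachine.encodes_rowCircuit {M : RotMachine} {d : ℕ} [DecidableEq (M.Vtx d)]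
    {ρ : Par → List Bool} {x : List Bool} (hcols : (ρ .cols).length = d)
    (hpat : ρ .pat = mainBits false (M.init d x)) {r : ℝ}
    (hr : IsSmallestEigenvalue ((M.forest d x).gram.map (Nat.cast : ℕ → ℝ)) r) :
    EncodesPSDWithSmallestEigenvalue (M.rowCircuit.circuit ρ).encode r := by
  obtain ⟨φ, h⟩ := represents_rowCircuit hcols hpat
  refine ⟨_, _, rfl, h, fun i j => ?_, (M.forest d x).gram_isSymm.submatrix φ, ?_, ?_⟩
  · have := gram_le_two x (φ i) (φ j)
    rw [Matrix.submatrix_apply]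
    omega
  · exact (M.forest d x).posSemidef_gram.submatrix φ
  · exact hr.submatrix φ

theorem Circuit.arity_lt_length_encode (C : Circuit) : C.arity < C.encode.length := by
  simp [encode, encodeNat]

/-! ### Preparation of the parameters -/

open Prog Reg

/-- The registers can be brought to the contents `ρ x`, where `x` is the input, in polynomial
time. -/
def Prepared (ρ : List Bool → Par → List Bool) : Prop :=
  (∀ x, ρ x .idx = []) ∧ ∃ P, PolyExec P (fun x => update (fun _ => []) .inp x) ρ

theorem polyRegs_inp : PolyRegs fun x => update (fun _ => []) .inp x := by
  refine polyBdd_length.mono fun x => ?_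
  rw [Finset.sum_eq_single .inp (fun p _ hp => by simp [hp]) (by simp)]
  simp

theorem prepared_inp : Prepared fun x => update (fun _ => []) .inp x :=
  ⟨fun _ => rfl, .skip, fun _ => 0, polyBdd_const 0, fun _ => execLE_skip _⟩

theorem Prepared.assign {ρ : List Bool → Par → List Bool} (h : Prepared ρ) {p : Par}
    (hp : p ≠ .idx) (is : List Item) :
    Prepared fun x => update (ρ x) p (itemsText (ρ x) is) := by
  obtain ⟨h1, P, h2⟩ := h
  refine ⟨fun x => ?_, _, h2.seq (polyExec_assign p is h1 (h2.polyRegs polyRegs_inp))⟩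
  simp only [update_of_ne hp.symm, h1]

theorem Prepared.polyTime {ρ : List Bool → Par → List Bool} (h : Prepared ρ) (is : List Item) :
    PolyTime fun x => itemsText (ρ x) is := by
  obtain ⟨h1, P, h2⟩ := h
  obtain ⟨T', hT', h3⟩ := execLE_finish is h1 (h2.polyRegs polyRegs_inp)
  obtain ⟨T, hT, h2⟩ := h2
  obtain ⟨q, hq⟩ := hT.add hT'
  refine polyTime_of_exec (.seq P (finish is)) (par .inp) fin _ q fun x => ?_
  have := ((h2 x).seq (h3 x)).mono (hq x)
  have hs : state (update (fun _ => []) .inp x) [] [] [] [] = only (par .inp) x := by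
    funext k
    cases k with
    | par p => cases p <;> simp [only, update, state]
    | _ => simp [only, update, state]
  rwa [hs] at this

/-- Polynomials are bounded by powers. -/
theorem exists_eval_le_pow (p : Polynomial ℕ) : ∃ C k, ∀ n, p.eval n ≤ (n + C) ^ k := by
  induction p using Polynomial.induction_on' with
  | add p q hp hq =>
    obtain ⟨C, k, hp⟩ := hp
    obtain ⟨C', k', hq⟩ := hq
    -- The extra exponent and the summand 2 in the base pay for the factor 2 that comes from adding
    -- two powers.
    refine ⟨C + C' + 2, k + k' + 1, fun n => ?_⟩
    have h1 : (n + C) ^ k ≤ (n + (C + C' + 2)) ^ (k + k') :=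
      (Nat.pow_le_pow_left (by omega) k).trans (Nat.pow_le_pow_right (by omega) (by omega))
    have h2 : (n + C') ^ k' ≤ (n + (C + C' + 2)) ^ (k + k') :=
      (Nat.pow_le_pow_left (by omega) k').trans (Nat.pow_le_pow_right (by omega) (by omega))
    rw [Polynomial.eval_add, pow_succ]
    have h3 := Nat.mul_le_mul_left ((n + (C + C' + 2)) ^ (k + k'))
      (show 2 ≤ n + (C + C' + 2) by omega)
    have := hp n
    have := hq n
    omega
  | monomial j a =>
    refine ⟨a, j + 1, fun n => ?_⟩
    rw [Polynomial.eval_monomial, pow_succ, mul_comm]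
    exact Nat.mul_le_mul (Nat.pow_le_pow_left (by omega) j) (by omega)

theorem itemsText_map_lit (ρ : Par → List Bool) (l : List Bool) :
    itemsText ρ (l.map fun b => .atom (.lit b)) = l := by
  induction l with
  | nil => rfl
  | cons b l ih => rw [List.map_cons, itemsText, List.flatMap_cons, ← itemsText, ih]; rfl

theorem atomsText_map_lit (ρ : Par → List Bool) (l : List Bool) :
    atomsText ρ (l.map .lit) = l := by
  induction l with
  | nil => rfl
  | cons b l ih => rw [List.map_cons, atomsText, List.flatMap_cons, ← atomsText, ih]; rfl

theorem loopText_map_lit (ρ : Par → List Bool) (f : Bool → List Bool) (l : List Bool) (i : ℕ) :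
    loopText ρ (fun b => (f b).map .lit) i l = l.flatMap f := by
  induction l generalizing i with
  | nil => rfl
  | cons b l ih => rw [loopText, atomsText_map_lit, ih, List.flatMap_cons]

theorem length_loopText_reg (ρ : Par → List Bool) {p : Par} (hp : p ≠ .idx) (l : List Bool)
    (i : ℕ) : (loopText ρ (fun _ => [.reg p]) i l).length = l.length * (ρ p).length := by
  induction l generalizing i with
  | nil => simp [loopText]
  | cons b l ih =>
    rw [loopText, List.length_append, ih, List.length_cons, add_mul, one_mul, add_comm]
    simp [atomsText, Atom.text, hp]

/-- A power of the length of the input can be prepared. -/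
theorem exists_prepared_pow (C k : ℕ) : ∃ ρ, Prepared ρ ∧ ∀ x, ρ x .inp = x ∧
    (ρ x .base).length = x.length + C ∧ (ρ x .pow).length = (x.length + C) ^ k := by
  induction k with
  | zero =>
    refine ⟨_, (prepared_inp.assign (p := .base) (by simp) (.atom (.reg .inp) ::
      (List.replicate C true).map fun b => .atom (.lit b))).assign (p := .pow) (by simp)
        [.atom (.lit true)], fun x => ⟨?_, ?_, ?_⟩⟩
    · simp
    · rw [update_of_ne (by simp), update_self, itemsText, List.flatMap_cons, ← itemsText,
        itemsText_map_lit]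
      simp [Item.text, Atom.text]
    · rw [update_self]
      simp [itemsText, Item.text, Atom.text]
  | succ k ih =>
    obtain ⟨ρ, h, hx⟩ := ih
    -- Printing `base` once for every bit of `pow` multiplies the lengths.
    refine ⟨_, h.assign (p := .pow) (by simp) [.loop .pow fun _ => [.reg .base]],
      fun x => ⟨?_, ?_, ?_⟩⟩
    · rw [update_of_ne (by simp), (hx x).1]
    · rw [update_of_ne (by simp), (hx x).2.1]
    · rw [update_self, itemsText, List.flatMap_cons, List.flatMap_nil, List.append_nil, Item.text,
        length_loopText_reg _ (by simp), (hx x).2.1, (hx x).2.2, pow_succ]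

/-- The bits of the initial configuration. -/
theorem RotMachine.mainBits_init (M : RotMachine) (x : List Bool) (N : ℕ) :
    mainBits false (M.init (x.length + N) x) = [false] ++ (List.ofFn M.start ++
      ((x.flatMap fun b => List.ofFn (M.code b)) ++ List.replicate ((N + 2) * M.w) false)) := by
  have h1 : ((List.finRange (x.length + N + 2)).flatMap fun i =>
      List.ofFn ((M.init (x.length + N) x).2 i)) =
      (List.range (x.length + (N + 2))).flatMap fun i => List.ofFn (M.startCell x i) := by
    rw [← add_assoc, ← List.map_coe_finRange_eq_range, List.flatMap_map]
    rfl
  have h2 : ((List.range x.length).flatMap fun i => List.ofFn (M.startCell x i)) =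
      x.flatMap fun b => List.ofFn (M.code b) := by
    rw [← List.map_coe_finRange_eq_range, List.flatMap_map]
    conv_rhs => rw [← List.map_get_finRange x, List.flatMap_map]
    congr 1
    funext i
    simp [startCell]
  have h3 : ∀ n, ((List.range n).flatMap fun i => List.ofFn (M.startCell x (x.length + i))) =
      List.replicate (n * M.w) false := by
    intro n
    have : ∀ i, List.ofFn (M.startCell x (x.length + i)) = List.replicate M.w false := by
      intro i
      simp [startCell, List.ofFn_const]
    simp only [this]
    induction n with
    | zero => simp
    | succ n ih =>
      rw [List.range_succ, List.flatMap_append, ih, add_mul, one_mul, List.replicate_add]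
      simp
  rw [List.range_add, List.flatMap_append, h2, List.flatMap_map, h3] at h1
  rw [mainBits, h1]
  rfl

/-- The parameters of the circuit can be prepared. -/
theorem RotMachine.exists_prepared (M : RotMachine) (C k : ℕ) :
    ∃ (ρ : List Bool → Par → List Bool) (d : List Bool → ℕ), Prepared ρ ∧ ∀ x,
      (x.length + C) ^ k ≤ d x ∧ (ρ x .cols).length = d x ∧
        ρ x .pat = mainBits false (M.init (d x) x) := by
  obtain ⟨ρ, h, hx⟩ := exists_prepared_pow C k
  -- With this number of columns the input fits on the tape, and the blank rest has `(x.length + C)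
  -- ^ k + 2` columns: a loop over `pow` and two literal columns.
  refine ⟨_, fun x => x.length + (x.length + C) ^ k,
    (h.assign (p := .cols) (by simp) [.atom (.reg .inp), .atom (.reg .pow)]).assign
    (p := .pat) (by simp) ([.atom (.lit false)] ++
      ((List.ofFn M.start).map (fun b => .atom (.lit b)) ++
        ([.loop .inp fun b => (List.ofFn (M.code b)).map .lit] ++
          ([.loop .pow fun _ => (List.replicate M.w false).map .lit] ++
            (List.replicate (2 * M.w) false).map fun b => .atom (.lit b))))),
    fun x => ⟨Nat.le_add_left _ _, ?_, ?_⟩⟩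
  · rw [update_of_ne (by simp), update_self]
    simp [itemsText, Item.text, Atom.text, hx x]
  · have h0 : ∀ l : List Bool, (l.flatMap fun _ => List.replicate M.w false) =
        List.replicate (l.length * M.w) false := by
      intro l
      induction l with
      | nil => simp
      | cons b l ih =>
        rw [List.flatMap_cons, ih, List.length_cons, add_mul, one_mul, add_comm,
          List.replicate_add]
    have h1 : ∀ (ρ : Par → List Bool) p body, itemsText ρ [.loop p body] =
        loopText ρ body 0 (ρ p) := fun ρ p body => List.append_nil _
    rw [update_self, mainBits_init, itemsText_append, itemsText_append, itemsText_append,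
      itemsText_append, itemsText_map_lit, itemsText_map_lit, h1, h1, loopText_map_lit,
      loopText_map_lit, h0, ← List.replicate_add, update_of_ne (by simp), update_of_ne (by simp),
      (hx x).1, (hx x).2.2, ← add_mul]
    rfl

/-! ### Hardness -/

theorem RotMachine.encodes_of_fixed {M : RotMachine} {d n : ℕ} {ρ : Par → List Bool}
    {x : List Bool} (hcols : (ρ .cols).length = d) (hpat : ρ .pat = mainBits false (M.init d x))
    {c : M.Main d} (hn : step^[n] (M.init d x) = c) (hc : step c = c) :
    if M.acc c.1 then (M.rowCircuit.circuit ρ).encode ∈ (GappedSuccinctDet (2 * .X + 3)).yes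
    else (M.rowCircuit.circuit ρ).encode ∈ (GappedSuccinctDet (2 * .X + 3)).no := by
  classical
  obtain ⟨v, hv, hreach, he⟩ := reach_final_of_fixed hn hc
  split_ifs with ha
  · exact encodes_rowCircuit hcols hpat
      ((M.forest d x).isSmallestEigenvalue_of_accept hreach hv (by
        change M.acc v.main.1 = true
        rw [he, ha]))
  · obtain ⟨r, hr, hle⟩ := (M.forest d x).exists_isSmallestEigenvalue_of_reject hreach hv (by
      change ¬ M.acc v.main.1 = true
      rw [he]
      exact ha)
    refine ⟨r, encodes_rowCircuit hcols hpat hr, le_trans ?_ hle⟩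
    -- The arity is written in unary, so the number `2 * M.len d + 1` of index bits is less than the
    -- length of the instance.
    have hlen := (M.rowCircuit.circuit ρ).arity_lt_length_encode
    rw [arity_rowCircuit (by rw [hpat, length_mainBits])] at hlen
    rw [card_vtx]
    refine inv_anti₀ (by positivity) ?_
    have h8 : (8 : ℝ) * ((2 ^ (2 * M.len d + 1) : ℕ) : ℝ) ^ 2 =
        2 ^ (2 * (2 * M.len d + 1) + 3) := by
      push_cast
      rw [← pow_mul, pow_add 2 _ 3, mul_comm (2 * M.len d + 1) 2]
      ring
    rw [h8]
    refine pow_le_pow_right₀ (by norm_num) ?_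
    simp
    omega

end GappedSuccinct

theorem mainTheorem4 :
    ∃ g : Polynomial ℕ, GappedSuccinct.PSPACEHard (GappedSuccinct.GappedSuccinctDet g) := by
  -- For `2 ^ m` indices the gap is at least the inverse of `8 * (2 ^ m) ^ 2 = 2 ^ (2 * m + 3)`, and
  -- `m` is less than the length of the instance.
  refine ⟨2 * .X + 3, ?_⟩
  rintro L ⟨M, p, hfin, hyes, hno⟩
  obtain ⟨R, C, hR⟩ := GappedSuccinct.exists_rotMachine M hfin
  -- The constant `C` is the extra room for stacks that grow in the middle of a simulated step.
  obtain ⟨D, k, hk⟩ := GappedSuccinct.exists_eval_le_pow (p + Polynomial.C C)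
  obtain ⟨ρ, d, hρ, h⟩ := R.exists_prepared D k
  have key : ∀ x b, GappedSuccinct.AnswersInSpace M x b (p.eval x.length) →
      ∃ (n : ℕ) (c : R.Main (d x)), GappedSuccinct.RotMachine.step^[n] (R.init (d x) x) = c ∧
        GappedSuccinct.RotMachine.step c = c ∧ R.acc c.1 = b := by
    intro x b hx
    refine hR x b _ (d x) hx ?_
    have h1 := hk x.length
    have h2 := (h x).1
    rw [Polynomial.eval_add, Polynomial.eval_C] at h1
    omega
  refine ⟨_, hρ.polyTime R.rowCircuit.items, fun x hx => ?_, fun x hx => ?_⟩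
  · obtain ⟨n, c, hn, hc, ha⟩ := key x true (hyes x hx)
    have := R.encodes_of_fixed (h x).2.1 (h x).2.2 hn hc
    rw [if_pos ha] at this
    rwa [GappedSuccinct.SCircuit.itemsText_items]
  · obtain ⟨n, c, hn, hc, ha⟩ := key x false (hno x hx)
    have := R.encodes_of_fixed (h x).2.1 (h x).2.2 hn hc
    rw [if_neg (by rw [ha]; simp)] at this
    rwa [GappedSuccinct.SCircuit.itemsText_items]
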